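/- **Setting.** Let $\mathcal X$ be a countable set of types. A type $x$ has an in-degree $d_x^+$ and an out-degree $d_x^-$ in $\{0,1,2,\dots\}$, an initial capital $\gamma_x>0$, end-user claims $\delta_x\in\mathbb R$, a continuous non-decreasing premium function $\alpha_x:[0,\infty)\to\mathbb R$, a shock distribution on $[0,1]$ with a density and a loss distribution on $(0,\infty)$ with density and c.d.f. $F_x$. For every $n$ there are $n$ agents, agent $i$ having type $x_i$, with $\sum_i d^+_{x_i}=\sum_i d^-_{x_i}$. Let $\mu^{(n)}_x$ be the fraction of agents of type $x$ and $\lambda^{(n)}=\sum_x d_x^+\mu_x^{(n)}=\sum_x d_x^-\mu_x^{(n)}$. **Loss reveal process.** Agent $i$ of type $x$ has $d_x^+$ incoming and $d_x^-$ outgoing half-edges and a random shock $\epsilon_i$ with the shock distribution of its type; the shocks are independent. The capital of $i$ at time $t$ is $$C_i(t)=\gamma_x(1-\epsilon_i)+\alpha_x(t)-\delta_x-(\text{sum of the losses revealed to } i \text{ by time } t),$$ and $i$ is ruined at time $t$ if $C_i(s)\le 0$ for some $s\in[0,t]$, otherwise solvent. Outgoing half-edges of ruined agents are called ruinous. Losses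 are revealed one by one. At each reveal an unrevealed ruinous outgoing half-edge (chosen in any way that depends only on the past) is matched with an incoming half-edge chosen uniformly at random among all remaining ones, and the owner of the latter, of type $y$ say, incurs a loss drawn from $F_y$. After a reveal at time $t_1$ (and at $t_1=0$) one waits an exponential time with parameter $\mathcal R_n(t_1)\ge 0$ for the next reveal (infinitely long if $\mathcal R_n(t_1)=0$); $\mathcal R_n$ is constant between reveals and its value may depend on the past in any way. Given the past, the waiting time, the chosen incoming half-edge and the loss are drawn independently apart from the dependence of the loss distribution on the type of the owner. Let $W_n(t)$ be the number of unrevealed ruinous outgoing half-edges at time $t$ and $\tau^\star_n=\inf\{t\ge0: W_n(t)=0\}\in[0,\infty]$, when the process stops, so $\mathcal R_n(t)=0$ for $t>\tau_n^\star$. Let $S^{(n)}(t)$ and $D^{(n)}(t)$ be the numbers of solvent and ruined agents, and $S^{(n)}_{x,\theta}(t)$ the number of solvent agents of type $x$ to which exactly $\theta$ losses have been revealed by time $t$ (links from ruined in-neighbours, counted with multiplicity). **Assumptions.** As $n\to\infty$, $\mu_x^{(n)}\to\mu_x$ for every $x$, where $\mu$ is a probability distribution on $\mathcal X$; and $\lambda^{(n)}\to\lambda:=\sum_x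 d_x^+\mu_x=\sum_x d_x^-\mu_x\in(0,\infty)$. There is a continuous function $\mathfrak R:[0,\infty)\to(0,\infty)$ with $\|\mathfrak R\|_{L^1}<\infty$ such that $\mathcal R_n(t)=n\mathfrak R(t)+o_p(n)$ for $t\le\tau_n^\star$, in the sense that $$\int_0^{\tau_n^\star}\Bigl|\frac{\mathcal R_n(t)}n-\mathfrak R(t)\Bigr|\,dt\ \stackrel{p}{\longrightarrow}\ 0 .$$ **Limit functions.** Put $b(d,z,\theta)=\binom d\theta z^\theta(1-z)^{d-\theta}$, $t_{\mathfrak R}(\lambda)=\inf\{t\ge 0:\int_0^t\mathfrak R(s)\,ds\ge\lambda\}$ (with $\inf\emptyset=\infty$) and $$\phi^{\mathfrak R}(t)=\frac1\lambda\int_0^{t\wedge t_{\mathfrak R}(\lambda)}\mathfrak R(s)\,ds .$$ For a shock $\epsilon$ and losses $\ell=(\ell^{(1)},\ell^{(2)},\dots)$ let $$\tau_{x,k}(\epsilon,\ell)=\inf\Bigl\{t\ge0:\gamma_x(1-\epsilon)+\alpha_x(t)-\delta_x\ge\sum_{i=1}^k\ell^{(i)}\Bigr\}.$$ For $0\le\theta\le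 d_x^+$ let $$\mathcal S^{\mathfrak R}_{x,\theta}(t)=\mathbb P\bigl(\tau_{x,0}(\epsilon_x,L_x)=0,\ U_{(1)}>\tau_{x,1}(\epsilon_x,L_x),\dots,U_{(\theta)}>\tau_{x,\theta}(\epsilon_x,L_x)\bigr),$$ where $\epsilon_x$ has the shock distribution of type $x$, $L_x$ consists of $\theta$ i.i.d. losses with c.d.f. $F_x$, $U_{(1)}\le\dots\le U_{(\theta)}$ are the order statistics of $\theta$ i.i.d. variables on $(0,t]$ with $\mathbb P(U\le y)=\int_0^y\mathfrak R/\int_0^t\mathfrak R$ for $0\le y\le t$, and all of these are independent. (For $t=0$ and $\theta\ge1$ the value is immaterial, since $b(d_x^+,\phi^{\mathfrak R}(0),\theta)=0$.) Finally let $f_S^{\mathfrak R}(t)=\sum_x\mu_x\sum_{\theta=0}^{d_x^+}b(d_x^+,\phi^{\mathfrak R}(t),\theta)\,\mathcal S^{\mathfrak R}_{x,\theta}(t)$, $f_D^{\mathfrak R}=1-f_S^{\mathfrak R}$ and $$f_W^{\mathfrak R}(t)=\lambda\bigl(1-\phi^{\mathfrak R}(t)\bigr)-\sum_x\mu_xd_x^-\sum_{\theta=0}^{d_x^+}b(d_x^+,\phi^{\mathfrak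 R}(t),\theta)\,\mathcal S^{\mathfrak R}_{x,\theta}(t).$$ **Theorem.** As $n\to\infty$, for all $x\in\mathcal X$ and $0\le\theta\le d_x^+$, $$\sup_{t\le\tau_n^\star}\Bigl|\frac{S^{(n)}_{x,\theta}(t)}n-\mu_x\,b(d_x^+,\phi^{\mathfrak R}(t),\theta)\,\mathcal S^{\mathfrak R}_{x,\theta}(t)\Bigr|\stackrel p\longrightarrow0,$$ and $$\sup_{t\le\tau_n^\star}\Bigl|\frac{S^{(n)}(t)}n-f_S^{\mathfrak R}(t)\Bigr|\stackrel p\longrightarrow0,\qquad \sup_{t\le\tau_n^\star}\Bigl|\frac{D^{(n)}(t)}n-f_D^{\mathfrak R}(t)\Bigr|\stackrel p\longrightarrow0,\qquad \sup_{t\le\tau_n^\star}\Bigl|\frac{W_n(t)}n-f_W^{\mathfrak R}(t)\Bigr|\stackrel p\longrightarrow0,$$ the suprema being over all $t\in[0,\infty)$ with $t\le\tau_n^\star$. -/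

import Mathlib

open MeasureTheory ProbabilityTheory Filter Topology Set
open scoped ENNReal

noncomputable section

/-- Convergence to zero in probability of a sequence of `[0,∞]`-valued functions `X n`, each living
on its own probability space. -/
def TendstoZeroInProb {Ω : ℕ → Type*} [∀ n, MeasurableSpace (Ω n)] (P : ∀ n, Measure (Ω n))
    (X : ∀ n, Ω n → ℝ≥0∞) : Prop :=
  ∀ ε : ℝ, 0 < ε → Tendsto (fun n => P n {ω | ENNReal.ofReal ε ≤ X n ω}) atTop (𝓝 0)

/-- The type-dependent parameters of the agents. Agents of type `x` have `inDeg x` incoming and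
`outDeg x` outgoing half-edges, initial capital `γ x`, premium accumulation function `α x` on
`[0,∞)`, end-user claims `δ x`, a random proportional shock in `[0,1]` with law `shockLaw x` and
positive random losses with law `lossLaw x`; both laws have a density. -/
structure RiskModel (X : Type*) where
  inDeg : X → ℕ
  outDeg : X → ℕ
  γ : X → ℝ
  δ : X → ℝ
  α : X → ℝ → ℝ
  shockLaw : X → Measure ℝ
  lossLaw : X → Measure ℝ
  γ_pos : ∀ x, 0 < γ x
  α_cont : ∀ x, ContinuousOn (α x) (Ici 0)
  α_mono : ∀ x, MonotoneOn (α x) (Ici 0)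
  shock_prob : ∀ x, IsProbabilityMeasure (shockLaw x)
  shock_density : ∀ x, shockLaw x ≪ volume
  shock_supp : ∀ x, shockLaw x (Icc 0 1)ᶜ = 0
  loss_prob : ∀ x, IsProbabilityMeasure (lossLaw x)
  loss_density : ∀ x, lossLaw x ≪ volume
  loss_supp : ∀ x, lossLaw x (Ioi 0)ᶜ = 0

namespace RiskModel

variable {X : Type*} (M : RiskModel X) {n : ℕ} (ty : Fin n → X)

/-- Incoming half-edges of the `n` agents, agent `i` being of type `ty i`. -/
abbrev InHalf : Type := Σ i : Fin n, Fin (M.inDeg (ty i))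

/-- Outgoing half-edges of the `n` agents. -/
abbrev OutHalf : Type := Σ i : Fin n, Fin (M.outDeg (ty i))

/-- The total number of incoming half-edges, that is, of links: `n λ⁽ⁿ⁾`. -/
def numLinks : ℕ := ∑ i, M.inDeg (ty i)

/-- The fraction of agents of type `x`. -/
def typeFraction (ty : Fin n → X) (x : X) : ℝ := (Nat.card {i : Fin n // ty i = x} : ℝ) / n

end RiskModel

/-- The random variables that drive a loss reveal process. At most `numLinks` losses are revealed;
reveals are numbered from `0`.
* `shock i` is the initial proportional shock of agent `i`;
* `rate k` is the loss reveal intensity after `k` reveals, up to the next reveal;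
* `clock k` is the unit exponential variable behind the waiting time for reveal `k`, which is
  `clock k / rate k`;
* `src k` is the ruinous outgoing half-edge whose counterparty is looked at in reveal `k`;
* `tgt k` is the incoming half-edge with which `src k` is matched;
* `loss k` is the loss which the owner of `tgt k` incurs in reveal `k`. -/
structure RevealData {X : Type*} (M : RiskModel X) {n : ℕ} (ty : Fin n → X) (Ω : Type*) where
  shock : Fin n → Ω → ℝ
  rate : Fin (M.numLinks ty) → Ω → ℝ
  clock : Fin (M.numLinks ty) → Ω → ℝ
  src : Fin (M.numLinks ty) → Ω → M.OutHalf ty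
  tgt : Fin (M.numLinks ty) → Ω → M.InHalf ty
  loss : Fin (M.numLinks ty) → Ω → ℝ

namespace RevealData

variable {X : Type*} {M : RiskModel X} {n : ℕ} {ty : Fin n → X} {Ω : Type*}
  (V : RevealData M ty Ω)

/-- The waiting time for reveal `k`; it is infinite when the intensity is zero. -/
def wait (k : Fin (M.numLinks ty)) (ω : Ω) : ℝ≥0∞ :=
  ENNReal.ofReal (V.clock k ω) / ENNReal.ofReal (V.rate k ω)

/-- The time at which the waiting for reveal `k` begins: the time of the preceding reveal, or `0`
for the first one. -/
def startTime (k : Fin (M.numLinks ty)) (ω : Ω) : ℝ≥0∞ :=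
  ∑ j with j < k, V.wait j ω

/-- The time of reveal `k` (infinite if it never takes place). -/
def revealTime (k : Fin (M.numLinks ty)) (ω : Ω) : ℝ≥0∞ :=
  V.startTime k ω + V.wait k ω

open Classical in
/-- The set of the reveals which have taken place by time `t`. -/
def revealed (ω : Ω) (t : ℝ) : Finset (Fin (M.numLinks ty)) :=
  {k | V.revealTime k ω ≤ ENNReal.ofReal t}

/-- The reveals by time `t` in which agent `i` incurs a loss. -/
def lossesOf (i : Fin n) (ω : Ω) (t : ℝ) : Finset (Fin (M.numLinks ty)) :=
  {k ∈ V.revealed ω t | (V.tgt k ω).1 = i}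

/-- The capital of agent `i` at time `t`. -/
def capital (i : Fin n) (ω : Ω) (t : ℝ) : ℝ :=
  M.γ (ty i) * (1 - V.shock i ω) + M.α (ty i) t - M.δ (ty i) - ∑ k ∈ V.lossesOf i ω t, V.loss k ω

open Classical in
/-- The set of ruined agents at time `t`: those whose capital has been at or below zero. -/
def ruined (ω : Ω) (t : ℝ) : Finset (Fin n) :=
  {i | ∃ s, 0 ≤ s ∧ s ≤ t ∧ V.capital i ω s ≤ 0}

/-- The number of ruined agents. -/
def D (ω : Ω) (t : ℝ) : ℕ := (V.ruined ω t).card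

/-- The number of solvent agents. -/
def S (ω : Ω) (t : ℝ) : ℕ := (V.ruined ω t)ᶜ.card

open Classical in
/-- The number of solvent agents of type `x` which have incurred exactly `θ` losses from ruined
neighbours. -/
def Sx (x : X) (θ : ℕ) (ω : Ω) (t : ℝ) : ℕ :=
  {i ∈ (V.ruined ω t)ᶜ | ty i = x ∧ (V.lossesOf i ω t).card = θ}.card

open Classical in
/-- The unrevealed ruinous outgoing half-edges at time `t`. -/
def ruinous (ω : Ω) (t : ℝ) : Finset (M.OutHalf ty) :=
  {o | o.1 ∈ V.ruined ω t ∧ ∀ k ∈ V.revealed ω t, V.src k ω ≠ o}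

/-- The number of unrevealed ruinous outgoing half-edges. -/
def W (ω : Ω) (t : ℝ) : ℕ := (V.ruinous ω t).card

/-- The first time at which no unrevealed ruinous half-edge is left (infinite if there is none). -/
def endTime (ω : Ω) : ℝ≥0∞ :=
  ⨅ (t : ℝ) (_ : 0 ≤ t ∧ V.W ω t = 0), ENNReal.ofReal t

/-- The loss reveal intensity at time `t`. -/
def intensity (ω : Ω) (t : ℝ) : ℝ :=
  if h : (V.revealed ω t).card < M.numLinks ty then V.rate ⟨_, h⟩ ω else 0

/-- `∫ |R(t) / n - r(t)| dt` over the times `0 ≤ t ≤ endTime`, where `R` is the intensity. -/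
def intensityError (r : ℝ → ℝ) (ω : Ω) : ℝ≥0∞ :=
  ∫⁻ t in {t : ℝ | 0 ≤ t ∧ ENNReal.ofReal t ≤ V.endTime ω},
    ENNReal.ofReal |V.intensity ω t / n - r t|

/-- The supremum over the times `0 ≤ t ≤ endTime` of `|F(t) / n - f(t)|`. -/
def supError (F : Ω → ℝ → ℕ) (f : ℝ → ℝ) (ω : Ω) : ℝ≥0∞ :=
  ⨆ (t : ℝ) (_ : 0 ≤ t ∧ ENNReal.ofReal t ≤ V.endTime ω), ENNReal.ofReal |(F ω t : ℝ) / n - f t|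

end RevealData

/-- The variables `V` form a loss reveal process on the directed configuration model, where `𝓖 k`
is the information available after `k` reveals. The intensity and the outgoing half-edge for the
next reveal may depend on this information in any way. Given it, the next outgoing half-edge is
matched with a uniformly chosen incoming half-edge among those not yet matched, the counterparty
incurs an independent loss with the law of its type, and the waiting time is an independent
exponential variable with parameter `rate k`. The process stops (the intensity is zero) once no
ruinous half-edge is left; the variables `clock`, `tgt`, `loss` are also drawn for later values
of `k`, where they have no effect. -/
structure IsLossReveal {X : Type*} {M : RiskModel X} {n : ℕ} {ty : Fin n → X} {Ω : Type*}
    [mΩ : MeasurableSpace Ω] (V : RevealData M ty Ω) (P : Measure Ω) (𝓖 : Filtration ℕ mΩ) :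
    Prop where
  isProb : IsProbabilityMeasure P
  shock_meas : ∀ i, Measurable[𝓖 0] (V.shock i)
  shock_law : ∀ i, P.map (V.shock i) = M.shockLaw (ty i)
  shock_indep : iIndepFun V.shock P
  rate_meas : ∀ k : Fin (M.numLinks ty), Measurable[𝓖 k] (V.rate k)
  rate_nonneg : ∀ k ω, 0 ≤ V.rate k ω
  src_meas : ∀ (k : Fin (M.numLinks ty)) (o : M.OutHalf ty), MeasurableSet[𝓖 k] {ω | V.src k ω = o}
  clock_meas : ∀ k : Fin (M.numLinks ty), Measurable[𝓖 (k + 1)] (V.clock k)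
  clock_pos : ∀ k ω, 0 < V.clock k ω
  tgt_meas : ∀ (k : Fin (M.numLinks ty)) (h : M.InHalf ty), MeasurableSet[𝓖 (k + 1)] {ω | V.tgt k ω = h}
  loss_meas : ∀ k : Fin (M.numLinks ty), Measurable[𝓖 (k + 1)] (V.loss k)
  step_law : ∀ (k : Fin (M.numLinks ty)) (A : Set Ω) (h : M.InHalf ty) (B C : Set ℝ),
    MeasurableSet[𝓖 k] A → MeasurableSet B → MeasurableSet C →
      P (A ∩ {ω | V.tgt k ω = h ∧ V.clock k ω ∈ B ∧ V.loss k ω ∈ C}) =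
        P (A ∩ {ω | ∀ j < k, V.tgt j ω ≠ h}) * ((M.numLinks ty - k : ℕ) : ℝ≥0∞)⁻¹ *
          expMeasure 1 B * M.lossLaw (ty h.1) C
  src_ruinous : ∀ k ω, V.startTime k ω ≠ ∞ → V.W ω (V.startTime k ω).toReal ≠ 0 →
    V.src k ω ∈ V.ruinous ω (V.startTime k ω).toReal
  rate_stop : ∀ k ω, V.startTime k ω ≠ ∞ → V.W ω (V.startTime k ω).toReal = 0 → V.rate k ω = 0

/-- `b(d,z,θ) = ℙ(Bin(d,z) = θ)`. -/
def binomProb (d : ℕ) (z : ℝ) (θ : ℕ) : ℝ := (d.choose θ : ℝ) * z ^ θ * (1 - z) ^ (d - θ)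

/-- The `k`-th smallest (counted from `0`) of the numbers `u 0, …, u (θ - 1)`. -/
def orderStat {θ : ℕ} (u : Fin θ → ℝ) (k : Fin θ) : ℝ := u (Tuple.sort u k)

/-- `t_r(λ) = inf {t ≥ 0 : ∫₀ᵗ r ≥ λ}`, with `inf ∅ = ∞`. -/
def exhaustTime (r : ℝ → ℝ) (lam : ℝ) : ℝ≥0∞ :=
  ⨅ (t : ℝ) (_ : 0 ≤ t ∧ lam ≤ ∫ s in 0..t, r s), ENNReal.ofReal t

/-- `φ(t) = λ⁻¹ ∫₀^{t ∧ t_r(λ)} r(s) ds`. -/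
def revealFraction (r : ℝ → ℝ) (lam t : ℝ) : ℝ :=
  (∫ s in 0..(min (ENNReal.ofReal t) (exhaustTime r lam)).toReal, r s) / lam

/-- The law of `U^{r,t}`: the probability measure on `(0,t]` with density proportional to `r`, so
that `ℙ(U ≤ y) = ∫₀ʸ r / ∫₀ᵗ r` for `0 ≤ y ≤ t`. -/
def arrivalLaw (r : ℝ → ℝ) (t : ℝ) : Measure ℝ :=
  cond (volume.withDensity fun s => ENNReal.ofReal (r s)) (Ioc 0 t)

namespace RiskModel

variable {X : Type*} (M : RiskModel X)

/-- The threshold time `τ_{x,k}(ε,ℓ) = inf {t ≥ 0 : γ(1-ε) + α(t) - δ ≥ ℓ⁽¹⁾ + ⋯ + ℓ⁽ᵏ⁾}`, with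
`inf ∅ = ∞`. -/
def thresholdTime (x : X) (ε : ℝ) {θ : ℕ} (ℓ : Fin θ → ℝ) (k : ℕ) : ℝ≥0∞ :=
  ⨅ (t : ℝ) (_ : 0 ≤ t ∧ ∑ i with i.val < k, ℓ i ≤ M.γ x * (1 - ε) + M.α x t - M.δ x),
    ENNReal.ofReal t

/-- `𝒮_{x,θ}(t) = ℙ(τ_{x,0} = 0, U₍₁₎ > τ_{x,1}, …, U₍θ₎ > τ_{x,θ})`, where the shock, the `θ`
losses and the `θ` arrival times are independent. -/
def survival (r : ℝ → ℝ) (x : X) (θ : ℕ) (t : ℝ) : ℝ :=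
  ((M.shockLaw x).prod ((Measure.pi fun _ : Fin θ => M.lossLaw x).prod
    (Measure.pi fun _ : Fin θ => arrivalLaw r t))).real
      {p | M.thresholdTime x p.1 p.2.1 0 = 0 ∧
        ∀ k : Fin θ, M.thresholdTime x p.1 p.2.1 (k + 1) < ENNReal.ofReal (orderStat p.2.2 k)}

/-- The limit of the fraction of solvent agents of type `x` with `θ` losses, per agent of this
type. -/
def limitSx (r : ℝ → ℝ) (lam : ℝ) (x : X) (θ : ℕ) (t : ℝ) : ℝ :=
  binomProb (M.inDeg x) (revealFraction r lam t) θ * M.survival r x θ t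

/-- `f_S`, the limiting fraction of solvent agents. -/
def limitS (r : ℝ → ℝ) (lam : ℝ) (μ : X → ℝ) (t : ℝ) : ℝ :=
  ∑' x, μ x * ∑ θ ∈ Finset.range (M.inDeg x + 1), M.limitSx r lam x θ t

/-- `f_D`, the limiting fraction of ruined agents. -/
def limitD (r : ℝ → ℝ) (lam : ℝ) (μ : X → ℝ) (t : ℝ) : ℝ := 1 - M.limitS r lam μ t

/-- `f_W`, the limiting fraction of unrevealed ruinous half-edges. -/
def limitW (r : ℝ → ℝ) (lam : ℝ) (μ : X → ℝ) (t : ℝ) : ℝ :=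
  lam * (1 - revealFraction r lam t) -
    ∑' x, μ x * M.outDeg x * ∑ θ ∈ Finset.range (M.inDeg x + 1), M.limitSx r lam x θ t

end RiskModel

end

/-! Every reveal draws uniformly among the incoming half-edges that are left, whatever rule selects
the ruinous half-edge and the intensity. Hence the reveal numbers are matched with the incoming
half-edges by a uniformly random bijection, and the shock of an agent, the losses on its incoming
half-edges and the reveal numbers hitting them have a joint law that does not see the dynamics
(`measure_match_agents`). With reveal numbers divided by `n`, this law is asymptotically that of a
shock, independent losses and independent uniform positions on `(0, lam]`, and two distinct agents
are asymptotically independent.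

The dynamics only decides at which real time a given reveal number is reached. The intensity
integrated up to reveal `k` is exactly the sum of the first `k` exponential clocks
(`integral_intensity_cumTime`). A law of large numbers for the clocks and the assumption on the
intensity then show that the number of reveals by time `t`, over `n`, is close to `cumRate r t`,
uniformly up to the end time. So position `v` stands for the time at which `cumRate r` equals `v`.

Capital drops only at losses, so solvency amounts to comparing the initial deficit plus the
accumulated losses with the premiums at the loss times. After the time change this is membership in
`barrier`, a condition on the data of the agent alone (`solvent_iff_dataEvent`). The small error in
the time change matters only for fragile agents, whose status changes when positions move slightly.
For almost every position at most one deficit is critical, and the shock has a density, so fragile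
data have small probability (`tendsto_measure_fragileSet`).

Agents of a given type whose data lie in a fixed set are counted by the second moment method
(`measure_le_abs_count_sub`). The required bounds all come from domination by independent data,
lower bounds being obtained from complements. Moving the position from `v` to `v'` changes a count
by at most `n (v' - v) + 1`, so a finite grid of positions gives uniformity in time.

The limiting probability is identified in `measureReal_surviveSet_cumRate`: the number of uniform
positions before `v` is binomial, these positions are then uniform on `(0, v]`, `cumRate` carries
the arrival law to that uniform law, and sorting independent losses by arrival does not change their
law. Sums over the types are truncated to finitely many types, and `W` follows from the exact
identity `W_add_numRevealed`. -/

namespace RevealData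

/-! ### Reveal times and reveal counts along a path. -/

variable {X : Type*} {M : RiskModel X} {n : ℕ} {ty : Fin n → X} {Ω : Type*}
  (V : RevealData M ty Ω)

/-- The time of the `k`-th reveal, `cumTime 0 = 0`. -/
noncomputable def cumTime (k : ℕ) (ω : Ω) : ℝ≥0∞ := ∑ j with j.val < k, V.wait j ω

/-- The number of reveals by time `t`. -/
noncomputable def numRevealed (ω : Ω) (t : ℝ) : ℕ := (V.revealed ω t).card

/-- The sum of the first `k` unit exponential clocks. -/
noncomputable def clockSum (k : ℕ) (ω : Ω) : ℝ := ∑ j with j.val < k, V.clock j ω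

theorem startTime_eq (k : Fin (M.numLinks ty)) (ω : Ω) : V.startTime k ω = V.cumTime k ω := rfl

theorem filter_val_lt_succ {m k : ℕ} (h : k < m) :
    (Finset.univ.filter fun j : Fin m => j.val < k + 1) =
      insert ⟨k, h⟩ (Finset.univ.filter fun j : Fin m => j.val < k) := by
  ext j
  simp only [Finset.mem_filter, Finset.mem_univ, true_and, Finset.mem_insert, Fin.ext_iff]
  omega

theorem cumTime_succ {k : ℕ} (h : k < M.numLinks ty) (ω : Ω) :
    V.cumTime (k + 1) ω = V.cumTime k ω + V.wait ⟨k, h⟩ ω := by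
  rw [cumTime, filter_val_lt_succ h, Finset.sum_insert (by simp), add_comm, cumTime]

theorem clockSum_succ {k : ℕ} (h : k < M.numLinks ty) (ω : Ω) :
    V.clockSum (k + 1) ω = V.clockSum k ω + V.clock ⟨k, h⟩ ω := by
  rw [clockSum, filter_val_lt_succ h, Finset.sum_insert (by simp), add_comm, clockSum]

theorem revealTime_eq (k : Fin (M.numLinks ty)) (ω : Ω) :
    V.revealTime k ω = V.cumTime (k + 1) ω := by
  rw [cumTime_succ V k.2, revealTime, startTime_eq]

@[simp] theorem cumTime_zero (ω : Ω) : V.cumTime 0 ω = 0 := by simp [cumTime]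

@[simp] theorem clockSum_zero (ω : Ω) : V.clockSum 0 ω = 0 := by simp [clockSum]

theorem cumTime_mono (ω : Ω) : Monotone fun k => V.cumTime k ω := fun a b (hab : a ≤ b) =>
  Finset.sum_le_sum_of_subset fun j => by simp only [Finset.mem_filter, Finset.mem_univ, true_and]; omega

theorem wait_ne_zero {ω : Ω} (hpos : ∀ k, 0 < V.clock k ω) (k : Fin (M.numLinks ty)) :
    V.wait k ω ≠ 0 := by
  rw [wait, ENNReal.div_ne_zero]
  exact ⟨by simpa using hpos k, ENNReal.ofReal_ne_top⟩

theorem cumTime_lt_succ {ω : Ω} (hpos : ∀ k, 0 < V.clock k ω) {k : ℕ} (h : k < M.numLinks ty)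
    (hfin : V.cumTime k ω ≠ ∞) : V.cumTime k ω < V.cumTime (k + 1) ω := by
  rw [cumTime_succ V h]
  exact ENNReal.lt_add_right hfin (wait_ne_zero V hpos _)

theorem clockSum_mono {ω : Ω} (hpos : ∀ k, 0 < V.clock k ω) :
    Monotone fun k => V.clockSum k ω := fun a b (hab : a ≤ b) =>
  Finset.sum_le_sum_of_subset_of_nonneg (fun j => by simp only [Finset.mem_filter, Finset.mem_univ, true_and]; omega)
    fun j _ _ => (hpos j).le

theorem mem_revealed {ω : Ω} {t : ℝ} {k : Fin (M.numLinks ty)} :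
    k ∈ V.revealed ω t ↔ V.cumTime (k + 1) ω ≤ ENNReal.ofReal t := by
  simp [revealed, revealTime_eq]

theorem numRevealed_le (ω : Ω) (t : ℝ) : V.numRevealed ω t ≤ M.numLinks ty := by
  simpa [numRevealed] using Finset.card_le_univ (V.revealed ω t)

/-- A lower set of `Fin m` is an initial segment, hence determined by its cardinality. Applied to
`revealed`, this replaces the set of reveals by the number `numRevealed`. -/
theorem _root_.Finset.mem_iff_lt_card_of_isLowerSet {m : ℕ} {s : Finset (Fin m)}
    (hs : ∀ a b : Fin m, a ≤ b → b ∈ s → a ∈ s) (k : Fin m) : k ∈ s ↔ k.val < s.card := by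
  constructor
  · intro hk
    have : Finset.Iic k ⊆ s := fun a ha => hs a k (Finset.mem_Iic.1 ha) hk
    have := Finset.card_le_card this
    simp at this
    omega
  · intro hk
    by_contra hn
    have : s ⊆ Finset.Iio k := fun a ha => by
      rw [Finset.mem_Iio]
      by_contra hak
      exact hn (hs k a (not_lt.1 hak) ha)
    have := Finset.card_le_card this
    simp at this
    omega

theorem mem_revealed_iff {ω : Ω} {t : ℝ} {k : Fin (M.numLinks ty)} :
    k ∈ V.revealed ω t ↔ k.val < V.numRevealed ω t := by
  refine Finset.mem_iff_lt_card_of_isLowerSet (fun a b hab hb => ?_) k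
  rw [mem_revealed] at hb ⊢
  exact (V.cumTime_mono ω (by have : a.val ≤ b.val := hab; omega)).trans hb

theorem cumTime_le_iff {ω : Ω} {t : ℝ} {k : ℕ} (hk : k ≤ M.numLinks ty) :
    V.cumTime k ω ≤ ENNReal.ofReal t ↔ k ≤ V.numRevealed ω t := by
  cases k with
  | zero => simp
  | succ k =>
    have := V.mem_revealed (ω := ω) (t := t) (k := ⟨k, hk⟩)
    rw [mem_revealed_iff] at this
    exact this.symm

theorem cumTime_numRevealed_le (ω : Ω) (t : ℝ) :
    V.cumTime (V.numRevealed ω t) ω ≤ ENNReal.ofReal t :=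
  (V.cumTime_le_iff (V.numRevealed_le ω t)).2 le_rfl

theorem lt_cumTime_succ {ω : Ω} {t : ℝ} (h : V.numRevealed ω t < M.numLinks ty) :
    ENNReal.ofReal t < V.cumTime (V.numRevealed ω t + 1) ω := by
  by_contra hn
  have := (V.cumTime_le_iff h).1 (not_lt.1 hn)
  omega

theorem numRevealed_mono (ω : Ω) : Monotone (V.numRevealed ω) := fun s t hst =>
  Finset.card_le_card fun k hk => by
    rw [mem_revealed] at hk ⊢
    exact hk.trans (ENNReal.ofReal_le_ofReal hst)

/-- Positive clocks make finite reveal times strictly increasing: no two reveals coincide, and the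
count at a reveal time is exact. -/
theorem numRevealed_cumTime {ω : Ω} (hpos : ∀ k, 0 < V.clock k ω) {k : ℕ}
    (hk : k ≤ M.numLinks ty) (hfin : V.cumTime k ω ≠ ∞) :
    V.numRevealed ω (V.cumTime k ω).toReal = k := by
  have h1 : k ≤ V.numRevealed ω (V.cumTime k ω).toReal := by
    rw [← cumTime_le_iff V hk, ENNReal.ofReal_toReal hfin]
  refine le_antisymm ?_ h1
  by_contra! h
  have hlt : k < M.numLinks ty := h.trans_le (V.numRevealed_le _ _)
  have := (V.cumTime_le_iff (t := (V.cumTime k ω).toReal) hlt).2 h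
  rw [ENNReal.ofReal_toReal hfin] at this
  exact absurd (V.cumTime_lt_succ hpos hlt hfin) (not_lt.2 this)

theorem numRevealed_zero {ω : Ω} (hpos : ∀ k, 0 < V.clock k ω) : V.numRevealed ω 0 = 0 := by
  simpa using V.numRevealed_cumTime hpos (k := 0) (Nat.zero_le _) (by simp)

/-! ### Intensity -/

theorem intensity_of_lt {ω : Ω} {t : ℝ} (h : V.numRevealed ω t < M.numLinks ty) :
    V.intensity ω t = V.rate ⟨_, h⟩ ω := dif_pos h

theorem intensity_nonneg {ω : Ω} (h0 : ∀ k, 0 ≤ V.rate k ω) (t : ℝ) : 0 ≤ V.intensity ω t := by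
  unfold intensity
  split_ifs
  exacts [h0 _, le_rfl]

theorem measurable_intensity (ω : Ω) : Measurable (V.intensity ω) := by
  have : V.intensity ω =
      (fun q : ℕ => if h : q < M.numLinks ty then V.rate ⟨q, h⟩ ω else 0) ∘ V.numRevealed ω := rfl
  rw [this]
  exact (measurable_of_countable _).comp (V.numRevealed_mono ω).measurable

/-- At rate zero the wait is a positive number divided by `0` in `ℝ≥0∞`, that is `∞`. -/
theorem rate_ne_zero_of_cumTime {ω : Ω} (hpos : ∀ k, 0 < V.clock k ω) {k : ℕ}
    (h : k < M.numLinks ty) (hfin : V.cumTime (k + 1) ω ≠ ∞) : V.rate ⟨k, h⟩ ω ≠ 0 := by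
  intro h0
  apply hfin
  rw [cumTime_succ V h, wait, h0, ENNReal.ofReal_zero, ENNReal.div_zero, add_top]
  simpa using hpos _

theorem intervalIntegrable_intensity (ω : Ω) (a b : ℝ) :
    IntervalIntegrable (V.intensity ω) volume a b := by
  have hb : ∃ C, ∀ t, ‖V.intensity ω t‖ ≤ C := by
    refine ⟨∑ k, ‖V.rate k ω‖, fun t => ?_⟩
    unfold intensity
    split_ifs
    · exact Finset.single_le_sum (f := fun k => ‖V.rate k ω‖) (fun _ _ => norm_nonneg _)
        (Finset.mem_univ _)
    · rw [norm_zero]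
      exact Finset.sum_nonneg fun _ _ => norm_nonneg _
  obtain ⟨C, hC⟩ := hb
  rw [intervalIntegrable_iff]
  exact Measure.integrableOn_of_bounded (M := C) (by simp)
    (V.measurable_intensity ω).aestronglyMeasurable (ae_of_all _ hC)

theorem integral_intensity_of_numRevealed {ω : Ω} {k : ℕ}
    (h : k < M.numLinks ty) (hfin : V.cumTime k ω ≠ ∞) {t : ℝ}
    (h1 : V.cumTime k ω ≤ ENNReal.ofReal t) (h2 : ENNReal.ofReal t ≤ V.cumTime (k + 1) ω)
    (h3 : 0 ≤ t) :
    ∫ s in (V.cumTime k ω).toReal..t, V.intensity ω s =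
      V.rate ⟨k, h⟩ ω * (t - (V.cumTime k ω).toReal) := by
  have hle : (V.cumTime k ω).toReal ≤ t := ENNReal.toReal_le_of_le_ofReal h3 h1
  have : ∫ s in (V.cumTime k ω).toReal..t, V.intensity ω s =
      ∫ s in (V.cumTime k ω).toReal..t, V.rate ⟨k, h⟩ ω := by
    -- The right endpoint is dropped because the count may already have jumped there.
    rw [intervalIntegral.integral_of_le hle, intervalIntegral.integral_of_le hle,
      ← integral_Ico_eq_integral_Ioc, ← integral_Ico_eq_integral_Ioc]
    refine setIntegral_congr_fun measurableSet_Ico fun s hs => ?_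
    have hs0 : 0 ≤ s := ENNReal.toReal_nonneg.trans hs.1
    have hk1 : k ≤ V.numRevealed ω s := by
      rw [← V.cumTime_le_iff h.le]
      exact ENNReal.le_ofReal_iff_toReal_le hfin hs0 |>.2 hs.1
    have hk2 : V.numRevealed ω s < k + 1 := by
      by_contra hn
      have := (V.cumTime_le_iff (t := s) h).2 (not_lt.1 hn)
      have h4 := h2.trans this
      rw [ENNReal.ofReal_le_ofReal_iff hs0] at h4
      exact absurd hs.2 (not_lt.2 h4)
    have hk : V.numRevealed ω s = k := by omega
    have := V.intensity_of_lt (ω := ω) (t := s) (by omega)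
    simpa [hk] using this
  rw [this, intervalIntegral.integral_const, smul_eq_mul, mul_comm]

theorem toReal_wait {ω : Ω} (hpos : ∀ k, 0 < V.clock k ω) (h0 : ∀ k, 0 ≤ V.rate k ω)
    {k : Fin (M.numLinks ty)} (hr : V.rate k ω ≠ 0) :
    (V.wait k ω).toReal = V.clock k ω / V.rate k ω := by
  rw [wait, ← ENNReal.ofReal_div_of_pos ((h0 k).lt_of_ne' hr), ENNReal.toReal_ofReal]
  exact div_nonneg (hpos k).le (h0 k)

/-- The random time change: during the wait for a reveal the intensity is constant and the wait is
clock over rate, so the rate cancels and the clock remains. -/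
theorem integral_intensity_cumTime {ω : Ω} (hpos : ∀ k, 0 < V.clock k ω)
    (h0 : ∀ k, 0 ≤ V.rate k ω) {k : ℕ} (hk : k ≤ M.numLinks ty) (hfin : V.cumTime k ω ≠ ∞) :
    ∫ s in (0 : ℝ)..(V.cumTime k ω).toReal, V.intensity ω s = V.clockSum k ω := by
  induction k with
  | zero => simp
  | succ k ih =>
    have hfin' : V.cumTime k ω ≠ ∞ :=
      ne_top_of_le_ne_top hfin (V.cumTime_mono ω (Nat.le_succ k))
    have hr := V.rate_ne_zero_of_cumTime hpos hk hfin
    rw [← intervalIntegral.integral_add_adjacent_intervals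
      (V.intervalIntegrable_intensity ω _ (V.cumTime k ω).toReal)
      (V.intervalIntegrable_intensity ω _ _), ih (by omega) hfin',
      V.integral_intensity_of_numRevealed hk hfin', clockSum_succ V hk]
    · congr 1
      have hsum := V.cumTime_succ hk ω
      have hw : V.wait ⟨k, hk⟩ ω ≠ ∞ := by
        intro hw; rw [hw, add_top] at hsum; exact hfin hsum
      rw [hsum, ENNReal.toReal_add hfin' hw, V.toReal_wait hpos h0 hr]
      field_simp
      ring
    · rw [ENNReal.ofReal_toReal hfin]; exact V.cumTime_mono ω (Nat.le_succ k)
    · rw [ENNReal.ofReal_toReal hfin]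
    · exact ENNReal.toReal_nonneg

theorem clockSum_le_integral_intensity {ω : Ω} (hpos : ∀ k, 0 < V.clock k ω)
    (h0 : ∀ k, 0 ≤ V.rate k ω) {t : ℝ} (ht : 0 ≤ t) :
    V.clockSum (V.numRevealed ω t) ω ≤ ∫ s in (0 : ℝ)..t, V.intensity ω s := by
  have hT := V.cumTime_numRevealed_le ω t
  have hfin : V.cumTime (V.numRevealed ω t) ω ≠ ∞ := ne_top_of_le_ne_top ENNReal.ofReal_ne_top hT
  rw [← V.integral_intensity_cumTime hpos h0 (V.numRevealed_le ω t) hfin,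
    ← intervalIntegral.integral_add_adjacent_intervals (b := (V.cumTime _ ω).toReal) (c := t)
      (V.intervalIntegrable_intensity ω _ _) (V.intervalIntegrable_intensity ω _ _)]
  have := intervalIntegral.integral_nonneg (μ := volume)
    (ENNReal.toReal_le_of_le_ofReal ht hT) fun s _ => V.intensity_nonneg h0 s
  linarith

/-- The wait in progress at time `t` contributes at most its whole clock. With
`clockSum_le_integral_intensity`, the integrated intensity lies between two consecutive clock sums.
-/
theorem integral_intensity_le_clockSum {ω : Ω} (hpos : ∀ k, 0 < V.clock k ω)
    (h0 : ∀ k, 0 ≤ V.rate k ω) {t : ℝ} (ht : 0 ≤ t) :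
    ∫ s in (0 : ℝ)..t, V.intensity ω s ≤ V.clockSum (V.numRevealed ω t + 1) ω := by
  have hT := V.cumTime_numRevealed_le ω t
  have hfin : V.cumTime (V.numRevealed ω t) ω ≠ ∞ := ne_top_of_le_ne_top ENNReal.ofReal_ne_top hT
  have hle := ENNReal.toReal_le_of_le_ofReal ht hT
  rw [← intervalIntegral.integral_add_adjacent_intervals
      (b := (V.cumTime (V.numRevealed ω t) ω).toReal) (c := t)
      (V.intervalIntegrable_intensity ω _ _) (V.intervalIntegrable_intensity ω _ _),
      V.integral_intensity_cumTime hpos h0 (V.numRevealed_le ω t) hfin]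
  rcases (V.numRevealed_le ω t).lt_or_eq with h | h
  · rw [clockSum_succ V h]
    gcongr
    rw [V.integral_intensity_of_numRevealed h hfin hT (V.lt_cumTime_succ h).le ht]
    rcases eq_or_ne (V.rate ⟨_, h⟩ ω) 0 with hr | hr
    · rw [hr, zero_mul]; exact (hpos _).le
    · have hlt := (V.lt_cumTime_succ h).le
      have hsum := V.cumTime_succ h ω
      have hw : V.wait ⟨_, h⟩ ω ≠ ∞ := by
        rw [wait]
        exact ENNReal.div_ne_top ENNReal.ofReal_ne_top
          (by simpa using (h0 _).lt_of_ne' hr)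
      rw [hsum] at hlt
      have := ENNReal.toReal_mono (ENNReal.add_ne_top.2 ⟨hfin, hw⟩) hlt
      rw [ENNReal.toReal_add hfin hw, V.toReal_wait hpos h0 hr, ENNReal.toReal_ofReal ht] at this
      rw [mul_comm, ← le_div_iff₀ ((h0 _).lt_of_ne' hr)]
      linarith
  -- Once all links are revealed the intensity is zero, and `clockSum` at index `numLinks + 1` has
  -- no further clock to add.
  · have h1 : ∫ s in (V.cumTime (V.numRevealed ω t) ω).toReal..t, V.intensity ω s = 0 := by
      rw [intervalIntegral.integral_of_le hle, ← integral_Ico_eq_integral_Ioc]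
      refine (setIntegral_congr_fun measurableSet_Ico fun s hs => ?_).trans (integral_zero _ _)
      have : V.numRevealed ω t ≤ V.numRevealed ω s := by
        rw [← V.cumTime_le_iff (V.numRevealed_le ω t)]
        exact ENNReal.le_ofReal_iff_toReal_le hfin (ENNReal.toReal_nonneg.trans hs.1) |>.2 hs.1
      have h2 : ¬ (V.revealed ω s).card < M.numLinks ty := by
        change ¬ V.numRevealed ω s < _
        omega
      simp [intensity, h2]
    rw [h1, add_zero]
    exact V.clockSum_mono hpos (Nat.le_succ _)

/-! ### The number of unrevealed ruinous half-edges -/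

theorem ruined_mono (ω : Ω) : Monotone (V.ruined ω) := fun s t hst i => by
  simp only [ruined, Finset.mem_filter, Finset.mem_univ, true_and]
  exact fun ⟨u, h1, h2, h3⟩ => ⟨u, h1, h2.trans hst, h3⟩

/-- A reveal that takes place has a nonzero rate, whereas `hlast` makes the rate zero when no
ruinous half-edge is left; so `hsrc` applies. -/
theorem src_mem_ruinous {ω : Ω} (hpos : ∀ k, 0 < V.clock k ω)
    (hsrc : ∀ k, V.startTime k ω ≠ ∞ → V.W ω (V.startTime k ω).toReal ≠ 0 →
      V.src k ω ∈ V.ruinous ω (V.startTime k ω).toReal)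
    (hlast : ∀ k, V.startTime k ω ≠ ∞ → V.W ω (V.startTime k ω).toReal = 0 → V.rate k ω = 0)
    {k : Fin (M.numLinks ty)} {t : ℝ} (hk : k ∈ V.revealed ω t) :
    V.src k ω ∈ V.ruinous ω (V.startTime k ω).toReal := by
  rw [mem_revealed] at hk
  have hfin1 := ne_top_of_le_ne_top ENNReal.ofReal_ne_top hk
  have hfin : V.startTime k ω ≠ ∞ := by
    rw [startTime_eq]; exact ne_top_of_le_ne_top hfin1 (V.cumTime_mono ω (Nat.le_succ _))
  exact hsrc k hfin fun hW => V.rate_ne_zero_of_cumTime hpos k.2 hfin1 (hlast k hfin hW)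

/-- Each reveal uses up a ruinous half-edge that no earlier reveal has used, and ruin is permanent.
This reduces `W` to the reveal count and the out-degrees of the ruined agents. -/
theorem W_add_numRevealed {ω : Ω} (hpos : ∀ k, 0 < V.clock k ω)
    (hsrc : ∀ k, V.startTime k ω ≠ ∞ → V.W ω (V.startTime k ω).toReal ≠ 0 →
      V.src k ω ∈ V.ruinous ω (V.startTime k ω).toReal)
    (hlast : ∀ k, V.startTime k ω ≠ ∞ → V.W ω (V.startTime k ω).toReal = 0 → V.rate k ω = 0)
    {t : ℝ} (ht : 0 ≤ t) :
    V.W ω t + V.numRevealed ω t = ∑ i ∈ V.ruined ω t, M.outDeg (ty i) := by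
  classical
  have hinj : Set.InjOn (fun k => V.src k ω) (V.revealed ω t) := by
    have key : ∀ a b : Fin (M.numLinks ty), a ∈ V.revealed ω t → b ∈ V.revealed ω t → a < b →
        V.src a ω ≠ V.src b ω := by
      intro a b ha hb hab
      have hb' := V.src_mem_ruinous hpos hsrc hlast hb
      simp only [ruinous, Finset.mem_filter] at hb'
      refine hb'.2.2 a ?_
      rw [mem_revealed] at hb
      have hfin1 := ne_top_of_le_ne_top ENNReal.ofReal_ne_top hb
      have hfin : V.cumTime b ω ≠ ∞ :=
        ne_top_of_le_ne_top hfin1 (V.cumTime_mono ω (Nat.le_succ _))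
      rw [mem_revealed, startTime_eq, ENNReal.ofReal_toReal hfin]
      exact V.cumTime_mono ω hab
    intro a ha b hb hab
    by_contra hne
    rcases lt_or_gt_of_ne hne with h | h
    · exact key a b ha hb h hab
    · exact key b a hb ha h hab.symm
  have hsplit : (V.ruined ω t).sigma (fun i => (Finset.univ : Finset (Fin (M.outDeg (ty i))))) =
      V.ruinous ω t ∪ (V.revealed ω t).image fun k => V.src k ω := by
    ext o
    simp only [ruinous, Finset.mem_sigma, Finset.mem_univ, and_true, Finset.mem_union,
      Finset.mem_filter, true_and, Finset.mem_image]
    constructor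
    · intro ho
      by_cases h : ∃ k ∈ V.revealed ω t, V.src k ω = o
      · exact Or.inr h
      · push Not at h
        exact Or.inl ⟨ho, h⟩
    · rintro (h | ⟨k, hk, rfl⟩)
      · exact h.1
      · have h1 := V.src_mem_ruinous hpos hsrc hlast hk
        simp only [ruinous, Finset.mem_filter] at h1
        refine V.ruined_mono ω ?_ h1.2.1
        rw [mem_revealed] at hk
        refine ENNReal.toReal_le_of_le_ofReal ht (le_trans ?_ hk)
        exact V.cumTime_mono ω (Nat.le_succ _)
  have hdisj : Disjoint (V.ruinous ω t) ((V.revealed ω t).image fun k => V.src k ω) := by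
    rw [Finset.disjoint_right]
    intro o ho
    obtain ⟨k, hk, rfl⟩ := Finset.mem_image.1 ho
    simp only [ruinous, Finset.mem_filter, not_and, not_forall]
    exact fun _ _ => ⟨k, hk, by simp⟩
  have hcard := congrArg Finset.card hsplit
  rw [Finset.card_union_of_disjoint hdisj, Finset.card_image_of_injOn hinj,
    Finset.card_sigma] at hcard
  simpa [W, numRevealed] using hcard.symm

/-! ### Solvency -/

/-- An agent is solvent if its capital has been positive initially and at the reveals of its
losses. -/
theorem notMem_ruined_iff {ω : Ω} (hpos : ∀ k, 0 < V.clock k ω) {t : ℝ} (ht : 0 ≤ t)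
    (i : Fin n) :
    i ∉ V.ruined ω t ↔ M.δ (ty i) - M.γ (ty i) * (1 - V.shock i ω) < M.α (ty i) 0 ∧
      ∀ k ∈ V.lossesOf i ω t, M.δ (ty i) - M.γ (ty i) * (1 - V.shock i ω) +
        ∑ j ∈ V.lossesOf i ω t with j ≤ k, V.loss j ω <
          M.α (ty i) (V.cumTime (k + 1) ω).toReal := by
  classical
  have hcap : ∀ k ∈ V.lossesOf i ω t, 0 ≤ (V.cumTime (k + 1) ω).toReal ∧
      (V.cumTime (k + 1) ω).toReal ≤ t ∧ V.lossesOf i ω (V.cumTime (k + 1) ω).toReal =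
        (V.lossesOf i ω t).filter (· ≤ k) := by
    intro k hk
    have hk' := hk
    simp only [lossesOf, Finset.mem_filter, mem_revealed] at hk'
    have hfin := ne_top_of_le_ne_top ENNReal.ofReal_ne_top hk'.1
    refine ⟨ENNReal.toReal_nonneg, ENNReal.toReal_le_of_le_ofReal ht hk'.1, ?_⟩
    have hkt : k.val < V.numRevealed ω t := V.mem_revealed_iff.1 (V.mem_revealed.2 hk'.1)
    ext j
    simp only [lossesOf, Finset.mem_filter, mem_revealed_iff, V.numRevealed_cumTime hpos k.2 hfin,
      Fin.le_def]
    constructor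
    · exact fun h => ⟨⟨by omega, h.2⟩, by omega⟩
    · exact fun h => ⟨by omega, h.1.2⟩
  have hmem : i ∉ V.ruined ω t ↔ ∀ s, 0 ≤ s → s ≤ t → 0 < V.capital i ω s := by
    simp [ruined]
  rw [hmem]
  constructor
  · intro h
    refine ⟨?_, fun k hk => ?_⟩
    · have h1 := h 0 le_rfl ht
      have h2 : V.lossesOf i ω 0 = ∅ := by
        ext k; simp [lossesOf, mem_revealed_iff, V.numRevealed_zero hpos]
      rw [capital, h2, Finset.sum_empty] at h1
      linarith
    · obtain ⟨h1, h2, h3⟩ := hcap k hk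
      have h4 := h _ h1 h2
      rw [capital, h3] at h4
      linarith
  -- As `α` is monotone, the capital does not decrease between losses; at time `s` it is compared
  -- with the capital at the last loss by then, or at time `0`.
  · rintro ⟨h1, h2⟩ s hs hst
    rcases (V.lossesOf i ω s).eq_empty_or_nonempty with he | hne
    · rw [capital, he, Finset.sum_empty]
      have := M.α_mono (ty i) (mem_Ici.2 le_rfl) (mem_Ici.2 hs) hs
      linarith
    · have hk := Finset.max'_mem _ hne
      set k := (V.lossesOf i ω s).max' hne with hkdef
      have hsub : V.lossesOf i ω s ⊆ V.lossesOf i ω t := by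
        intro j hj
        simp only [lossesOf, Finset.mem_filter, mem_revealed_iff] at hj ⊢
        exact ⟨hj.1.trans_le (V.numRevealed_mono ω hst), hj.2⟩
      have h3 := h2 k (hsub hk)
      have h4 : V.lossesOf i ω s = (V.lossesOf i ω t).filter (· ≤ k) := by
        ext j
        rw [Finset.mem_filter]
        refine ⟨fun hj => ⟨hsub hj, Finset.le_max' _ _ hj⟩, fun hj => ?_⟩
        have hj1 := hj.1
        simp only [lossesOf, Finset.mem_filter, mem_revealed_iff] at hj1 hk ⊢
        exact ⟨(show j.val ≤ k.val from hj.2).trans_lt hk.1, hj1.2⟩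
      rw [← h4] at h3
      have hks : (V.cumTime (k + 1) ω).toReal ≤ s := by
        refine ENNReal.toReal_le_of_le_ofReal hs ?_
        rw [← mem_revealed]
        exact (Finset.mem_filter.1 hk).1
      have := M.α_mono (ty i) (mem_Ici.2 ENNReal.toReal_nonneg) (mem_Ici.2 hs) hks
      rw [capital]
      linarith

end RevealData

/-! ### The joint law of shocks, targets and losses. -/

namespace IsLossReveal

variable {X : Type*} {M : RiskModel X} {n : ℕ} {ty : Fin n → X} {Ω : Type*}
  [mΩ : MeasurableSpace Ω] {V : RevealData M ty Ω} {P : Measure Ω} {𝓖 : Filtration ℕ mΩ}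

theorem measurableSet_tgt (hV : IsLossReveal V P 𝓖) (k : Fin (M.numLinks ty))
    (h : M.InHalf ty) : MeasurableSet {ω | V.tgt k ω = h} :=
  𝓖.le _ _ (hV.tgt_meas k h)

theorem measurable_clock (hV : IsLossReveal V P 𝓖) (k : Fin (M.numLinks ty)) :
    Measurable (V.clock k) := (hV.clock_meas k).mono (𝓖.le _) le_rfl

theorem measurable_loss (hV : IsLossReveal V P 𝓖) (k : Fin (M.numLinks ty)) :
    Measurable (V.loss k) := (hV.loss_meas k).mono (𝓖.le _) le_rfl

theorem measurable_shock (hV : IsLossReveal V P 𝓖) (i : Fin n) :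
    Measurable (V.shock i) := (hV.shock_meas i).mono (𝓖.le _) le_rfl

/-- Summing `step_law` over the targets gives a factor free of `B`, times `expMeasure 1 B`. Taking
`B = univ` shows that the factor is `P A`, with no counting of the remaining half-edges. -/
theorem measure_inter_clock (hV : IsLossReveal V P 𝓖) (k : Fin (M.numLinks ty)) {A : Set Ω}
    (hA : MeasurableSet[𝓖 k] A) {B : Set ℝ} (hB : MeasurableSet B) :
    P (A ∩ {ω | V.clock k ω ∈ B}) = P A * expMeasure 1 B := by
  have hA' := 𝓖.le _ _ hA
  have key : ∀ B : Set ℝ, MeasurableSet B → P (A ∩ {ω | V.clock k ω ∈ B}) =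
      (∑ h, P (A ∩ {ω | ∀ j < k, V.tgt j ω ≠ h}) * ((M.numLinks ty - k : ℕ) : ℝ≥0∞)⁻¹) *
        expMeasure 1 B := by
    intro B hB
    have hU : A ∩ {ω | V.clock k ω ∈ B} = ⋃ h ∈ (Finset.univ : Finset (M.InHalf ty)),
        A ∩ {ω | V.tgt k ω = h ∧ V.clock k ω ∈ B ∧ V.loss k ω ∈ univ} := by
      ext ω; simp
    rw [hU, measure_biUnion_finset, Finset.sum_mul]
    · refine Finset.sum_congr rfl fun h _ => ?_
      have := M.loss_prob (ty h.1)
      rw [hV.step_law k A h B univ hA hB MeasurableSet.univ, measure_univ, mul_one]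
    · intro a _ b _ hab
      rw [Function.onFun, Set.disjoint_left]
      rintro ω ⟨_, h1, _⟩ ⟨_, h2, _⟩
      exact hab (h1.symm.trans h2)
    · intro h _
      refine hA'.inter ((hV.measurableSet_tgt k h).inter ?_)
      exact (hV.measurable_clock k hB).inter (hV.measurable_loss k MeasurableSet.univ)
  have h1 := key univ MeasurableSet.univ
  have := isProbabilityMeasure_expMeasure zero_lt_one
  simp only [mem_univ, ofPred_true, inter_univ, measure_univ, mul_one] at h1
  rw [key B hB, ← h1]

theorem map_clock (hV : IsLossReveal V P 𝓖) (k : Fin (M.numLinks ty)) :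
    P.map (V.clock k) = expMeasure 1 := by
  have := hV.isProb
  ext B hB
  rw [Measure.map_apply (hV.measurable_clock k) hB]
  have h := hV.measure_inter_clock k MeasurableSet.univ hB
  rwa [univ_inter, measure_univ, one_mul] at h

theorem indepFun_clock (hV : IsLossReveal V P 𝓖) {j k : Fin (M.numLinks ty)} (hjk : j ≠ k) :
    IndepFun (V.clock j) (V.clock k) P := by
  wlog h : j < k generalizing j k
  · exact (this hjk.symm (lt_of_le_of_ne (not_lt.1 h) hjk.symm)).symm
  rw [indepFun_iff_measure_inter_preimage_eq_mul]
  intro s t hs ht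
  have h1 : MeasurableSet[𝓖 k] (V.clock j ⁻¹' s) :=
    𝓖.mono (show (j : ℕ) + 1 ≤ k from h) _ (hV.clock_meas j hs)
  have h2 := hV.measure_inter_clock k h1 ht
  rw [← hV.map_clock k, Measure.map_apply (hV.measurable_clock k) ht] at h2
  exact h2

/-- By `step_law`, a half-edge has probability zero of being drawn on the event that it was drawn
before. -/
theorem ae_injective_tgt (hV : IsLossReveal V P 𝓖) :
    ∀ᵐ ω ∂P, Function.Injective fun k => V.tgt k ω := by
  have key : ∀ᵐ ω ∂P, ∀ j k : Fin (M.numLinks ty), j < k → ∀ h : M.InHalf ty,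
      ¬ (V.tgt j ω = h ∧ V.tgt k ω = h) := by
    simp only [ae_all_iff]
    intro j k hjk h
    rw [ae_iff]
    have h1 : MeasurableSet[𝓖 k] {ω | V.tgt j ω = h} :=
      𝓖.mono (show (j : ℕ) + 1 ≤ k from hjk) _ (hV.tgt_meas j h)
    have h2 := hV.step_law k _ h univ univ h1 MeasurableSet.univ MeasurableSet.univ
    have h3 : {ω | V.tgt j ω = h} ∩ {ω | ∀ j < k, V.tgt j ω ≠ h} = ∅ := by
      ext ω
      simp only [mem_inter_iff, mem_ofPred_eq, mem_empty_iff_false, iff_false, not_and, not_forall]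
      exact fun h' => ⟨j, hjk, by simpa using h'⟩
    rw [h3, measure_empty, zero_mul, zero_mul, zero_mul] at h2
    convert h2 using 2
    ext ω; simp
  filter_upwards [key] with ω hω j k hjk
  by_contra hne
  rcases lt_or_gt_of_ne hne with h | h
  · exact hω j k h _ ⟨hjk, rfl⟩
  · exact hω k j h _ ⟨rfl, hjk⟩

theorem card_inHalf : Fintype.card (M.InHalf ty) = M.numLinks ty := by
  simp [RiskModel.numLinks, Fintype.card_sigma]

theorem ae_bijective_tgt (hV : IsLossReveal V P 𝓖) :
    ∀ᵐ ω ∂P, Function.Bijective fun k => V.tgt k ω := by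
  filter_upwards [hV.ae_injective_tgt] with ω hω
  exact (Fintype.bijective_iff_injective_and_card _).2 ⟨hω, by rw [card_inHalf, Fintype.card_fin]⟩

theorem measureReal_step (hV : IsLossReveal V P 𝓖) (k : Fin (M.numLinks ty)) {A : Set Ω}
    (hA : MeasurableSet[𝓖 k] A) (h : M.InHalf ty) {C : Set ℝ} (hC : MeasurableSet C) :
    P.real (A ∩ {ω | V.tgt k ω = h ∧ V.loss k ω ∈ C}) =
      P.real (A ∩ {ω | ∀ j < k, V.tgt j ω ≠ h}) * ((M.numLinks ty - k : ℕ) : ℝ)⁻¹ *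
        (M.lossLaw (ty h.1)).real C := by
  have h1 := hV.step_law k A h univ C hA MeasurableSet.univ hC
  have := isProbabilityMeasure_expMeasure zero_lt_one
  simp only [mem_univ, true_and, measure_univ, mul_one] at h1
  simp [Measure.real, h1, ENNReal.toReal_mul]

section Joint

variable {ι : Type*} [Fintype ι] (V) (e : ι → M.InHalf ty) (f : ι → Fin (M.numLinks ty))
  (C : ι → Set ℝ)

/-- Up to reveal `k`, the half-edges `e i` are matched exactly in the reveals `f i`, with losses
in `C i`. -/
def partialMatch (k : ℕ) : Set Ω :=
  {ω | ∀ i, ((f i).val < k → V.tgt (f i) ω = e i ∧ V.loss (f i) ω ∈ C i) ∧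
    ∀ j : Fin (M.numLinks ty), j.val < k → V.tgt j ω = e i → j = f i}

variable {V e f C}

theorem measurableSet_partialMatch (hV : IsLossReveal V P 𝓖) (hC : ∀ i, MeasurableSet (C i))
    (k : ℕ) : MeasurableSet[𝓖 k] (partialMatch V e f C k) := by
  have h1 : ∀ (j : Fin (M.numLinks ty)) (h : M.InHalf ty), j.val < k →
      MeasurableSet[𝓖 k] {ω | V.tgt j ω = h} :=
    fun j h hj => 𝓖.mono (show (j : ℕ) + 1 ≤ k from hj) _ (hV.tgt_meas j h)
  have h2 : ∀ (j : Fin (M.numLinks ty)) (D : Set ℝ), MeasurableSet D → j.val < k →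
      MeasurableSet[𝓖 k] {ω | V.loss j ω ∈ D} :=
    fun j D hD hj => 𝓖.mono (show (j : ℕ) + 1 ≤ k from hj) _ (hV.loss_meas j hD)
  have : partialMatch V e f C k = ⋂ i,
      ((⋂ (_ : (f i).val < k), {ω | V.tgt (f i) ω = e i} ∩ {ω | V.loss (f i) ω ∈ C i}) ∩
      ⋂ (j : Fin (M.numLinks ty)) (_ : j.val < k) (_ : j ≠ f i), {ω | V.tgt j ω = e i}ᶜ) := by
    ext ω
    simp only [partialMatch, mem_ofPred_eq, mem_iInter, mem_inter_iff, mem_compl_iff]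
    refine forall_congr' fun i => and_congr Iff.rfl (forall_congr' fun j => forall_congr' fun _ => ?_)
    tauto
  rw [this]
  refine MeasurableSet.iInter fun i => MeasurableSet.inter
    (MeasurableSet.iInter fun hi => (h1 _ _ hi).inter (h2 _ _ (hC i) hi))
    (MeasurableSet.iInter fun j => MeasurableSet.iInter fun hj => MeasurableSet.iInter fun _ =>
      (h1 _ _ hj).compl)

open Classical in
-- Let `m` be the number of links and `ν k` the number of reveals from `k` on that are not of the
-- form `f i`. At a reveal `k = f i` the half-edge `e i` must be drawn, which has probability `1 /
-- (m - k)`, with an independent loss in `C i`. At any other reveal the half-edges `e i` not yet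
-- matched must be avoided, which has probability `ν k / (m - k)`. Multiplying these factors gives
-- quotients of factorials, stated here without division. The event `A` in `𝓖 0` is there to carry
-- the shocks.
theorem measureReal_partialMatch (hV : IsLossReveal V P 𝓖) (he : Function.Injective e)
    (hf : Function.Injective f) (hC : ∀ i, MeasurableSet (C i)) {A : Set Ω}
    (hA : MeasurableSet[𝓖 0] A) {k : ℕ} (hk : k ≤ M.numLinks ty) :
    P.real (A ∩ partialMatch V e f C k) * ((M.numLinks ty).factorial *
      (Finset.card {j : Fin (M.numLinks ty) | k ≤ j.val ∧ ∀ i, f i ≠ j}).factorial) =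
    P.real A * (∏ i with (f i).val < k, (M.lossLaw (ty (e i).1)).real (C i)) *
      ((M.numLinks ty - k).factorial * (M.numLinks ty - Fintype.card ι).factorial) := by
  have := hV.isProb
  induction k with
  | zero =>
    have h1 : partialMatch V e f C 0 = univ := by ext; simp [partialMatch]
    have h2 : Finset.card {j : Fin (M.numLinks ty) | 0 ≤ j.val ∧ ∀ i, f i ≠ j} =
        M.numLinks ty - Fintype.card ι := by
      have : (Finset.univ.filter fun j : Fin (M.numLinks ty) => 0 ≤ j.val ∧ ∀ i, f i ≠ j) =
          (Finset.univ.image f)ᶜ := by ext; simp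
      rw [this, Finset.card_compl, Finset.card_image_of_injective _ hf, Fintype.card_fin,
        Finset.card_univ]
    rw [h1, h2]
    simp
  | succ k ih =>
    have ih := ih (by omega)
    set B := A ∩ partialMatch V e f C k with hB
    have hBm : MeasurableSet[𝓖 k] B :=
      (𝓖.mono (Nat.zero_le k) _ hA).inter (measurableSet_partialMatch hV hC k)
    have hmk : (((M.numLinks ty - k : ℕ) : ℝ)) ≠ 0 := by
      rw [Nat.cast_ne_zero]; omega
    have hfac : ((M.numLinks ty - k).factorial : ℝ) =
        (M.numLinks ty - k : ℕ) * (M.numLinks ty - (k + 1)).factorial := by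
      rw [show M.numLinks ty - k = (M.numLinks ty - (k + 1)) + 1 by omega, Nat.factorial_succ]
      push_cast; ring
    by_cases hi : ∃ i, (f i).val = k
    · obtain ⟨i₀, hi₀⟩ := hi
      have hfi : f i₀ = ⟨k, hk⟩ := Fin.ext hi₀
      have hset : A ∩ partialMatch V e f C (k + 1) =
          B ∩ {ω | V.tgt ⟨k, hk⟩ ω = e i₀ ∧ V.loss ⟨k, hk⟩ ω ∈ C i₀} := by
        ext ω
        rw [hB, inter_assoc, mem_inter_iff, mem_inter_iff]
        refine and_congr_right fun _ => ?_
        simp only [partialMatch, mem_ofPred_eq, mem_inter_iff]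
        constructor
        · intro h
          refine ⟨fun i => ⟨fun h1 => (h i).1 (by omega), fun j hj => (h i).2 j (by omega)⟩, ?_⟩
          have := (h i₀).1 (by omega)
          rwa [hfi] at this
        · rintro ⟨h1, h2⟩ i
          refine ⟨fun h3 => ?_, fun j hj hje => ?_⟩
          · rcases Nat.lt_succ_iff_lt_or_eq.1 h3 with h4 | h4
            · exact (h1 i).1 h4
            · have : i = i₀ := hf (Fin.ext (h4.trans hi₀.symm))
              rw [this, hfi]; exact h2
          · rcases Nat.lt_succ_iff_lt_or_eq.1 hj with h4 | h4
            · exact (h1 i).2 j h4 hje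
            · have hj' : j = ⟨k, hk⟩ := Fin.ext h4
              rw [hj', h2.1] at hje
              rw [← he hje, hj', hfi]
      have hset2 : B ∩ {ω | ∀ j < (⟨k, hk⟩ : Fin (M.numLinks ty)), V.tgt j ω ≠ e i₀} = B := by
        refine inter_eq_left.2 fun ω hω j hj hje => ?_
        have := (hω.2 i₀).2 j hj hje
        rw [this, hfi] at hj
        exact lt_irrefl _ hj
      have hν : (Finset.univ.filter fun j : Fin (M.numLinks ty) => k + 1 ≤ j.val ∧ ∀ i, f i ≠ j) =
          Finset.univ.filter fun j : Fin (M.numLinks ty) => k ≤ j.val ∧ ∀ i, f i ≠ j := by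
        ext j
        simp only [Finset.mem_filter, Finset.mem_univ, true_and]
        refine ⟨fun h => ⟨by omega, h.2⟩, fun h => ⟨?_, h.2⟩⟩
        have := h.2 i₀
        rw [hfi, Ne, Fin.ext_iff] at this
        simp only at this
        omega
      have hprod : (Finset.univ.filter fun i => (f i).val < k + 1) =
          insert i₀ (Finset.univ.filter fun i => (f i).val < k) := by
        ext i
        simp only [Finset.mem_filter, Finset.mem_univ, true_and, Finset.mem_insert]
        constructor
        · intro h
          rcases Nat.lt_succ_iff_lt_or_eq.1 h with h4 | h4
          · exact Or.inr h4
          · exact Or.inl (hf (Fin.ext (h4.trans hi₀.symm)))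
        · rintro (rfl | h) <;> omega
      rw [hset, hV.measureReal_step ⟨k, hk⟩ hBm (e i₀) (hC i₀), hset2, hν, hprod,
        Finset.prod_insert (by simp [hi₀])]
      rw [hfac] at ih
      simp only
      field_simp
      linear_combination ((M.lossLaw (ty (e i₀).1)).real (C i₀)) * ih
    · push Not at hi
      -- On `B`, an `e i` with `f i` before `k` has been matched already and cannot be drawn again;
      -- any other `e i` is drawn with probability `1 / (m - k)`.
      have hstep : ∀ i, P.real (B ∩ {ω | V.tgt ⟨k, hk⟩ ω = e i}) =
          if k ≤ (f i).val then P.real B * ((M.numLinks ty - k : ℕ) : ℝ)⁻¹ else 0 := by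
        intro i
        have h1 := hV.measureReal_step ⟨k, hk⟩ hBm (e i) MeasurableSet.univ
        have := M.loss_prob (ty (e i).1)
        simp only [mem_univ, and_true, probReal_univ, mul_one] at h1
        rw [h1]
        split_ifs with h2
        · have hset2 : B ∩ {ω | ∀ j < (⟨k, hk⟩ : Fin (M.numLinks ty)), V.tgt j ω ≠ e i} = B := by
            refine inter_eq_left.2 fun ω hω j hj hje => ?_
            have := (hω.2 i).2 j hj hje
            rw [this] at hj
            exact absurd (show (f i).val < k from hj) (not_lt.2 h2)
          rw [hset2]
        · have hset2 : B ∩ {ω | ∀ j < (⟨k, hk⟩ : Fin (M.numLinks ty)), V.tgt j ω ≠ e i} = ∅ := by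
            ext ω
            simp only [mem_inter_iff, mem_ofPred_eq, mem_empty_iff_false, iff_false, not_and,
              not_forall]
            intro hω
            refine ⟨f i, not_le.1 h2, ?_⟩
            simpa using ((hω.2 i).1 (not_le.1 h2)).1
          rw [hset2, measureReal_empty, zero_mul]
      have hset : B = (A ∩ partialMatch V e f C (k + 1)) ∪
          ⋃ i ∈ (Finset.univ : Finset ι), B ∩ {ω | V.tgt ⟨k, hk⟩ ω = e i} := by
        ext ω
        simp only [mem_union, mem_iUnion, Finset.mem_univ, mem_inter_iff, mem_ofPred_eq,
          exists_prop, true_and]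
        constructor
        · intro hω
          by_cases h : ∃ i, V.tgt ⟨k, hk⟩ ω = e i
          · obtain ⟨i, h⟩ := h
            exact Or.inr ⟨i, hω, h⟩
          · push Not at h
            refine Or.inl ⟨hω.1, fun i => ⟨fun h3 => (hω.2 i).1 ?_, fun j hj hje => ?_⟩⟩
            · have := hi i; omega
            · rcases Nat.lt_succ_iff_lt_or_eq.1 hj with h4 | h4
              · exact (hω.2 i).2 j h4 hje
              · exact absurd ((show j = ⟨k, hk⟩ from Fin.ext h4) ▸ hje) (h i)
        · rintro (h | ⟨i, h, _⟩)
          · exact ⟨h.1, fun i => ⟨fun h1 => (h.2 i).1 (by omega),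
              fun j hj => (h.2 i).2 j (by omega)⟩⟩
          · exact h
      have hdisj : Disjoint (A ∩ partialMatch V e f C (k + 1))
          (⋃ i ∈ (Finset.univ : Finset ι), B ∩ {ω | V.tgt ⟨k, hk⟩ ω = e i}) := by
        rw [Set.disjoint_left]
        intro ω h1 h2
        simp only [mem_iUnion, Finset.mem_univ, mem_inter_iff, mem_ofPred_eq, exists_prop,
          true_and] at h2
        obtain ⟨i, _, h2⟩ := h2
        have := (h1.2 i).2 ⟨k, hk⟩ (Nat.lt_succ_self k) h2
        exact hi i (by rw [← this])
      have hBmeas : ∀ i, MeasurableSet (B ∩ {ω | V.tgt ⟨k, hk⟩ ω = e i}) := fun i =>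
        (𝓖.le _ _ hBm).inter (hV.measurableSet_tgt _ _)
      have hsum : P.real B = P.real (A ∩ partialMatch V e f C (k + 1)) +
          (Finset.card {i | k ≤ (f i).val} : ℝ) *
            (P.real B * ((M.numLinks ty - k : ℕ) : ℝ)⁻¹) := by
        conv_lhs => rw [hset]
        rw [measureReal_union hdisj (Finset.univ.measurableSet_biUnion fun i _ => hBmeas i)
          (measure_ne_top _ _) (measure_ne_top _ _),
          measureReal_biUnion_finset _ fun i _ => hBmeas i]
        · simp only [hstep]
          rw [← Finset.sum_filter, Finset.sum_const, nsmul_eq_mul]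
        · intro i _ i' _ hii
          rw [Function.onFun, Set.disjoint_left]
          rintro ω ⟨_, h1⟩ ⟨_, h2⟩
          exact hii (he (h1.symm.trans h2))
      have hν : (Finset.univ.filter fun j : Fin (M.numLinks ty) => k ≤ j.val ∧ ∀ i, f i ≠ j) =
          insert ⟨k, hk⟩
          (Finset.univ.filter fun j : Fin (M.numLinks ty) => k + 1 ≤ j.val ∧ ∀ i, f i ≠ j) := by
        ext j
        simp only [Finset.mem_filter, Finset.mem_univ, true_and, Finset.mem_insert]
        constructor
        · intro h
          rcases h.1.eq_or_lt with h1 | h1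
          · exact Or.inl (Fin.ext h1.symm)
          · exact Or.inr ⟨h1, h.2⟩
        · rintro (rfl | h)
          · exact ⟨le_rfl, fun i h => hi i (by rw [h])⟩
          · exact ⟨by omega, h.2⟩
      -- The half-edges to be avoided and the reveals that are not prescribed add up to the `m - k`
      -- remaining places. This turns the complementary probability in `hsum` into the product form
      -- `h5`.
      have hcard : Finset.card {i | k ≤ (f i).val} + Finset.card
          {j : Fin (M.numLinks ty) | k ≤ j.val ∧ ∀ i, f i ≠ j} = M.numLinks ty - k := by
        have h1 : (Finset.univ.filter fun j : Fin (M.numLinks ty) => k ≤ j.val) =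
            ((Finset.univ.filter fun i => k ≤ (f i).val).image f) ∪
            (Finset.univ.filter fun j : Fin (M.numLinks ty) => k ≤ j.val ∧ ∀ i, f i ≠ j) := by
          ext j
          simp only [Finset.mem_filter, Finset.mem_univ, true_and, Finset.mem_union,
            Finset.mem_image]
          constructor
          · intro h
            by_cases h2 : ∃ i, f i = j
            · obtain ⟨i, rfl⟩ := h2
              exact Or.inl ⟨i, h, rfl⟩
            · push Not at h2
              exact Or.inr ⟨h, h2⟩
          · rintro (⟨i, h, rfl⟩ | h)
            exacts [h, h.1]
        have h2 : (Finset.univ.filter fun j : Fin (M.numLinks ty) => k ≤ j.val) =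
            Finset.Ici ⟨k, hk⟩ := by
          ext j; simp [Fin.le_def]
        have h3 := congrArg Finset.card h1
        rw [Finset.card_union_of_disjoint, Finset.card_image_of_injective _ hf, h2,
          Fin.card_Ici] at h3
        · exact h3.symm
        · rw [Finset.disjoint_left]
          simp only [Finset.mem_image, Finset.mem_filter, Finset.mem_univ, true_and]
          rintro j ⟨i, _, rfl⟩ h
          exact h.2 i rfl
      have hprod : (Finset.univ.filter fun i => (f i).val < k + 1) =
          Finset.univ.filter fun i => (f i).val < k := by
        ext i
        have := hi i
        simp only [Finset.mem_filter, Finset.mem_univ, true_and]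
        omega
      rw [hprod]
      rw [hν, Finset.card_insert_of_notMem (by simp)] at ih hcard
      set ν := Finset.card {j : Fin (M.numLinks ty) | k + 1 ≤ j.val ∧ ∀ i, f i ≠ j}
      have hcard' : (Finset.card {i | k ≤ (f i).val} : ℝ) =
          ((M.numLinks ty - k : ℕ) : ℝ) - (ν + 1) := by
        rw [← hcard]; push_cast; ring
      rw [hcard'] at hsum
      have h5 : P.real (A ∩ partialMatch V e f C (k + 1)) * (M.numLinks ty - k : ℕ) =
          P.real B * (ν + 1) := by
        field_simp at hsum
        linarith
      rw [hfac, Nat.factorial_succ] at ih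
      push_cast at ih
      apply mul_left_cancel₀ hmk
      linear_combination ih + (M.numLinks ty).factorial * (ν.factorial : ℝ) * h5

end Joint

/-- The joint law of the positions of finitely many half-edges and of the losses incurred there. -/
theorem measure_match (hV : IsLossReveal V P 𝓖) {ι : Type*} [Fintype ι] {e : ι → M.InHalf ty}
    {f : ι → Fin (M.numLinks ty)} (he : Function.Injective e)
    (hf : Function.Injective f) {C : ι → Set ℝ} (hC : ∀ i, MeasurableSet (C i)) {A : Set Ω}
    (hA : MeasurableSet[𝓖 0] A) :
    P (A ∩ {ω | ∀ i, V.tgt (f i) ω = e i ∧ V.loss (f i) ω ∈ C i}) =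
      P A * (∏ i, M.lossLaw (ty (e i).1) (C i)) *
        ENNReal.ofReal ((M.numLinks ty - Fintype.card ι).factorial / (M.numLinks ty).factorial) := by
  classical
  have := hV.isProb
  have h1 := hV.measureReal_partialMatch he hf hC hA le_rfl
  have h2 : P (A ∩ {ω | ∀ i, V.tgt (f i) ω = e i ∧ V.loss (f i) ω ∈ C i}) =
      P (A ∩ partialMatch V e f C (M.numLinks ty)) := by
    refine measure_congr ?_
    filter_upwards [hV.ae_injective_tgt] with ω hω
    refine propext (and_congr_right fun _ => ?_)
    refine forall_congr' fun i => ?_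
    constructor
    · exact fun h => ⟨fun _ => h, fun j _ hj => hω (hj.trans h.1.symm)⟩
    · exact fun h => h.1 (f i).2
  have h3 : Finset.card {j : Fin (M.numLinks ty) | M.numLinks ty ≤ j.val ∧ ∀ i, f i ≠ j} = 0 := by
    rw [Finset.card_eq_zero, Finset.filter_eq_empty_iff]
    rintro j _ ⟨h, _⟩
    exact absurd j.2 (not_lt.2 h)
  have h4 : (Finset.univ.filter fun i => (f i).val < M.numLinks ty) = Finset.univ := by
    ext i; simp
  have := fun i => M.loss_prob (ty (e i).1)
  rw [h3, h4] at h1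
  rw [h2, ← ENNReal.ofReal_toReal (measure_ne_top P (A ∩ _)), ← ENNReal.ofReal_toReal
    (measure_ne_top P A), ← ENNReal.ofReal_toReal (a := ∏ i, _)
      (ENNReal.prod_ne_top fun i _ => measure_ne_top _ _), ← ENNReal.ofReal_mul (by positivity),
      ← ENNReal.ofReal_mul (by positivity), ENNReal.toReal_prod]
  congr 1
  change P.real _ = P.real _ * (∏ i, (M.lossLaw (ty (e i).1)).real (C i)) * _
  simp only [Nat.factorial_zero, Nat.cast_one, mul_one, Nat.sub_self, one_mul] at h1
  field_simp
  exact h1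

end IsLossReveal

instance RiskModel.instIsProbabilityMeasureShockLaw {X : Type*} (M : RiskModel X) (x : X) :
    IsProbabilityMeasure (M.shockLaw x) := M.shock_prob x

instance RiskModel.instIsProbabilityMeasureLossLaw {X : Type*} (M : RiskModel X) (x : X) :
    IsProbabilityMeasure (M.lossLaw x) := M.loss_prob x

/-- The law of the shock and of the losses attached to the incoming half-edges of an agent. -/
noncomputable def RiskModel.agentLaw {X : Type*} (M : RiskModel X) (x : X) :
    Measure (ℝ × (Fin (M.inDeg x) → ℝ)) :=
  (M.shockLaw x).prod (Measure.pi fun _ => M.lossLaw x)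

instance RiskModel.instIsProbabilityMeasureAgentLaw {X : Type*} (M : RiskModel X) (x : X) :
    IsProbabilityMeasure (M.agentLaw x) := by
  unfold RiskModel.agentLaw; infer_instance

/-- The shock, the losses and the positions of the incoming half-edges of an agent. -/
abbrev RiskModel.AgentData {X : Type*} (M : RiskModel X) (x : X) : Type :=
  ℝ × (Fin (M.inDeg x) → ℝ) × (Fin (M.inDeg x) → ℝ)

/-- The law of the data of an agent whose half-edges have independent uniform positions in
`{0, 1/N, …, (m-1)/N}`. -/
noncomputable def RiskModel.gridProb {X : Type*} (M : RiskModel X) (x : X) (N m : ℕ)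
    (E : Set (M.AgentData x)) : ℝ≥0∞ :=
  ((m : ℝ≥0∞)⁻¹) ^ M.inDeg x * ∑ f : Fin (M.inDeg x) → Fin m,
    M.agentLaw x {p | (p.1, p.2, fun j => ((f j : ℕ) : ℝ) / N) ∈ E}

/-- A probability measure is spanned by the universe of any family of sets containing it. -/
noncomputable def MeasureTheory.Measure.finiteSpanningSetsInOfUnivMem {α : Type*}
    [MeasurableSpace α] (μ : Measure α) [IsFiniteMeasure μ] {C : Set (Set α)} (h : univ ∈ C) :
    μ.FiniteSpanningSetsIn C where
  set := fun _ => univ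
  set_mem := fun _ => h
  finite := fun _ => measure_lt_top _ _
  spanning := iUnion_const _

namespace RevealData

variable {X : Type*} {M : RiskModel X} {n : ℕ} {ty : Fin n → X} {Ω : Type*}
  (V : RevealData M ty Ω)

/-- The shock, losses and positions (divided by `n`) of the agent `i` lie in `E`. -/
def dataEvent (E : ∀ x, Set (M.AgentData x)) (i : Fin n) : Set Ω :=
  {ω | ∃ f : Fin (M.inDeg (ty i)) → Fin (M.numLinks ty), (∀ j, V.tgt (f j) ω = ⟨i, j⟩) ∧
    (V.shock i ω, (fun j => V.loss (f j) ω), fun j => ((f j : ℕ) : ℝ) / n) ∈ E (ty i)}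

end RevealData

namespace IsLossReveal

variable {X : Type*} {M : RiskModel X} {n : ℕ} {ty : Fin n → X} {Ω : Type*}
  [mΩ : MeasurableSpace Ω] {V : RevealData M ty Ω} {P : Measure Ω} {𝓖 : Filtration ℕ mΩ}

theorem measurableSet_match (hV : IsLossReveal V P 𝓖) {ι : Type*} [Fintype ι]
    (e : ι → M.InHalf ty) (f : ι → Fin (M.numLinks ty)) :
    MeasurableSet {ω | ∀ i, V.tgt (f i) ω = e i} := by
  have : {ω | ∀ i, V.tgt (f i) ω = e i} = ⋂ i, {ω | V.tgt (f i) ω = e i} := by ext; simp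
  rw [this]
  exact MeasurableSet.iInter fun i => hV.measurableSet_tgt _ _

theorem measurableSet_slice {x : X} {E : Set (M.AgentData x)} (hE : MeasurableSet E)
    (w : Fin (M.inDeg x) → ℝ) :
    MeasurableSet {p : ℝ × (Fin (M.inDeg x) → ℝ) | (p.1, p.2, w) ∈ E} := by
  have : Measurable fun p : ℝ × (Fin (M.inDeg x) → ℝ) => (p.1, p.2, w) := by fun_prop
  exact this hE

theorem measurableSet_dataEvent (hV : IsLossReveal V P 𝓖) {E : ∀ x, Set (M.AgentData x)}
    (hE : ∀ x, MeasurableSet (E x)) (i : Fin n) : MeasurableSet (V.dataEvent E i) := by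
  have : V.dataEvent E i = ⋃ f : Fin (M.inDeg (ty i)) → Fin (M.numLinks ty),
      {ω | ∀ j, V.tgt (f j) ω = ⟨i, j⟩} ∩ {ω | (V.shock i ω, (fun j => V.loss (f j) ω),
        fun j => ((f j : ℕ) : ℝ) / n) ∈ E (ty i)} := by
    ext ω; simp [RevealData.dataEvent]
  rw [this]
  refine MeasurableSet.iUnion fun f => (hV.measurableSet_match _ _).inter ?_
  have : Measurable fun ω => (V.shock i ω, (fun j => V.loss (f j) ω),
      fun j => ((f j : ℕ) : ℝ) / n) :=
    (hV.measurable_shock i).prodMk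
      ((measurable_pi_lambda _ fun j => hV.measurable_loss _).prodMk measurable_const)
  exact this (hE _)

section Agents

variable {κ : Type*} [Fintype κ] {a : κ → Fin n}

/-- On rectangles this is `measure_match` combined with the independence of the shocks. Survival
sets are not rectangles, so the law restricted to the matching event is normalised and compared with
the product law on a generating π-system. -/
theorem measure_match_agents (hV : IsLossReveal V P 𝓖) (ha : Function.Injective a)
    {f : (Σ c, Fin (M.inDeg (ty (a c)))) → Fin (M.numLinks ty)} (hf : Function.Injective f)
    {E : ∀ c, Set (ℝ × (Fin (M.inDeg (ty (a c))) → ℝ))} (hE : ∀ c, MeasurableSet (E c)) :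
    P ({ω | ∀ i : Σ c, Fin (M.inDeg (ty (a c))), V.tgt (f i) ω = ⟨a i.1, i.2⟩} ∩
        {ω | ∀ c, (V.shock (a c) ω, fun j => V.loss (f ⟨c, j⟩) ω) ∈ E c}) =
      ENNReal.ofReal ((M.numLinks ty - ∑ c, M.inDeg (ty (a c))).factorial /
        (M.numLinks ty).factorial) * ∏ c, M.agentLaw (ty (a c)) (E c) := by
  have := hV.isProb
  set G := {ω | ∀ i : Σ c, Fin (M.inDeg (ty (a c))), V.tgt (f i) ω = ⟨a i.1, i.2⟩} with hG
  have hGm : MeasurableSet G := hV.measurableSet_match _ _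
  set c₀ := ENNReal.ofReal ((M.numLinks ty - ∑ c, M.inDeg (ty (a c))).factorial /
        (M.numLinks ty).factorial) with hc₀
  have hc0 : c₀ ≠ 0 := by
    rw [hc₀, Ne, ENNReal.ofReal_eq_zero, not_le]; positivity
  have hctop : c₀ ≠ ∞ := ENNReal.ofReal_ne_top
  set g : Ω → (c : κ) → ℝ × (Fin (M.inDeg (ty (a c))) → ℝ) :=
    fun ω c => (V.shock (a c) ω, fun j => V.loss (f ⟨c, j⟩) ω) with hg
  have hgm : Measurable g := measurable_pi_lambda _ fun c => (hV.measurable_shock _).prodMk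
    (measurable_pi_lambda _ fun j => hV.measurable_loss _)
  have he : Function.Injective fun i : Σ c, Fin (M.inDeg (ty (a c))) =>
      (⟨a i.1, i.2⟩ : M.InHalf ty) := by
    rintro ⟨c, j⟩ ⟨c', j'⟩ h
    simp only [Sigma.mk.injEq] at h
    have := ha h.1
    subst this
    simpa using h
  have key : Measure.pi (fun c => M.agentLaw (ty (a c))) = c₀⁻¹ • (P.restrict G).map g := by
    refine Measure.pi_eq_generateFrom (C := fun c => image2 (· ×ˢ ·)
      {s : Set ℝ | MeasurableSet s} (pi univ '' pi univ fun _ => {s : Set ℝ | MeasurableSet s}))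
      (fun c => ?_) (fun c => ?_) (fun c => Measure.finiteSpanningSetsInOfUnivMem _ ?_) ?_
    · refine (generateFrom_eq_prod (MeasurableSpace.generateFrom_measurableSet) generateFrom_pi ?_ ?_)
      · exact ⟨fun _ => univ, fun _ => by simp, iUnion_const _⟩
      · exact ⟨fun _ => univ, fun _ => ⟨fun _ => univ, fun _ _ => by simp,
          by simp⟩, iUnion_const _⟩
    · exact MeasurableSpace.isPiSystem_measurableSet.prod isPiSystem_pi
    · exact ⟨univ, by simp, univ, ⟨fun _ => univ, fun _ _ => by simp,
          by simp⟩, by simp⟩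
    · intro s hs
      choose A hA D hD hAD using hs
      choose C hC hCD using hD
      have hA : ∀ c, MeasurableSet (A c) := fun c => by simpa using hA c
      have hs' : s = fun c => A c ×ˢ (univ.pi (C c)) := by
        funext c; rw [← hAD, ← hCD]
      subst hs'
      have hCm : ∀ c j, MeasurableSet (C c j) := fun c j => by simpa using hC c j (mem_univ _)
      rw [Measure.smul_apply, Measure.map_apply hgm (MeasurableSet.univ_pi fun c =>
        (hA c).prod (MeasurableSet.univ_pi fun j => hCm c j)),
        Measure.restrict_apply (hgm (MeasurableSet.univ_pi fun c =>
        (hA c).prod (MeasurableSet.univ_pi fun j => hCm c j)))]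
      have hset : g ⁻¹' (univ.pi fun c => A c ×ˢ (univ.pi (C c))) ∩ G =
          (⋂ c ∈ (Finset.univ : Finset κ), V.shock (a c) ⁻¹' A c) ∩
            {ω | ∀ i : Σ c, Fin (M.inDeg (ty (a c))),
            V.tgt (f i) ω = ⟨a i.1, i.2⟩ ∧ V.loss (f i) ω ∈ C i.1 i.2} := by
        ext ω
        simp only [hg, hG, mem_inter_iff, mem_preimage, mem_univ_pi, mem_prod, mem_ofPred_eq,
          mem_iInter, Finset.mem_univ, true_imp_iff, Sigma.forall, forall_and]
        tauto
      have hAm : MeasurableSet[𝓖 0] (⋂ c ∈ (Finset.univ : Finset κ), V.shock (a c) ⁻¹' A c) :=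
        Finset.measurableSet_biInter _ fun c _ => hV.shock_meas _ (hA c)
      rw [hset, hV.measure_match he hf (fun i => hCm i.1 i.2) hAm]
      have hind := hV.shock_indep.precomp ha
      rw [hind.measure_inter_preimage_eq_mul Finset.univ (fun c _ => hA c)]
      have hcard : Fintype.card (Σ c, Fin (M.inDeg (ty (a c)))) = ∑ c, M.inDeg (ty (a c)) := by
        simp [Fintype.card_sigma]
      rw [hcard, ← hc₀, Fintype.prod_sigma, ← Finset.prod_mul_distrib, smul_eq_mul, mul_comm _ c₀,
        ← mul_assoc, ENNReal.inv_mul_cancel hc0 hctop, one_mul]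
      refine Finset.prod_congr rfl fun c _ => ?_
      rw [RiskModel.agentLaw, Measure.prod_prod, Measure.pi_pi, ← hV.shock_law,
        Measure.map_apply (hV.measurable_shock _) (hA c)]
  have hEm : MeasurableSet (univ.pi E) := MeasurableSet.univ_pi hE
  have h1 := congrArg (fun μ => c₀ * μ (univ.pi E)) key
  rw [Measure.smul_apply, smul_eq_mul, ← mul_assoc, ENNReal.mul_inv_cancel hc0 hctop, one_mul,
    Measure.map_apply hgm hEm, Measure.restrict_apply (hgm hEm), Measure.pi_pi] at h1
  rw [h1, inter_comm]
  congr 1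
  ext ω
  simp [hg]

/-- A non-injective `f` would match one reveal with two half-edges, which is impossible. Allowing
such `f` makes the later sum over all `f` factor over the agents. -/
theorem measure_match_agents_le (hV : IsLossReveal V P 𝓖) (ha : Function.Injective a)
    (f : (c : κ) → Fin (M.inDeg (ty (a c))) → Fin (M.numLinks ty))
    {E : ∀ c, Set (ℝ × (Fin (M.inDeg (ty (a c))) → ℝ))} (hE : ∀ c, MeasurableSet (E c)) :
    P ({ω | ∀ i : Σ c, Fin (M.inDeg (ty (a c))), V.tgt (f i.1 i.2) ω = ⟨a i.1, i.2⟩} ∩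
        {ω | ∀ c, (V.shock (a c) ω, fun j => V.loss (f c j) ω) ∈ E c}) ≤
      ENNReal.ofReal ((M.numLinks ty - ∑ c, M.inDeg (ty (a c))).factorial /
        (M.numLinks ty).factorial) * ∏ c, M.agentLaw (ty (a c)) (E c) := by
  by_cases hinj : Function.Injective fun i : Σ c, Fin (M.inDeg (ty (a c))) => f i.1 i.2
  · exact (hV.measure_match_agents ha hinj hE).le
  · have : {ω | ∀ i : Σ c, Fin (M.inDeg (ty (a c))), V.tgt (f i.1 i.2) ω = ⟨a i.1, i.2⟩} = ∅ := by
      rw [Set.eq_empty_iff_forall_notMem]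
      intro ω h1
      refine hinj fun i i' hii => ?_
      have h2 := (h1 i).symm.trans ((congrArg (fun k => V.tgt k ω) hii).trans (h1 i'))
      obtain ⟨c, j⟩ := i
      obtain ⟨c', j'⟩ := i'
      simp only [Sigma.mk.injEq] at h2
      have := ha h2.1
      subst this
      simpa using h2
    rw [this, empty_inter, measure_empty]
    exact zero_le

/-- The data of distinct agents are dominated by independent data with independent uniform
positions. -/
theorem measure_dataEvent_le (hV : IsLossReveal V P 𝓖) (ha : Function.Injective a)
    {E : ∀ x, Set (M.AgentData x)} (hE : ∀ x, MeasurableSet (E x)) (hm : M.numLinks ty ≠ 0) :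
    P {ω | ∀ c, ω ∈ V.dataEvent E (a c)} ≤
      ENNReal.ofReal ((M.numLinks ty - ∑ c, M.inDeg (ty (a c))).factorial /
        (M.numLinks ty).factorial * (M.numLinks ty : ℝ) ^ ∑ c, M.inDeg (ty (a c))) *
        ∏ c, M.gridProb (ty (a c)) n (M.numLinks ty) (E (ty (a c))) := by
  classical
  have hsub : {ω | ∀ c, ω ∈ V.dataEvent E (a c)} ⊆
      ⋃ f : (c : κ) → Fin (M.inDeg (ty (a c))) → Fin (M.numLinks ty),
      {ω | ∀ i : Σ c, Fin (M.inDeg (ty (a c))), V.tgt (f i.1 i.2) ω = ⟨a i.1, i.2⟩} ∩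
      {ω | ∀ c, (V.shock (a c) ω, fun j => V.loss (f c j) ω) ∈
        {p : ℝ × (Fin (M.inDeg (ty (a c))) → ℝ) |
          (p.1, p.2, fun j => ((f c j : ℕ) : ℝ) / n) ∈ E (ty (a c))}} := by
    intro ω hω
    choose f hf hfE using hω
    exact mem_iUnion.2 ⟨f, fun i => hf i.1 i.2, hfE⟩
  -- A union bound over all positions, so only an upper estimate; it is turned into lower estimates
  -- later by passing to complements.
  refine (measure_mono hsub).trans ((measure_iUnion_fintype_le _ _).trans
    ((Finset.sum_le_sum fun f _ => hV.measure_match_agents_le ha f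
      fun c => measurableSet_slice (hE (ty (a c))) _).trans (le_of_eq ?_)))
  have hm0 : (M.numLinks ty : ℝ≥0∞) ≠ 0 := by simpa using hm
  rw [ENNReal.ofReal_mul (by positivity), ENNReal.ofReal_pow (by positivity),
    ENNReal.ofReal_natCast, ← Finset.prod_pow_eq_pow_sum, mul_assoc, ← Finset.prod_mul_distrib,
    ← Finset.mul_sum]
  congr 1
  have hg : ∀ c, (M.numLinks ty : ℝ≥0∞) ^ M.inDeg (ty (a c)) *
      M.gridProb (ty (a c)) n (M.numLinks ty) (E (ty (a c))) =
      ∑ f : Fin (M.inDeg (ty (a c))) → Fin (M.numLinks ty), M.agentLaw (ty (a c))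
        {p | (p.1, p.2, fun j => ((f j : ℕ) : ℝ) / n) ∈ E (ty (a c))} := fun c => by
    rw [RiskModel.gridProb, ← mul_assoc, ← mul_pow, ENNReal.mul_inv_cancel hm0
      (ENNReal.natCast_ne_top _), one_pow, one_mul]
  rw [Finset.prod_congr rfl fun c _ => hg c, Finset.prod_univ_sum, Fintype.piFinset_univ]

end Agents

end IsLossReveal

/-! ### Independent uniform positions, survival and fragility. -/

/-- The uniform distribution on `(0, L]`. -/
noncomputable def unifLaw (L : ℝ) : Measure ℝ := (ENNReal.ofReal L)⁻¹ • volume.restrict (Ioc 0 L)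

theorem isProbabilityMeasure_unifLaw {L : ℝ} (hL : 0 < L) : IsProbabilityMeasure (unifLaw L) := by
  constructor
  rw [unifLaw, Measure.smul_apply, Measure.restrict_apply_univ, Real.volume_Ioc, sub_zero,
    smul_eq_mul, ENNReal.inv_mul_cancel (by simpa using hL) ENNReal.ofReal_ne_top]

instance (L : ℝ) [Fact (0 < L)] : IsProbabilityMeasure (unifLaw L) :=
  isProbabilityMeasure_unifLaw Fact.out

theorem unifLaw_absolutelyContinuous (L : ℝ) : unifLaw L ≪ volume.restrict (Ioc 0 L) :=
  Measure.smul_absolutelyContinuous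

theorem unifLaw_le (L : ℝ) (s : Set ℝ) : unifLaw L s ≤ (ENNReal.ofReal L)⁻¹ * volume s := by
  rw [unifLaw, Measure.smul_apply, smul_eq_mul]
  exact mul_le_mul_right (Measure.restrict_apply_le _ _) _

theorem unifLaw_Ioc {L a b : ℝ} (hL : 0 < L) (ha : 0 ≤ a) (hb : b ≤ L) :
    unifLaw L (Ioc a b) = ENNReal.ofReal ((b - a) / L) := by
  rw [unifLaw, Measure.smul_apply, smul_eq_mul, Measure.restrict_apply measurableSet_Ioc,
    inter_eq_left.2 (Ioc_subset_Ioc ha hb), Real.volume_Ioc, ENNReal.ofReal_div_of_pos hL,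
    div_eq_mul_inv, mul_comm]

instance (L : ℝ) : NullSingletonClass (unifLaw L) :=
  ⟨fun x => (unifLaw_absolutelyContinuous L) (measure_singleton x)⟩

theorem MeasureTheory.Measure.pi_setOf_eval_eq {ι : Type*} [Fintype ι] (μ : Measure ℝ)
    [IsProbabilityMeasure μ] [NullSingletonClass μ] {i j : ι} (hij : i ≠ j) :
    Measure.pi (fun _ : ι => μ) {w | w i = w j} = 0 := by
  have h1 := (iIndepFun_pi (μ := fun _ : ι => μ) (X := fun _ => id)
    fun i => aemeasurable_id).indepFun hij
  simp only [id] at h1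
  rw [indepFun_iff_map_prod_eq_prod_map_map
    (measurable_pi_apply i).aemeasurable (measurable_pi_apply j).aemeasurable] at h1
  have hd : MeasurableSet {p : ℝ × ℝ | p.1 = p.2} := measurableSet_eq_fun measurable_fst
    measurable_snd
  have h2 := congrArg (fun μ => μ {p : ℝ × ℝ | p.1 = p.2}) h1
  rw [Measure.map_apply (by fun_prop) hd] at h2
  have h3 : ∀ i : ι, (Measure.pi fun _ : ι => μ).map (fun w => w i) = μ :=
    fun i => (measurePreserving_eval (fun _ : ι => μ) i).map_eq
  rw [h3, h3, Measure.measure_prod_null hd |>.2] at h2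
  · exact h2
  · refine ae_of_all _ fun a => ?_
    have : Prod.mk a ⁻¹' {p : ℝ × ℝ | p.1 = p.2} = {a} := by
      ext b; simp [eq_comm]
    simp only [this, measure_singleton, Pi.zero_apply]

namespace RiskModel

variable {X : Type*} (M : RiskModel X) (x : X)

/-- The law of the data of an agent whose half-edges have independent uniform positions. -/
noncomputable def dataLaw (L : ℝ) : Measure (M.AgentData x) :=
  (M.shockLaw x).prod ((Measure.pi fun _ => M.lossLaw x).prod (Measure.pi fun _ => unifLaw L))

instance (L : ℝ) [Fact (0 < L)] : IsProbabilityMeasure (M.dataLaw x L) := by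
  unfold dataLaw; infer_instance

variable {x}

/-- A coupling: `(0, L]` is cut into `m` cells of equal length, so that each product of cells has
uniform probability `m⁻¹` to the power of the in-degree. By `h`, replacing a point by the grid point
of its cell moves no coordinate by more than `η`. -/
theorem gridProb_le {L η : ℝ} [hL : Fact (0 < L)] {N m : ℕ} (hm : m ≠ 0)
    (h : ∀ k : ℕ, k < m → ∀ w : ℝ, k * L / m < w → w ≤ (k + 1) * L / m → |(k : ℝ) / N - w| ≤ η)
    {E : Set (M.AgentData x)} (hE : MeasurableSet E) :
    M.gridProb x N m E ≤ M.dataLaw x L {p | ∃ w' : Fin (M.inDeg x) → ℝ,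
      (∀ j, |w' j - p.2.2 j| ≤ η) ∧ (p.1, p.2.1, w') ∈ E} := by
  have hm' : (0 : ℝ) < m := by positivity
  have hL' := hL.out
  let I (f : Fin (M.inDeg x) → Fin m) : Set (Fin (M.inDeg x) → ℝ) :=
    univ.pi fun j => Ioc ((f j : ℕ) * L / m) (((f j : ℕ) + 1) * L / m)
  let Sl (f : Fin (M.inDeg x) → Fin m) : Set (ℝ × (Fin (M.inDeg x) → ℝ)) :=
    {p | (p.1, p.2, fun j => ((f j : ℕ) : ℝ) / N) ∈ E}
  have hI : ∀ f, Measure.pi (fun _ => unifLaw L) (I f) = ((m : ℝ≥0∞)⁻¹) ^ M.inDeg x := by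
    intro f
    rw [Measure.pi_pi]
    have : ∀ j, unifLaw L (Ioc ((f j : ℕ) * L / m) (((f j : ℕ) + 1) * L / m)) = (m : ℝ≥0∞)⁻¹ := by
      intro j
      have hj : ((f j : ℕ) : ℝ) + 1 ≤ m := by exact_mod_cast (f j).2
      rw [unifLaw_Ioc hL' (by positivity)
        (by rw [div_le_iff₀ hm']; nlinarith)]
      rw [show (((f j : ℕ) + 1) * L / m - (f j : ℕ) * L / m) / L = (m : ℝ)⁻¹ by field_simp; ring,
        ENNReal.ofReal_inv_of_pos hm', ENNReal.ofReal_natCast]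
    simp [this]
  have hIm : ∀ f, MeasurableSet (I f) := fun f => MeasurableSet.univ_pi fun _ => measurableSet_Ioc
  have hSm : ∀ f, MeasurableSet (Sl f) := fun f => by
    have : Measurable fun p : ℝ × (Fin (M.inDeg x) → ℝ) =>
      (p.1, p.2, fun j => ((f j : ℕ) : ℝ) / N) := by fun_prop
    exact this hE
  have hsum : M.gridProb x N m E =
      ((M.agentLaw x).prod (Measure.pi fun _ => unifLaw L)) (⋃ f, Sl f ×ˢ I f) := by
    rw [measure_iUnion]
    · rw [tsum_fintype, gridProb, Finset.mul_sum]
      refine Finset.sum_congr rfl fun f _ => ?_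
      rw [Measure.prod_prod, hI, mul_comm]
    · intro f g hfg
      rw [Function.onFun, Set.disjoint_left]
      rintro p ⟨_, h1⟩ ⟨_, h2⟩
      apply hfg
      funext j
      have h1 := h1 j (mem_univ _)
      have h2 := h2 j (mem_univ _)
      have h3 := h1.1.trans_le h2.2
      have h4 := h2.1.trans_le h1.2
      rw [div_lt_div_iff_of_pos_right hm', mul_lt_mul_iff_of_pos_right hL'] at h3 h4
      have h3 : (f j : ℕ) < (g j : ℕ) + 1 := by exact_mod_cast h3
      have h4 : (g j : ℕ) < (f j : ℕ) + 1 := by exact_mod_cast h4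
      exact Fin.ext (by omega)
    · exact fun f => (hSm f).prod (hIm f)
  have hassoc := measurePreserving_prodAssoc (M.shockLaw x)
    (Measure.pi fun _ : Fin (M.inDeg x) => M.lossLaw x)
    (Measure.pi fun _ : Fin (M.inDeg x) => unifLaw L)
  rw [hsum, dataLaw, ← hassoc.measure_preimage_equiv]
  refine measure_mono (iUnion_subset fun f => ?_)
  rintro ⟨⟨ε, ℓ⟩, w⟩ ⟨h1, h2⟩
  exact ⟨_, fun j => h _ (f j).2 _ (h2 j (mem_univ _)).1 (h2 j (mem_univ _)).2, h1⟩

/-- The capital that an agent without losses lacks when no premiums have accumulated. -/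
def deficit (x : X) (ε : ℝ) : ℝ := M.δ x - M.γ x * (1 - ε)

/-- The sum of the losses at positions up to that of the half-edge `j`. -/
noncomputable def cumLoss {ι : Type*} [Fintype ι] (ℓ w : ι → ℝ) (j : ι) : ℝ :=
  ∑ i, if w i ≤ w j then ℓ i else 0

variable (x) in
/-- The data of agents with `θ` losses at positions before `v` which have survived them, where `B`
contains `(w, y)` if a deficit `y` does not cause ruin at position `w`. -/
def surviveSet (B : Set (ℝ × ℝ)) (θ : ℕ) (v : ℝ) : Set (M.AgentData x) :=
  {p | Finset.card {j | p.2.2 j < v} = θ ∧ M.deficit x p.1 < M.α x 0 ∧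
    ∀ j, p.2.2 j < v → (p.2.2 j, M.deficit x p.1 + cumLoss p.2.1 p.2.2 j) ∈ B}

variable (x) in
/-- The data of agents whose solvency may change if positions are perturbed by at most `η`. -/
def fragileSet (B : Set (ℝ × ℝ)) (η : ℝ) : Set (M.AgentData x) :=
  {p | (∃ j, (p.2.2 j + η, M.deficit x p.1 + cumLoss p.2.1 p.2.2 j) ∈ B ∧
      (p.2.2 j - η, M.deficit x p.1 + cumLoss p.2.1 p.2.2 j) ∉ B) ∨
    ∃ i j, i ≠ j ∧ |p.2.2 i - p.2.2 j| ≤ 2 * η}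

theorem measurable_cumLoss {ι : Type*} [Fintype ι] (j : ι) :
    Measurable fun q : (ι → ℝ) × (ι → ℝ) => cumLoss q.1 q.2 j := by
  refine Finset.measurable_sum _ fun i _ => Measurable.ite ?_ (by fun_prop) measurable_const
  exact measurableSet_le (by fun_prop) (by fun_prop)

theorem measurable_deficit_add_cumLoss (j : Fin (M.inDeg x)) :
    Measurable fun p : M.AgentData x => M.deficit x p.1 + cumLoss p.2.1 p.2.2 j :=
  Measurable.add (by unfold deficit; fun_prop) ((measurable_cumLoss j).comp measurable_snd)

theorem measurableSet_card_eq {α ι : Type*} [MeasurableSpace α] [Fintype ι] {s : ι → Set α}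
    (hs : ∀ i, MeasurableSet (s i)) (θ : ℕ) [∀ a, DecidablePred fun i => a ∈ s i] :
    MeasurableSet {a | Finset.card {i | a ∈ s i} = θ} := by
  classical
  have : (fun a => Finset.card {i | a ∈ s i}) = fun a => ∑ i, if a ∈ s i then 1 else 0 := by
    funext a; rw [Finset.card_filter]
  have hm : Measurable fun a => Finset.card {i | a ∈ s i} := by
    rw [this]
    exact Finset.measurable_sum _ fun i _ => Measurable.ite (hs i) measurable_const
      measurable_const
  exact hm (measurableSet_singleton θ)

theorem measurableSet_surviveSet {B : Set (ℝ × ℝ)} (hB : MeasurableSet B) (θ : ℕ) (v : ℝ) :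
    MeasurableSet (M.surviveSet x B θ v) := by
  have h1 : ∀ j, MeasurableSet {p : M.AgentData x | p.2.2 j < v} := fun j =>
    measurableSet_lt (by fun_prop) measurable_const
  have : M.surviveSet x B θ v = {p : M.AgentData x | Finset.card {j | p.2.2 j < v} = θ} ∩
      ({p | M.deficit x p.1 < M.α x 0} ∩ ⋂ j, ({p : M.AgentData x | p.2.2 j < v}ᶜ ∪
        {p | (p.2.2 j, M.deficit x p.1 + cumLoss p.2.1 p.2.2 j) ∈ B})) := by
    ext p
    simp only [surviveSet, mem_ofPred_eq, mem_inter_iff, mem_iInter, mem_union, mem_compl_iff,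
      imp_iff_not_or]
  rw [this]
  refine (measurableSet_card_eq h1 θ).inter ((measurableSet_lt (by unfold deficit; fun_prop)
    measurable_const).inter (MeasurableSet.iInter fun j => (h1 j).compl.union ?_))
  have : Measurable fun p : M.AgentData x => (p.2.2 j, M.deficit x p.1 + cumLoss p.2.1 p.2.2 j) :=
    Measurable.prodMk (by fun_prop) (M.measurable_deficit_add_cumLoss j)
  exact this hB

theorem measurableSet_fragileSet {B : Set (ℝ × ℝ)} (hB : MeasurableSet B) (η : ℝ) :
    MeasurableSet (M.fragileSet x B η) := by
  have h2 : ∀ j c, Measurable fun p : M.AgentData x =>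
      (p.2.2 j + c, M.deficit x p.1 + cumLoss p.2.1 p.2.2 j) := fun j c =>
    Measurable.prodMk (by fun_prop) (M.measurable_deficit_add_cumLoss j)
  have : M.fragileSet x B η =
      (⋃ j, {p : M.AgentData x | (p.2.2 j + η, M.deficit x p.1 + cumLoss p.2.1 p.2.2 j) ∈ B} ∩
        {p | (p.2.2 j + -η, M.deficit x p.1 + cumLoss p.2.1 p.2.2 j) ∈ B}ᶜ) ∪
      ⋃ (i) (j) (_ : i ≠ j), {p : M.AgentData x | |p.2.2 i - p.2.2 j| ≤ 2 * η} := by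
    ext p
    simp [fragileSet, sub_eq_add_neg]
  rw [this]
  refine (MeasurableSet.iUnion fun j => (h2 j η hB).inter (h2 j (-η) hB).compl).union
    (MeasurableSet.iUnion fun i => MeasurableSet.iUnion fun j => MeasurableSet.iUnion fun _ =>
      measurableSet_le (by fun_prop) measurable_const)

variable {B : Set (ℝ × ℝ)}

/-- Positions more than `2 * η` apart keep their order when each moves by at most `η`, and `cumLoss`
depends on positions only through their order. -/
theorem cumLoss_congr {ι : Type*} [Fintype ι] {ℓ w w' : ι → ℝ} {η : ℝ}
    (hw : ∀ j, |w' j - w j| ≤ η) (hties : ∀ i j, i ≠ j → 2 * η < |w i - w j|) (j : ι) :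
    cumLoss ℓ w' j = cumLoss ℓ w j := by
  refine Finset.sum_congr rfl fun i _ => ?_
  have : w' i ≤ w' j ↔ w i ≤ w j := by
    rcases eq_or_ne i j with rfl | hij
    · simp
    · have h1 := abs_le.1 (hw i)
      have h2 := abs_le.1 (hw j)
      have h3 := hties i j hij
      rcases lt_abs.1 h3 with h | h <;> constructor <;> intro h' <;> linarith
  simp only [this]

/-- A perturbation could change which positions lie before `v`, the order of the losses, or
membership in `B`. The first is excluded by `hv`, the second by the separation of positions, the
third because membership at `w j + η` already forces membership at `w j - η`. -/
theorem mem_surviveSet_congr (hBmono : ∀ v v' y : ℝ, (v, y) ∈ B → v ≤ v' → (v', y) ∈ B)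
    {ε η v : ℝ} {θ : ℕ} {ℓ w w' : Fin (M.inDeg x) → ℝ}
    (hw : ∀ j, |w' j - w j| ≤ η) (hfrag : (ε, ℓ, w) ∉ M.fragileSet x B η)
    (hv : ∀ j, η < |w j - v|) :
    (ε, ℓ, w') ∈ M.surviveSet x B θ v ↔ (ε, ℓ, w) ∈ M.surviveSet x B θ v := by
  simp only [fragileSet, mem_ofPred_eq, not_or, not_exists, not_and, not_not, not_le] at hfrag
  have hlt : ∀ j, w' j < v ↔ w j < v := fun j => by
    have h1 := abs_le.1 (hw j)
    rcases lt_abs.1 (hv j) with h | h <;> constructor <;> intro h' <;> linarith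
  simp only [surviveSet, mem_ofPred_eq, hlt, cumLoss_congr hw hfrag.2]
  refine and_congr_right fun _ => and_congr_right fun _ => forall_congr' fun j =>
    imp_congr_right fun _ => ?_
  have h1 := abs_le.1 (hw j)
  exact ⟨fun h => hBmono _ _ _ (hfrag.1 j (hBmono _ _ _ h (by linarith))) (by linarith),
    fun h => hBmono _ _ _ (hfrag.1 j (hBmono _ _ _ h (by linarith))) (by linarith)⟩

/-- Fragility passes from grid positions to uniform positions at the price of doubling `η`; for the
ties, `2 * η` becomes `4 * η`. -/
theorem mem_fragileSet_of_abs_le (hBmono : ∀ v v' y : ℝ, (v, y) ∈ B → v ≤ v' → (v', y) ∈ B)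
    {ε η : ℝ} {ℓ w w' : Fin (M.inDeg x) → ℝ}
    (hw : ∀ j, |w' j - w j| ≤ η) (hfrag : (ε, ℓ, w') ∈ M.fragileSet x B η) :
    (ε, ℓ, w) ∈ M.fragileSet x B (2 * η) := by
  by_contra hcon
  simp only [fragileSet, mem_ofPred_eq, not_or, not_exists, not_and, not_not, not_le] at hcon
  have h0 : ∀ j : Fin (M.inDeg x), 0 ≤ η := fun j => (abs_nonneg _).trans (hw j)
  rcases hfrag with ⟨j, h1, h2⟩ | ⟨i, j, hij, h⟩
  · simp only at h1 h2
    rw [cumLoss_congr hw (fun i k hik => by have := hcon.2 i k hik; linarith [h0 i])] at h1 h2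
    have h3 := abs_le.1 (hw j)
    exact h2 (hBmono _ _ _ (hcon.1 j (hBmono _ _ _ h1 (by linarith))) (by linarith))
  · have h1 := hcon.2 i j hij
    have h2 := abs_le.1 (hw i)
    have h3 := abs_le.1 (hw j)
    have h4 := abs_le.1 h
    simp only at h4
    rcases lt_abs.1 h1 with h | h <;> linarith

theorem fragileSet_mono (hBmono : ∀ v v' y : ℝ, (v, y) ∈ B → v ≤ v' → (v', y) ∈ B)
    {η η' : ℝ} (h : η ≤ η') :
    M.fragileSet x B η ⊆ M.fragileSet x B η' := by
  rintro p (⟨j, h1, h2⟩ | ⟨i, j, hij, h3⟩)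
  · exact Or.inl ⟨j, hBmono _ _ _ h1 (by linarith), fun h3 => h2 (hBmono _ _ _ h3 (by linarith))⟩
  · exact Or.inr ⟨i, j, hij, h3.trans (by linarith)⟩

theorem dataLaw_preimage_eval {L : ℝ} [Fact (0 < L)] (j : Fin (M.inDeg x)) {s : Set ℝ}
    (hs : NullMeasurableSet s (unifLaw L)) :
    M.dataLaw x L {p | p.2.2 j ∈ s} = unifLaw L s := by
  have h := (((measurePreserving_eval (fun _ : Fin (M.inDeg x) => unifLaw L) j).comp
    (measurePreserving_snd (μ := Measure.pi fun _ : Fin (M.inDeg x) => M.lossLaw x)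
      (ν := Measure.pi fun _ : Fin (M.inDeg x) => unifLaw L))).comp
    (measurePreserving_snd (μ := M.shockLaw x)))
  exact h.measure_preimage hs

theorem dataLaw_exists_mem_le {L : ℝ} [Fact (0 < L)] {s : Set ℝ} (hs : MeasurableSet s) :
    M.dataLaw x L {p | ∃ j, p.2.2 j ∈ s} ≤ M.inDeg x * ((ENNReal.ofReal L)⁻¹ * volume s) := by
  have : {p : M.AgentData x | ∃ j, p.2.2 j ∈ s} = ⋃ j, {p : M.AgentData x | p.2.2 j ∈ s} := by
    ext; simp
  rw [this]
  refine (measure_iUnion_fintype_le _ _).trans ?_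
  calc _ ≤ ∑ _j : Fin (M.inDeg x), ((ENNReal.ofReal L)⁻¹ * volume s) :=
        Finset.sum_le_sum fun j _ => by
          rw [M.dataLaw_preimage_eval j hs.nullMeasurableSet]; exact unifLaw_le _ _
    _ = _ := by simp

theorem measureReal_dataLaw_exists_mem_Icc_le {L a b : ℝ} [hL : Fact (0 < L)] (hab : a ≤ b) :
    (M.dataLaw x L).real {p | ∃ j, p.2.2 j ∈ Icc a b} ≤ M.inDeg x * ((b - a) / L) := by
  have h := M.dataLaw_exists_mem_le (x := x) (L := L) (measurableSet_Icc (a := a) (b := b))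
  rw [Real.volume_Icc, ← ENNReal.ofReal_inv_of_pos hL.out, ← ENNReal.ofReal_mul
    (inv_nonneg.2 hL.out.le), ← ENNReal.ofReal_natCast, ← ENNReal.ofReal_mul (by positivity)] at h
  refine ENNReal.toReal_le_of_le_ofReal ?_ (h.trans_eq (by rw [mul_comm L⁻¹, div_eq_mul_inv]))
  exact mul_nonneg (by positivity) (div_nonneg (by linarith) hL.out.le)

/-- The probability of survival is Lipschitz in the position. -/
theorem abs_measureReal_surviveSet_sub_le {L : ℝ} [hL : Fact (0 < L)]
    (θ : ℕ) (v v' : ℝ) :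
    |(M.dataLaw x L).real (M.surviveSet x B θ v) - (M.dataLaw x L).real (M.surviveSet x B θ v')|
      ≤ M.inDeg x * (|v - v'| / L) := by
  wlog h : v ≤ v' generalizing v v'
  · rw [abs_sub_comm, abs_sub_comm v]
    exact this _ _ (le_of_not_ge h)
  have key : ∀ p : M.AgentData x, (¬ ∃ j, p.2.2 j ∈ Icc v v') →
      (p ∈ M.surviveSet x B θ v ↔ p ∈ M.surviveSet x B θ v') := by
    intro p hp
    have : ∀ j, p.2.2 j < v ↔ p.2.2 j < v' := fun j =>
      ⟨fun h' => h'.trans_le h, fun h' => by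
        by_contra hn
        exact hp ⟨j, not_lt.1 hn, h'.le⟩⟩
    simp only [surviveSet, mem_ofPred_eq, this]
  have hb := M.measureReal_dataLaw_exists_mem_Icc_le (x := x) (L := L) h
  have h1 : M.surviveSet x B θ v ⊆ M.surviveSet x B θ v' ∪ {p | ∃ j, p.2.2 j ∈ Icc v v'} :=
    fun p hp => by
      by_cases h' : ∃ j, p.2.2 j ∈ Icc v v'
      exacts [Or.inr h', Or.inl ((key p h').1 hp)]
  have h2 : M.surviveSet x B θ v' ⊆ M.surviveSet x B θ v ∪ {p | ∃ j, p.2.2 j ∈ Icc v v'} :=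
    fun p hp => by
      by_cases h' : ∃ j, p.2.2 j ∈ Icc v v'
      exacts [Or.inr h', Or.inl ((key p h').2 hp)]
  have h3 := (measureReal_mono h1 (μ := M.dataLaw x L)).trans (measureReal_union_le _ _)
  have h4 := (measureReal_mono h2 (μ := M.dataLaw x L)).trans (measureReal_union_le _ _)
  rw [abs_sub_comm v, abs_of_nonneg (sub_nonneg.2 h), abs_le]
  constructor <;> linarith

/-- Almost no data are fragile under small perturbations. -/
theorem tendsto_measure_fragileSet (hBmono : ∀ v v' y : ℝ, (v, y) ∈ B → v ≤ v' → (v', y) ∈ B)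
    {L : ℝ} [hL : Fact (0 < L)] (hB : MeasurableSet B)
    (hcrit : ∀ᵐ v ∂(unifLaw L), {y | ∀ η > 0, (v + η, y) ∈ B ∧ (v - η, y) ∉ B}.Subsingleton) :
    Tendsto (fun k : ℕ => M.dataLaw x L (M.fragileSet x B (1 / (k + 1)))) atTop (𝓝 0) := by
  have hanti : Antitone fun k : ℕ => M.fragileSet x B (1 / ((k : ℝ) + 1)) := fun a b hab =>
    M.fragileSet_mono hBmono (one_div_le_one_div_of_le (by positivity) (by gcongr))
  have h := tendsto_measure_iInter_atTop (μ := M.dataLaw x L)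
    (fun k : ℕ => (M.measurableSet_fragileSet hB (1 / ((k : ℝ) + 1))).nullMeasurableSet) hanti
    ⟨0, measure_ne_top _ _⟩
  suffices h0 : M.dataLaw x L (⋂ k : ℕ, M.fragileSet x B (1 / ((k : ℝ) + 1))) = 0 by
    rwa [h0] at h
  have hties : ∀ i j : Fin (M.inDeg x), i ≠ j →
      M.dataLaw x L {p | p.2.2 i = p.2.2 j} = 0 := by
    intro i j hij
    have h := (measurePreserving_snd (μ := Measure.pi fun _ : Fin (M.inDeg x) => M.lossLaw x)
      (ν := Measure.pi fun _ : Fin (M.inDeg x) => unifLaw L)).comp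
      (measurePreserving_snd (μ := M.shockLaw x))
    have h2 := h.measure_preimage (s := {w | w i = w j}) (measurableSet_eq_fun (by fun_prop)
      (by fun_prop)).nullMeasurableSet
    rw [Measure.pi_setOf_eval_eq _ hij] at h2
    exact h2
  -- The data whose deficit at half-edge `j` is critical at every scale.
  let D (j : Fin (M.inDeg x)) : Set (M.AgentData x) := ⋂ k : ℕ,
    {p | (p.2.2 j + 1 / ((k : ℝ) + 1), M.deficit x p.1 + cumLoss p.2.1 p.2.2 j) ∈ B ∧
      (p.2.2 j - 1 / ((k : ℝ) + 1), M.deficit x p.1 + cumLoss p.2.1 p.2.2 j) ∉ B}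
  have hDm : ∀ j, MeasurableSet (D j) := by
    intro j
    have h2 : ∀ c, Measurable fun p : M.AgentData x =>
        (p.2.2 j + c, M.deficit x p.1 + cumLoss p.2.1 p.2.2 j) := fun c =>
      Measurable.prodMk (by fun_prop) (M.measurable_deficit_add_cumLoss j)
    refine MeasurableSet.iInter fun k => ?_
    simp only [sub_eq_add_neg]
    exact (h2 _ hB).inter (h2 _ hB).compl
  have hD : ∀ j, M.dataLaw x L (D j) = 0 := by
    intro j
    rw [dataLaw, Measure.prod_apply_symm (hDm j)]
    rw [lintegral_eq_zero_iff' (measurable_measure_prodMk_right (hDm j)).aemeasurable]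
    have h1 : ∀ᵐ q ∂((Measure.pi fun _ : Fin (M.inDeg x) => M.lossLaw x).prod
        (Measure.pi fun _ : Fin (M.inDeg x) => unifLaw L)),
        {y | ∀ η > 0, (q.2 j + η, y) ∈ B ∧ (q.2 j - η, y) ∉ B}.Subsingleton :=
      ((measurePreserving_eval (fun _ : Fin (M.inDeg x) => unifLaw L) j).comp
        measurePreserving_snd).quasiMeasurePreserving.ae hcrit
    filter_upwards [h1] with q hq
    -- With losses and positions fixed, `deficit` is injective in the shock because `γ` is positive.
    -- So at most one shock is critical, and the density makes this null.
    refine M.shock_density x (Set.Subsingleton.measure_zero (fun a ha b hb => ?_) _)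
    have hmem : ∀ a, a ∈ (fun ε => ((ε, q) : M.AgentData x)) ⁻¹' D j →
        M.deficit x a + cumLoss q.1 q.2 j ∈
          {y | ∀ η > 0, (q.2 j + η, y) ∈ B ∧ (q.2 j - η, y) ∉ B} := by
      intro a ha η hη
      obtain ⟨k, hk⟩ := exists_nat_one_div_lt hη
      have := mem_iInter.1 ha k
      exact ⟨hBmono _ _ _ this.1 (by simp only; linarith),
        fun h => this.2 (hBmono _ _ _ h (by simp only; linarith))⟩
    have h2 := hq (hmem a ha) (hmem b hb)
    have h3 := M.γ_pos x
    simp only [deficit] at h2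
    have h4 : M.γ x * (a - b) = 0 := by linarith
    rcases mul_eq_zero.1 h4 with h5 | h5
    · exact absurd h5 h3.ne'
    · linarith
  -- Without ties, and if every `j` stops being critical at some scale `1 / (K j + 1)`, the scale
  -- with index `k₀ + ∑ j, K j` is finer than all of these and than the gaps between positions, so
  -- the data are not fragile there.
  refine measure_mono_null (t := (⋃ j, D j) ∪ ⋃ (i) (j) (_ : i ≠ j), {p | p.2.2 i = p.2.2 j}) ?_ ?_
  · intro p hp
    by_contra hcon
    simp only [mem_union, mem_iUnion, not_or, not_exists, D, mem_iInter, not_forall] at hcon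
    obtain ⟨h1, h2⟩ := hcon
    choose K hK using h1
    obtain ⟨c, hc, hcw⟩ : ∃ c > 0, ∀ i j, i ≠ j → c ≤ |p.2.2 i - p.2.2 j| := by
      have : ∀ i j, ∃ c > 0, i ≠ j → c ≤ |p.2.2 i - p.2.2 j| := fun i j => by
        by_cases hij : i = j
        · exact ⟨1, one_pos, fun h => absurd hij h⟩
        · exact ⟨|p.2.2 i - p.2.2 j|, abs_pos.2 (sub_ne_zero.2 (h2 i j hij)), fun _ => le_rfl⟩
      choose c hc hcw using this
      by_cases hne : Nonempty (Fin (M.inDeg x) × Fin (M.inDeg x))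
      · refine ⟨Finset.univ.inf' Finset.univ_nonempty fun q : Fin (M.inDeg x) × Fin (M.inDeg x) =>
          c q.1 q.2, ?_, fun i j hij => (Finset.inf'_le _ (Finset.mem_univ (i, j))).trans
            (hcw i j hij)⟩
        rw [gt_iff_lt, Finset.lt_inf'_iff]
        exact fun q _ => hc _ _
      · exact ⟨1, one_pos, fun i j => absurd ⟨(i, j)⟩ hne⟩
    obtain ⟨k₀, hk₀⟩ := exists_nat_one_div_lt (show 0 < c / 2 by linarith)
    have hp' := mem_iInter.1 hp (k₀ + ∑ j, K j)
    have hle : ∀ k ≤ k₀ + ∑ j, K j, 1 / (((k₀ + ∑ j, K j : ℕ) : ℝ) + 1) ≤ 1 / ((k : ℝ) + 1) :=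
      fun k hk => one_div_le_one_div_of_le (by positivity) (by gcongr)
    rcases hp' with ⟨j, h3, h4⟩ | ⟨i, j, hij, h3⟩
    · have hKj : K j ≤ k₀ + ∑ j, K j :=
        (Finset.single_le_sum (fun _ _ => Nat.zero_le _) (Finset.mem_univ j)).trans
          (Nat.le_add_left _ _)
      have := hle _ hKj
      exact hK j ⟨hBmono _ _ _ h3 (by linarith), fun h => h4 (hBmono _ _ _ h (by linarith))⟩
    · have h5 := hcw i j hij
      have := hle k₀ (Nat.le_add_right _ _)
      linarith
  · simp only [measure_union_null_iff, measure_iUnion_null_iff]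
    exact ⟨hD, hties⟩

/-! ### Comparison of grid positions with uniform positions -/

theorem gridProb_fragileSet_le (hBmono : ∀ v v' y : ℝ, (v, y) ∈ B → v ≤ v' → (v', y) ∈ B)
    {L η : ℝ} [hL : Fact (0 < L)] (hB : MeasurableSet B) {N m : ℕ}
    (hm : m ≠ 0)
    (h : ∀ k : ℕ, k < m → ∀ w : ℝ, k * L / m < w → w ≤ (k + 1) * L / m → |(k : ℝ) / N - w| ≤ η) :
    M.gridProb x N m (M.fragileSet x B η) ≤ M.dataLaw x L (M.fragileSet x B (2 * η)) := by
  refine (M.gridProb_le hm h (M.measurableSet_fragileSet hB η)).trans (measure_mono ?_)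
  rintro ⟨ε, ℓ, w⟩ ⟨w', h1, h2⟩
  exact M.mem_fragileSet_of_abs_le hBmono h1 h2

theorem gridProb_surviveSet_le (hBmono : ∀ v v' y : ℝ, (v, y) ∈ B → v ≤ v' → (v', y) ∈ B)
    {L η v : ℝ} {θ : ℕ} [hL : Fact (0 < L)] (hB : MeasurableSet B)
    {N m : ℕ} (hm : m ≠ 0)
    (h : ∀ k : ℕ, k < m → ∀ w : ℝ, k * L / m < w → w ≤ (k + 1) * L / m → |(k : ℝ) / N - w| ≤ η) :
    M.gridProb x N m (M.surviveSet x B θ v) ≤ M.dataLaw x L (M.surviveSet x B θ v) +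
      (M.dataLaw x L (M.fragileSet x B η) +
        M.dataLaw x L {p | ∃ j, p.2.2 j ∈ Icc (v - η) (v + η)}) := by
  refine (M.gridProb_le hm h (M.measurableSet_surviveSet hB θ v)).trans ((measure_mono ?_).trans
    ((measure_union_le _ _).trans (add_le_add_right (measure_union_le _ _) _)))
  rintro ⟨ε, ℓ, w⟩ ⟨w', h1, h2⟩
  by_cases h3 : (ε, ℓ, w) ∈ M.fragileSet x B η
  · exact Or.inr (Or.inl h3)
  by_cases h4 : ∃ j, w j ∈ Icc (v - η) (v + η)
  · exact Or.inr (Or.inr h4)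
  push Not at h4
  refine Or.inl ((M.mem_surviveSet_congr hBmono h1 h3 fun j => ?_).1 h2)
  by_contra hn
  have := abs_le.1 (not_lt.1 hn)
  exact h4 j ⟨by linarith, by linarith⟩

/-- Stated for the complement because data events are only bounded from above; this becomes the
lower bound for survival. -/
theorem gridProb_compl_surviveSet_le (hBmono : ∀ v v' y : ℝ, (v, y) ∈ B → v ≤ v' → (v', y) ∈ B)
    {L η v : ℝ} {θ : ℕ} [hL : Fact (0 < L)] (hB : MeasurableSet B)
    {N m : ℕ} (hm : m ≠ 0)
    (h : ∀ k : ℕ, k < m → ∀ w : ℝ, k * L / m < w → w ≤ (k + 1) * L / m → |(k : ℝ) / N - w| ≤ η) :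
    M.gridProb x N m (M.surviveSet x B θ v)ᶜ ≤ M.dataLaw x L (M.surviveSet x B θ v)ᶜ +
      (M.dataLaw x L (M.fragileSet x B η) +
        M.dataLaw x L {p | ∃ j, p.2.2 j ∈ Icc (v - η) (v + η)}) := by
  refine (M.gridProb_le hm h (M.measurableSet_surviveSet hB θ v).compl).trans ((measure_mono ?_).trans
    ((measure_union_le _ _).trans (add_le_add_right (measure_union_le _ _) _)))
  rintro ⟨ε, ℓ, w⟩ ⟨w', h1, h2⟩
  by_cases h3 : (ε, ℓ, w) ∈ M.fragileSet x B η
  · exact Or.inr (Or.inl h3)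
  by_cases h4 : ∃ j, w j ∈ Icc (v - η) (v + η)
  · exact Or.inr (Or.inr h4)
  push Not at h4
  refine Or.inl (fun h5 => h2 ((M.mem_surviveSet_congr hBmono h1 h3 fun j => ?_).2 h5))
  by_contra hn
  have := abs_le.1 (not_lt.1 hn)
  exact h4 j ⟨by linarith, by linarith⟩

end RiskModel

/-! ### Time change by the accumulated rate, and the barrier. -/

/-- The accumulated rate `∫₀ᵗ r`. -/
noncomputable def cumRate (r : ℝ → ℝ) (t : ℝ) : ℝ := ∫ s in (0 : ℝ)..max t 0, r s

/-- The pairs `(v, y)` such that a deficit `y` has been covered by the premiums `a` when the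
accumulated rate is `v`. -/
def barrier (r a : ℝ → ℝ) : Set (ℝ × ℝ) := {p | ∃ s, 0 ≤ s ∧ cumRate r s ≤ p.1 ∧ p.2 < a s}

theorem barrier_mono (r a : ℝ → ℝ) (v v' y : ℝ) (h : (v, y) ∈ barrier r a) (hv : v ≤ v') :
    (v', y) ∈ barrier r a := by
  obtain ⟨s, h1, h2, h3⟩ := h
  exact ⟨s, h1, le_trans h2 hv, h3⟩

section

variable {r : ℝ → ℝ}

theorem cumRate_of_nonneg {t : ℝ} (ht : 0 ≤ t) : cumRate r t = ∫ s in (0 : ℝ)..t, r s := by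
  rw [cumRate, max_eq_left ht]

@[simp] theorem cumRate_zero : cumRate r 0 = 0 := by simp [cumRate]

theorem intervalIntegrable_of_continuousOn_Ici (hr : ContinuousOn r (Ici 0)) {a b : ℝ}
    (ha : 0 ≤ a) (hb : 0 ≤ b) : IntervalIntegrable r volume a b :=
  (hr.mono fun _ hx => le_trans (le_min ha hb) hx.1).intervalIntegrable

theorem cumRate_sub (hr : ContinuousOn r (Ici 0)) {a b : ℝ} (ha : 0 ≤ a) (hb : 0 ≤ b) :
    cumRate r b - cumRate r a = ∫ s in a..b, r s := by
  rw [cumRate_of_nonneg ha, cumRate_of_nonneg hb,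
    intervalIntegral.integral_interval_sub_left
      (intervalIntegrable_of_continuousOn_Ici hr le_rfl hb)
      (intervalIntegrable_of_continuousOn_Ici hr le_rfl ha)]

theorem strictMonoOn_cumRate (hr : ContinuousOn r (Ici 0)) (hpos : ∀ t, 0 ≤ t → 0 < r t) :
    StrictMonoOn (cumRate r) (Ici 0) := by
  intro a ha b hb hab
  rw [← sub_pos, cumRate_sub hr ha hb]
  exact intervalIntegral.intervalIntegral_pos_of_pos_on
    (intervalIntegrable_of_continuousOn_Ici hr ha hb)
    (fun x hx => hpos x (le_trans ha hx.1.le)) hab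

theorem monotone_cumRate (hr : ContinuousOn r (Ici 0)) (hpos : ∀ t, 0 ≤ t → 0 < r t) :
    Monotone (cumRate r) := by
  intro a b hab
  have h : ∀ t, cumRate r t = cumRate r (max t 0) := fun t => by
    rw [cumRate, cumRate, max_eq_left (le_max_right t 0)]
  rw [h a, h b]
  exact (strictMonoOn_cumRate hr hpos).monotoneOn (mem_Ici.2 (le_max_right _ _))
    (mem_Ici.2 (le_max_right _ _))
    (max_le_max_right 0 hab)

theorem cumRate_nonneg (hr : ContinuousOn r (Ici 0)) (hpos : ∀ t, 0 ≤ t → 0 < r t) (t : ℝ) :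
    0 ≤ cumRate r t := by
  rcases le_total 0 t with h | h
  · rw [← cumRate_zero (r := r)]
    exact monotone_cumRate hr hpos h
  · rw [cumRate, max_eq_right h, intervalIntegral.integral_same]

theorem continuous_cumRate (hr : ContinuousOn r (Ici 0)) : Continuous (cumRate r) := by
  have h : ∀ t, cumRate r t = ∫ s in (0 : ℝ)..max t 0, r (max s 0) := fun t => by
    rw [cumRate]
    refine intervalIntegral.integral_congr fun s hs => ?_
    rw [uIcc_of_le (le_max_right _ _)] at hs
    simp only [max_eq_left hs.1]
  have hc : Continuous fun s => r (max s 0) :=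
    hr.comp_continuous (by fun_prop) fun s => le_max_right s 0
  rw [funext h]
  exact (intervalIntegral.continuous_primitive
    (fun a b => hc.intervalIntegrable a b) 0).comp (by fun_prop)

/-- As `r` is positive, `cumRate r` is strictly increasing, so the barrier is the premium function
read in the scale of positions. The existential form of `barrier` also makes sense at positions that
`cumRate r` never attains. -/
theorem mem_barrier_cumRate_iff (hr : ContinuousOn r (Ici 0)) (hpos : ∀ t, 0 ≤ t → 0 < r t)
    {a : ℝ → ℝ} (ha : MonotoneOn a (Ici 0)) {t y : ℝ} (ht : 0 ≤ t) :
    (cumRate r t, y) ∈ barrier r a ↔ y < a t := by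
  constructor
  · rintro ⟨s, h1, h2, h3⟩
    exact h3.trans_le (ha h1 ht (((strictMonoOn_cumRate hr hpos).le_iff_le h1 ht).1 h2))
  · exact fun h => ⟨t, ht, le_rfl, h⟩

/-- By continuity a deficit covered at `s` is covered strictly before `s`. Rationality gives the
measurability of the barrier; the strict time inequality serves for critical deficits and threshold
times. -/
theorem exists_rat_lt_of_lt {a : ℝ → ℝ} (ha : ContinuousOn a (Ici 0)) {s y : ℝ} (hs : 0 < s)
    (hy : y < a s) : ∃ q : ℚ, (0 : ℝ) < q ∧ (q : ℝ) < s ∧ y < a q := by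
  have h1 : ContinuousAt a s := ha.continuousAt (Ici_mem_nhds hs)
  have h2 : ∀ᶠ u in 𝓝 s, y < a u := h1.eventually (lt_mem_nhds hy)
  obtain ⟨l, hl, hl'⟩ := exists_Ioc_subset_of_mem_nhds h2 ⟨s - 1, by linarith⟩
  obtain ⟨q, hq1, hq2⟩ := exists_rat_btwn (max_lt hl hs)
  exact ⟨q, (le_max_right _ _).trans_lt hq1, hq2, hl' ⟨(le_max_left _ _).trans_lt hq1, hq2.le⟩⟩

theorem measurableSet_barrier (hr : ContinuousOn r (Ici 0)) (hpos : ∀ t, 0 ≤ t → 0 < r t)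
    {a : ℝ → ℝ} (ha : ContinuousOn a (Ici 0)) : MeasurableSet (barrier r a) := by
  have : barrier r a = ⋃ (q : ℚ) (_ : (0 : ℝ) ≤ q),
      {p : ℝ × ℝ | cumRate r q ≤ p.1} ∩ {p | p.2 < a q} := by
    ext p
    simp only [barrier, mem_ofPred_eq, mem_iUnion, mem_inter_iff, exists_prop]
    constructor
    · rintro ⟨s, h1, h2, h3⟩
      rcases h1.eq_or_lt with rfl | h1
      · exact ⟨0, by simp, by simpa using h2, by simpa using h3⟩
      · obtain ⟨q, hq0, hqs, hq⟩ := exists_rat_lt_of_lt ha h1 h3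
        exact ⟨q, hq0.le, (monotone_cumRate hr hpos hqs.le).trans h2, hq⟩
    · rintro ⟨q, h1, h2, h3⟩
      exact ⟨q, h1, h2, h3⟩
  rw [this]
  exact MeasurableSet.iUnion fun q => MeasurableSet.iUnion fun _ =>
    (measurableSet_le measurable_const measurable_fst).inter
      (measurableSet_lt measurable_snd measurable_const)

theorem exists_cumRate_eq (hr : ContinuousOn r (Ici 0)) (hpos : ∀ t, 0 ≤ t → 0 < r t)
    {t v : ℝ} (h0 : 0 ≤ v) (hv : v ≤ cumRate r t) : ∃ s, 0 ≤ s ∧ cumRate r s = v := by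
  have hmem : v ∈ Icc (cumRate r 0) (cumRate r (max t 0)) :=
    ⟨by simpa using h0, hv.trans (monotone_cumRate hr hpos (le_max_left _ _))⟩
  obtain ⟨s, hs, hsv⟩ := intermediate_value_Icc (le_max_right t 0)
    (continuous_cumRate hr).continuousOn hmem
  exact ⟨s, hs.1, hsv⟩

/-- For almost all `v` at most one deficit is critical at `v`. -/
theorem ae_subsingleton_critical (hr : ContinuousOn r (Ici 0)) (hpos : ∀ t, 0 ≤ t → 0 < r t)
    {a : ℝ → ℝ} (ha : ContinuousOn a (Ici 0)) (L : ℝ) :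
    ∀ᵐ v ∂(unifLaw L), {y | ∀ η > 0, (v + η, y) ∈ barrier r a ∧
      (v - η, y) ∉ barrier r a}.Subsingleton := by
  have h0 : ∀ᵐ v ∂(unifLaw L), v ∈ Ioc 0 L :=
    (unifLaw_absolutelyContinuous L).ae_le (ae_restrict_mem measurableSet_Ioc)
  -- If `cumRate r` is bounded, the barrier does not depend on the position beyond the supremum, so
  -- nothing is critical there and only the supremum has to be removed. If it is unbounded, `sSup`
  -- is a default value and removing one point is harmless.
  have h1 : ∀ᵐ v ∂(unifLaw L), v ≠ sSup (range (cumRate r)) := by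
    rw [ae_iff]
    simp
  filter_upwards [h0, h1] with v hv hv1
  by_cases hex : ∃ t, v ≤ cumRate r t
  · obtain ⟨t, ht⟩ := hex
    obtain ⟨s, hs, rfl⟩ := exists_cumRate_eq hr hpos hv.1.le ht
    have hs0 : 0 < s := by
      rcases hs.eq_or_lt with rfl | h
      · simp at hv
      · exact h
    have hac : ContinuousAt a s := ha.continuousAt (Ici_mem_nhds hs0)
    suffices h : ∀ y, (∀ η > 0, (cumRate r s + η, y) ∈ barrier r a ∧
        (cumRate r s - η, y) ∉ barrier r a) → y = a s from
      fun y hy z hz => (h y hy).trans (h z hz).symm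
    intro y hy
    apply le_antisymm
    · by_contra! hlt
      -- on a neighbourhood of `s` the premiums are below `y`
      obtain ⟨u, hu, hu'⟩ := exists_Ico_subset_of_mem_nhds
        (hac.eventually (gt_mem_nhds hlt)) ⟨s + 1, by linarith⟩
      obtain ⟨s', hs', h2, h3⟩ := (hy ((cumRate r ((s + u) / 2) - cumRate r s) / 2)
        (by
          have := strictMonoOn_cumRate hr hpos (a := s) (b := (s + u) / 2) hs0.le
            (show (0 : ℝ) ≤ _ by linarith) (by linarith)
          linarith)).1
      have hlt2 := strictMonoOn_cumRate hr hpos (a := s) (b := (s + u) / 2) hs0.le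
            (show (0 : ℝ) ≤ _ by linarith) (by linarith)
      simp only at h2 h3
      have h4 : s' < (s + u) / 2 := by
        rw [← (strictMonoOn_cumRate hr hpos).lt_iff_lt hs' (show (0 : ℝ) ≤ _ by linarith)]
        linarith
      -- Coverage before `s` would contradict that the deficit is not covered at slightly smaller
      -- positions; coverage just after `s` is excluded by the neighbourhood chosen above.
      rcases lt_or_ge s' s with h5 | h5
      · obtain ⟨s'', hs'', h6, h7⟩ : ∃ s'', 0 ≤ s'' ∧ s'' < s ∧ y < a s'' := ⟨s', hs', h5, h3⟩
        refine (hy (cumRate r s - cumRate r s'') ?_).2 ⟨s'', hs'', by simp, h7⟩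
        have := strictMonoOn_cumRate hr hpos (a := s'') (b := s) hs'' hs0.le h6
        linarith
      · have h6 : a s' < y := hu' ⟨h5, by linarith⟩
        linarith
    · by_contra! hlt
      obtain ⟨q, hq0, hqs, hq⟩ := exists_rat_lt_of_lt ha hs0 hlt
      refine (hy (cumRate r s - cumRate r q) ?_).2 ⟨q, hq0.le, by simp, hq⟩
      have := strictMonoOn_cumRate hr hpos (a := (q : ℝ)) (b := s) hq0.le hs0.le hqs
      linarith
  · push Not at hex
    have hlt : sSup (range (cumRate r)) < v :=
      lt_of_le_of_ne (csSup_le (range_nonempty _) (by rintro _ ⟨t, rfl⟩; exact (hex t).le)) hv1.symm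
    intro y hy
    exfalso
    obtain ⟨h2, h3⟩ := hy (v - sSup (range (cumRate r))) (by linarith)
    obtain ⟨s, hs, -, h5⟩ := h2
    exact h3 ⟨s, hs, by
      simp only [sub_sub_cancel]
      exact le_csSup ⟨v, by rintro _ ⟨t, rfl⟩; exact (hex t).le⟩ ⟨s, rfl⟩, h5⟩

/-- With `mem_barrier_add_of_lt`, this encloses the capital test at the real time `T` between
barrier tests at the positions `v - η` and `v + η`, when `v` is within `η` of `cumRate r T`. -/
theorem lt_of_mem_barrier_sub (hr : ContinuousOn r (Ici 0)) (hpos : ∀ t, 0 ≤ t → 0 < r t)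
    {a : ℝ → ℝ} (ha : MonotoneOn a (Ici 0)) {T v y η : ℝ} (hT : 0 ≤ T)
    (h : |v - cumRate r T| ≤ η) (hy : (v - η, y) ∈ barrier r a) : y < a T := by
  rw [← mem_barrier_cumRate_iff hr hpos ha hT]
  exact barrier_mono _ _ _ _ _ hy (by linarith [(abs_le.1 h).2])

theorem mem_barrier_add_of_lt {a : ℝ → ℝ} {T v y η : ℝ} (hT : 0 ≤ T)
    (h : |v - cumRate r T| ≤ η) (hy : y < a T) : (v + η, y) ∈ barrier r a :=
  ⟨T, hT, by simp only; linarith [(abs_le.1 h).1], hy⟩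

theorem withDensity_Ioc_eq_cumRate (hr : ContinuousOn r (Ici 0)) (hpos : ∀ t, 0 ≤ t → 0 < r t)
    {t : ℝ} (ht : 0 ≤ t) :
    (volume.withDensity fun s => ENNReal.ofReal (r s)) (Ioc 0 t) =
      ENNReal.ofReal (cumRate r t) := by
  rw [withDensity_apply _ measurableSet_Ioc, cumRate_of_nonneg ht,
    intervalIntegral.integral_of_le ht, ofReal_integral_eq_lintegral_ofReal]
  · exact (intervalIntegrable_iff_integrableOn_Ioc_of_le ht).1
      (intervalIntegrable_of_continuousOn_Ici hr le_rfl ht)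
  · exact (ae_restrict_mem measurableSet_Ioc).mono fun s hs => (hpos s hs.1.le).le

theorem cumRate_pos (hr : ContinuousOn r (Ici 0)) (hpos : ∀ t, 0 ≤ t → 0 < r t)
    {t : ℝ} (ht : 0 < t) : 0 < cumRate r t := by
  simpa using strictMonoOn_cumRate hr hpos (mem_Ici.2 le_rfl) ht.le ht

theorem isProbabilityMeasure_arrivalLaw (hr : ContinuousOn r (Ici 0))
    (hpos : ∀ t, 0 ≤ t → 0 < r t) {t : ℝ} (ht : 0 < t) :
    IsProbabilityMeasure (arrivalLaw r t) := by
  refine cond_isProbabilityMeasure_of_finite ?_ ?_ <;>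
    rw [withDensity_Ioc_eq_cumRate hr hpos ht.le]
  · simpa using cumRate_pos hr hpos ht
  · exact ENNReal.ofReal_ne_top

theorem ae_arrivalLaw_mem (r : ℝ → ℝ) (t : ℝ) : ∀ᵐ u ∂(arrivalLaw r t), u ∈ Ioc 0 t :=
  ae_cond_mem measurableSet_Ioc

theorem arrivalLaw_absolutelyContinuous (r : ℝ → ℝ) (t : ℝ) : arrivalLaw r t ≪ volume :=
  cond_absolutelyContinuous.trans (withDensity_absolutelyContinuous _ _)

instance (r : ℝ → ℝ) (t : ℝ) : NullSingletonClass (arrivalLaw r t) :=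
  ⟨fun x => (arrivalLaw_absolutelyContinuous r t) (measure_singleton x)⟩

/-- The probability integral transform: on `(0, t]` the arrival law has distribution function
`cumRate r y / cumRate r t`. -/
theorem map_cumRate_arrivalLaw (hr : ContinuousOn r (Ici 0)) (hpos : ∀ t, 0 ≤ t → 0 < r t)
    {t : ℝ} (ht : 0 < t) : (arrivalLaw r t).map (cumRate r) = unifLaw (cumRate r t) := by
  have hv := cumRate_pos hr hpos ht
  have h1 := isProbabilityMeasure_arrivalLaw hr hpos ht
  have h2 := isProbabilityMeasure_unifLaw hv
  have hm := (continuous_cumRate hr).measurable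
  have : IsProbabilityMeasure ((arrivalLaw r t).map (cumRate r)) :=
    Measure.isProbabilityMeasure_map hm.aemeasurable
  refine Measure.ext_of_Iic _ _ fun a => ?_
  rw [Measure.map_apply hm measurableSet_Iic, arrivalLaw, cond_apply measurableSet_Ioc,
    withDensity_Ioc_eq_cumRate hr hpos ht.le, unifLaw, Measure.smul_apply, smul_eq_mul,
    Measure.restrict_apply measurableSet_Iic]
  congr 1
  rcases lt_or_ge a 0 with ha | ha
  · have e1 : Ioc 0 t ∩ cumRate r ⁻¹' Iic a = ∅ := by
      ext u
      simp only [mem_inter_iff, mem_preimage, mem_Iic, mem_empty_iff_false, iff_false, not_and,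
        not_le]
      exact fun _ => ha.trans_le (cumRate_nonneg hr hpos u)
    have e2 : Iic a ∩ Ioc 0 (cumRate r t) = ∅ := by
      ext u
      simp only [mem_inter_iff, mem_Iic, mem_Ioc, mem_empty_iff_false, iff_false]
      rintro ⟨h1, h2, _⟩
      linarith
    rw [e1, e2, measure_empty, measure_empty]
  · obtain ⟨s, hs, hsa⟩ := exists_cumRate_eq hr hpos (le_min ha hv.le) (min_le_right a _)
    have e1 : Ioc 0 t ∩ cumRate r ⁻¹' Iic a = Ioc 0 s := by
      ext u
      simp only [mem_inter_iff, mem_preimage, mem_Iic, mem_Ioc]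
      constructor
      · rintro ⟨⟨h1, h2⟩, h3⟩
        refine ⟨h1, ?_⟩
        rw [← (strictMonoOn_cumRate hr hpos).le_iff_le h1.le hs, hsa]
        exact le_min h3 (monotone_cumRate hr hpos h2)
      · rintro ⟨h1, h2⟩
        have h3 : cumRate r u ≤ min a (cumRate r t) := hsa ▸ monotone_cumRate hr hpos h2
        exact ⟨⟨h1, ((strictMonoOn_cumRate hr hpos).le_iff_le h1.le ht.le).1
          (h3.trans (min_le_right _ _))⟩, h3.trans (min_le_left _ _)⟩
    have e2 : Iic a ∩ Ioc 0 (cumRate r t) = Ioc 0 (min a (cumRate r t)) := by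
      ext u
      simp only [mem_inter_iff, mem_Iic, mem_Ioc, le_min_iff]
      tauto
    rw [e1, e2, withDensity_Ioc_eq_cumRate hr hpos hs, hsa, Real.volume_Ioc, sub_zero]

end

/-! ### Sorting of arrivals and the survival probability. -/

theorem MeasureTheory.measurePreserving_pi_comp_injective {ι κ : Type*} [Fintype ι] [Fintype κ]
    {μ : κ → Measure ℝ} [∀ k, IsProbabilityMeasure (μ k)] {g : ι → κ} (hg : Function.Injective g) :
    MeasurePreserving (fun w i => w (g i)) (Measure.pi μ) (Measure.pi fun i => μ (g i)) := by
  have hm : Measurable fun (w : κ → ℝ) (i : ι) => w (g i) := by fun_prop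
  refine ⟨hm, (Measure.pi_eq fun s hs => ?_).symm⟩
  rw [Measure.map_apply hm (MeasurableSet.univ_pi hs)]
  have h1 := (iIndepFun_pi (μ := μ) (X := fun _ => id) fun i => aemeasurable_id).precomp hg
  have h2 := h1.measure_inter_preimage_eq_mul Finset.univ (fun i _ => hs i)
  have h3 : ∀ i, Measure.pi μ ((fun w => id (w (g i))) ⁻¹' s i) = μ (g i) (s i) := fun i =>
    (measurePreserving_eval μ (g i)).measure_preimage (hs i).nullMeasurableSet
  simp only [h3] at h2
  rw [← h2]
  congr 1
  ext w; simp

/-- The sorting permutation has finitely many values, and `Tuple.eq_sort_iff` describes the set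
where each is taken by finitely many comparisons of coordinates, ties included. -/
theorem measurable_sort_apply {β γ : Type*} [MeasurableSpace β] [MeasurableSpace γ] {θ : ℕ}
    {F : Equiv.Perm (Fin θ) → β → γ} (hF : ∀ σ, Measurable (F σ)) {U : β → Fin θ → ℝ}
    (hU : Measurable U) : Measurable fun b => F (Tuple.sort (U b)) b := by
  have hU' : ∀ i, Measurable fun b => U b i := fun i => (measurable_pi_apply i).comp hU
  have h1 : ∀ σ : Equiv.Perm (Fin θ), MeasurableSet {b | Tuple.sort (U b) = σ} := by
    intro σ
    have : {b | Tuple.sort (U b) = σ} =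
        (⋂ (i) (j) (_ : i ≤ j), {b | U b (σ i) ≤ U b (σ j)}) ∩
        ⋂ (i) (j) (_ : i < j) (_ : ¬ σ i < σ j), {b | U b (σ i) = U b (σ j)}ᶜ := by
      ext b
      rw [mem_ofPred_eq, eq_comm, Tuple.eq_sort_iff]
      simp only [mem_inter_iff, mem_iInter, mem_ofPred_eq, mem_compl_iff, Monotone,
        Function.comp_apply]
      refine and_congr (by tauto) ?_
      refine forall_congr' fun i => forall_congr' fun j => forall_congr' fun _ => ?_
      tauto
    rw [this]
    refine MeasurableSet.inter ?_ ?_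
    · exact MeasurableSet.iInter fun i => MeasurableSet.iInter fun j => MeasurableSet.iInter
        fun _ => measurableSet_le (hU' _) (hU' _)
    · exact MeasurableSet.iInter fun i => MeasurableSet.iInter fun j => MeasurableSet.iInter
        fun _ => MeasurableSet.iInter fun _ => (measurableSet_eq_fun (hU' _) (hU' _)).compl
  intro s hs
  have : (fun b => F (Tuple.sort (U b)) b) ⁻¹' s =
      ⋃ σ, {b | Tuple.sort (U b) = σ} ∩ F σ ⁻¹' s := by
    ext b; simp
  rw [this]
  exact MeasurableSet.iUnion fun σ => (h1 σ).inter (hF σ hs)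

theorem measurable_orderStat {θ : ℕ} (k : Fin θ) : Measurable fun u : Fin θ → ℝ => orderStat u k :=
  measurable_sort_apply (F := fun σ u => u (σ k)) (fun σ => by fun_prop) measurable_id

/-- Sorting the losses by independent arrival times does not change their joint law. -/
theorem measurePreserving_sort {θ : ℕ} (μ ν : Measure ℝ) [IsProbabilityMeasure μ]
    [IsProbabilityMeasure ν] :
    MeasurePreserving (fun q : (Fin θ → ℝ) × (Fin θ → ℝ) =>
        ((fun i => q.1 (Tuple.sort q.2 i)), q.2))
      ((Measure.pi fun _ => μ).prod (Measure.pi fun _ => ν))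
      ((Measure.pi fun _ => μ).prod (Measure.pi fun _ => ν)) := by
  have h1 : MeasurePreserving (fun q : (Fin θ → ℝ) × (Fin θ → ℝ) =>
        (q.1, fun i => q.2 (Tuple.sort q.1 i)))
      ((Measure.pi fun _ => ν).prod (Measure.pi fun _ => μ))
      ((Measure.pi fun _ => ν).prod (Measure.pi fun _ => μ)) := by
    -- For fixed arrival times the sort is a fixed permutation of independent identically
    -- distributed losses, which preserves their law.
    refine (MeasurePreserving.id _).skew_product 
      (g := fun (u ℓ : Fin θ → ℝ) i => ℓ (Tuple.sort u i)) ?_ ?_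
    · exact measurable_sort_apply (F := fun σ (q : (Fin θ → ℝ) × (Fin θ → ℝ)) i => q.2 (σ i))
        (fun σ => by fun_prop) measurable_fst
    · exact ae_of_all _ fun u =>
        (measurePreserving_pi_comp_injective (μ := fun _ : Fin θ => μ)
          (Tuple.sort u).injective).map_eq
  exact (Measure.measurePreserving_swap.comp h1).comp Measure.measurePreserving_swap

namespace RiskModel

variable {X : Type*} (M : RiskModel X) (x : X)

/-- The law of a shock, `θ` losses and `θ` independent positions with law `ν`. -/
noncomputable def pathLaw (θ : ℕ) (ν : Measure ℝ) :
    Measure (ℝ × (Fin θ → ℝ) × (Fin θ → ℝ)) :=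
  (M.shockLaw x).prod ((Measure.pi fun _ => M.lossLaw x).prod (Measure.pi fun _ => ν))

variable {x}

theorem continuous_α_max : Continuous fun s => M.α x (max s 0) :=
  (M.α_cont x).comp_continuous (by fun_prop) fun s => le_max_right s 0

theorem measurable_deficit : Measurable (M.deficit x) := by unfold deficit; fun_prop

/-- Given the second component, equality determines the shock because `γ` is positive, and the shock
has a density. This makes strict and weak inequalities for the capital interchangeable. -/
theorem measure_deficit_eq {β : Type*} [MeasurableSpace β] (ρ : Measure β) [SFinite ρ]
    {h : β → ℝ} (hh : Measurable h) :
    (M.shockLaw x).prod ρ {p | M.deficit x p.1 = h p.2} = 0 := by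
  have hm : MeasurableSet {p : ℝ × β | M.deficit x p.1 = h p.2} :=
    measurableSet_eq_fun (M.measurable_deficit.comp measurable_fst) (hh.comp measurable_snd)
  rw [Measure.prod_apply_symm hm, lintegral_eq_zero_iff' (measurable_measure_prodMk_right
    hm).aemeasurable]
  refine ae_of_all _ fun b => M.shock_density x (Set.Subsingleton.measure_zero
    (fun a ha a' ha' => ?_) _)
  have h1 : M.deficit x a = M.deficit x a' := Eq.trans ha (Eq.symm ha')
  have h3 := M.γ_pos x
  simp only [deficit] at h1
  have h4 : M.γ x * (a - a') = 0 := by linarith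
  rcases mul_eq_zero.1 h4 with h5 | h5
  · exact absurd h5 h3.ne'
  · linarith

/-- A zero infimum only gives the inequality at arbitrarily small positive times; continuity of `α`
carries it to time `0`. -/
theorem thresholdTime_zero_iff {θ : ℕ} (ε : ℝ) (ℓ : Fin θ → ℝ) :
    M.thresholdTime x ε ℓ 0 = 0 ↔ M.deficit x ε ≤ M.α x 0 := by
  have hs : ∀ t, (∑ i : Fin θ with i.val < 0, ℓ i ≤ M.γ x * (1 - ε) + M.α x t - M.δ x) ↔
      M.deficit x ε ≤ M.α x t := fun t => by
    simp only [not_lt_zero, Finset.filter_false, Finset.sum_empty, deficit]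
    constructor <;> intro h <;> linarith
  simp only [thresholdTime, hs]
  constructor
  · intro h
    have h1 : ∀ t > 0, M.deficit x ε ≤ M.α x (max t 0) := by
      intro t ht
      have h2 : (⨅ (t : ℝ) (_ : 0 ≤ t ∧ M.deficit x ε ≤ M.α x t), ENNReal.ofReal t) <
          ENNReal.ofReal t := by
        rw [h]; simpa using ht
      simp only [iInf_lt_iff] at h2
      obtain ⟨s, ⟨hs0, hs1⟩, hst⟩ := h2
      rw [ENNReal.ofReal_lt_ofReal_iff ht] at hst
      rw [max_eq_left ht.le]
      exact hs1.trans (M.α_mono x hs0 ht.le hst.le)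
    have h2 := ge_of_tendsto ((M.continuous_α_max (x := x)).continuousAt.tendsto.mono_left
      (nhdsWithin_le_nhds (a := 0) (s := Ioi 0))) (eventually_mem_nhdsWithin.mono fun t ht => h1 t ht)
    simpa using h2
  · intro h
    refine le_antisymm ((iInf₂_le (0 : ℝ) ⟨le_rfl, h⟩).trans (by simp)) zero_le

/-- With `thresholdTime_lt_of_lt` this is an equivalence up to the case of equality, which is null
by `measure_deficit_eq`. -/
theorem le_of_thresholdTime_lt {θ k : ℕ} {ε u : ℝ} {ℓ : Fin θ → ℝ} (hu : 0 < u)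
    (h : M.thresholdTime x ε ℓ k < ENNReal.ofReal u) :
    M.deficit x ε + ∑ i with i.val < k, ℓ i ≤ M.α x u := by
  simp only [thresholdTime, iInf_lt_iff] at h
  obtain ⟨s, ⟨hs0, hs1⟩, hst⟩ := h
  rw [ENNReal.ofReal_lt_ofReal_iff hu] at hst
  have := M.α_mono x (mem_Ici.2 hs0) (mem_Ici.2 hu.le) hst.le
  simp only [deficit]
  linarith

theorem thresholdTime_lt_of_lt {θ k : ℕ} {ε u : ℝ} {ℓ : Fin θ → ℝ} (hu : 0 < u)
    (h : M.deficit x ε + ∑ i with i.val < k, ℓ i < M.α x u) :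
    M.thresholdTime x ε ℓ k < ENNReal.ofReal u := by
  obtain ⟨q, hq0, hqu, hq⟩ := exists_rat_lt_of_lt (M.α_cont x) hu h
  simp only [thresholdTime, iInf_lt_iff]
  refine ⟨q, ⟨hq0.le, ?_⟩, (ENNReal.ofReal_lt_ofReal_iff hu).2 hqu⟩
  simp only [deficit] at hq
  linarith

/-- The probability of survival in terms of the losses at arrival times in any order. -/
theorem survival_eq {r : ℝ → ℝ} (hr : ContinuousOn r (Ici 0)) (hpos : ∀ t, 0 ≤ t → 0 < r t)
    {t : ℝ} (ht : 0 < t) (θ : ℕ) :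
    M.survival r x θ t = (M.pathLaw x θ (arrivalLaw r t)).real
      {p | M.deficit x p.1 < M.α x 0 ∧
        ∀ k, M.deficit x p.1 + cumLoss p.2.1 p.2.2 k < M.α x (max (p.2.2 k) 0)} := by
  have := isProbabilityMeasure_arrivalLaw hr hpos ht
  let Z : Set (ℝ × (Fin θ → ℝ) × (Fin θ → ℝ)) := {p | M.deficit x p.1 < M.α x 0 ∧
    ∀ k : Fin θ, M.deficit x p.1 + ∑ i with i.val < k.val + 1, p.2.1 i <
      M.α x (max (orderStat p.2.2 k) 0)}
  have hα := (M.continuous_α_max (x := x)).measurable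
  have hord : ∀ k : Fin θ, Measurable fun q : (Fin θ → ℝ) × (Fin θ → ℝ) =>
      M.α x (max (orderStat q.2 k) 0) - ∑ i with i.val < k.val + 1, q.1 i := fun k =>
    (hα.comp ((measurable_orderStat k).comp measurable_snd)).sub
      (Finset.measurable_sum _ fun i _ => by fun_prop)
  have hZm : MeasurableSet Z := by
    have : Z = {p | M.deficit x p.1 < M.α x 0} ∩ ⋂ k : Fin θ, {p | M.deficit x p.1 <
        M.α x (max (orderStat p.2.2 k) 0) - ∑ i with i.val < k.val + 1, p.2.1 i} := by
      ext p; simp [Z, lt_sub_iff_add_lt]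
    rw [this]
    exact (measurableSet_lt (M.measurable_deficit.comp measurable_fst) measurable_const).inter
      (MeasurableSet.iInter fun k => measurableSet_lt (M.measurable_deficit.comp measurable_fst)
        ((hord k).comp measurable_snd))
  have hu : ∀ᵐ p ∂(M.pathLaw x θ (arrivalLaw r t)), ∀ k, 0 < p.2.2 k := by
    rw [ae_all_iff]
    intro k
    have h := ((measurePreserving_eval (fun _ : Fin θ => arrivalLaw r t) k).comp
      (measurePreserving_snd (μ := Measure.pi fun _ : Fin θ => M.lossLaw x)
        (ν := Measure.pi fun _ : Fin θ => arrivalLaw r t))).comp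
      (measurePreserving_snd (μ := M.shockLaw x))
    exact h.quasiMeasurePreserving.ae ((ae_arrivalLaw_mem r t).mono fun u hu => hu.1)
  have hinj : ∀ᵐ p ∂(M.pathLaw x θ (arrivalLaw r t)), Function.Injective p.2.2 := by
    have : ∀ᵐ p ∂(M.pathLaw x θ (arrivalLaw r t)), ∀ i j, i ≠ j → p.2.2 i ≠ p.2.2 j := by
      simp only [ae_all_iff]
      intro i j hij
      have h := (measurePreserving_snd (μ := Measure.pi fun _ : Fin θ => M.lossLaw x)
        (ν := Measure.pi fun _ : Fin θ => arrivalLaw r t)).comp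
        (measurePreserving_snd (μ := M.shockLaw x))
      refine h.quasiMeasurePreserving.ae (p := fun w => w i ≠ w j) ?_
      rw [ae_iff]
      simpa using Measure.pi_setOf_eval_eq (arrivalLaw r t) hij
    filter_upwards [this] with p hp i j hij
    by_contra hne
    exact hp i j hne hij
  -- Threshold times are traded for strict capital inequalities at the ordered arrival times, up to
  -- a null set.
  have h1 : M.survival r x θ t = (M.pathLaw x θ (arrivalLaw r t)).real Z := by
    rw [survival]
    change (M.pathLaw x θ (arrivalLaw r t)).real _ = _
    refine measureReal_congr ?_
    have hn0 : ∀ᵐ p ∂(M.pathLaw x θ (arrivalLaw r t)), M.deficit x p.1 ≠ M.α x 0 := by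
      rw [ae_iff]
      simp only [ne_eq, not_not, pathLaw]
      exact M.measure_deficit_eq (x := x) _ (h := fun _ => M.α x 0) measurable_const
    have hn : ∀ᵐ p ∂(M.pathLaw x θ (arrivalLaw r t)), ∀ k : Fin θ, M.deficit x p.1 ≠
        M.α x (max (orderStat p.2.2 k) 0) - ∑ i with i.val < k.val + 1, p.2.1 i := by
      rw [ae_all_iff]
      intro k
      rw [ae_iff]
      simp only [ne_eq, not_not, pathLaw]
      exact M.measure_deficit_eq (x := x) _ (hord k)
    filter_upwards [hu, hn0, hn] with p hp hp0 hpn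
    refine propext (and_congr ?_ (forall_congr' fun k => ?_))
    · rw [thresholdTime_zero_iff]
      exact ⟨fun h => h.lt_of_ne hp0, le_of_lt⟩
    · have hpk : 0 < orderStat p.2.2 k := hp _
      constructor
      · intro h
        have h1 := M.le_of_thresholdTime_lt hpk h
        rw [max_eq_left hpk.le]
        refine h1.lt_of_ne fun h2 => hpn k ?_
        rw [max_eq_left hpk.le, ← h2, add_sub_cancel_right]
      · intro h
        rw [max_eq_left hpk.le] at h
        exact M.thresholdTime_lt_of_lt hpk h
  -- The definition attaches the `k`-th loss to the `k`-th smallest arrival time. Feeding it the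
  -- losses permuted by arrival order attaches each loss to its own arrival time, which is how
  -- agents are described.
  have hmp := (MeasurePreserving.id (M.shockLaw x)).prod
    (measurePreserving_sort (θ := θ) (M.lossLaw x) (arrivalLaw r t))
  rw [h1, Measure.real, Measure.real, pathLaw, ← hmp.measure_preimage hZm.nullMeasurableSet]
  congr 1
  refine measure_congr ?_
  filter_upwards [hinj] with p hp
  refine propext (and_congr Iff.rfl ?_)
  refine Iff.trans (forall_congr' fun k => ?_) (Tuple.sort p.2.2).forall_congr_right
  change M.deficit x p.1 + ∑ i with i.val < k.val + 1, p.2.1 (Tuple.sort p.2.2 i) <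
    M.α x (max (p.2.2 (Tuple.sort p.2.2 k)) 0) ↔ _
  have hsm : StrictMono (p.2.2 ∘ Tuple.sort p.2.2) :=
    (Tuple.monotone_sort p.2.2).strictMono_of_injective (hp.comp (Tuple.sort p.2.2).injective)
  have : ∑ i with i.val < k.val + 1, p.2.1 (Tuple.sort p.2.2 i) =
      cumLoss p.2.1 p.2.2 (Tuple.sort p.2.2 k) := by
    rw [cumLoss, Finset.sum_filter]
    refine Eq.trans (Finset.sum_congr rfl fun i _ => ?_) (Equiv.sum_comp (Tuple.sort p.2.2)
      fun i => if p.2.2 i ≤ p.2.2 (Tuple.sort p.2.2 k) then p.2.1 i else 0)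
    have h3 : p.2.2 (Tuple.sort p.2.2 i) ≤ p.2.2 (Tuple.sort p.2.2 k) ↔ i.val < k.val + 1 :=
      (hsm.le_iff_le (a := i) (b := k)).trans Nat.lt_succ_iff.symm
    exact if_congr h3.symm rfl rfl
  rw [this]

/-- Data with `θ` losses that are survived with respect to `B`. -/
def pathSet (x : X) (B : Set (ℝ × ℝ)) (θ : ℕ) : Set (ℝ × (Fin θ → ℝ) × (Fin θ → ℝ)) :=
  {p | M.deficit x p.1 < M.α x 0 ∧ ∀ k, (p.2.2 k, M.deficit x p.1 + cumLoss p.2.1 p.2.2 k) ∈ B}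

theorem measurableSet_pathSet {B : Set (ℝ × ℝ)} (hB : MeasurableSet B) (θ : ℕ) :
    MeasurableSet (M.pathSet x B θ) := by
  have : M.pathSet x B θ = {p | M.deficit x p.1 < M.α x 0} ∩
      ⋂ k, {p | (p.2.2 k, M.deficit x p.1 + cumLoss p.2.1 p.2.2 k) ∈ B} := by
    ext p; simp [pathSet]
  rw [this]
  refine (measurableSet_lt (M.measurable_deficit.comp measurable_fst) measurable_const).inter
    (MeasurableSet.iInter fun k => ?_)
  have : Measurable fun p : ℝ × (Fin θ → ℝ) × (Fin θ → ℝ) =>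
      (p.2.2 k, M.deficit x p.1 + cumLoss p.2.1 p.2.2 k) :=
    Measurable.prodMk (by fun_prop) ((M.measurable_deficit.comp measurable_fst).add
      ((measurable_cumLoss k).comp measurable_snd))
  exact this hB

/-- `cumRate r` turns arrival times into uniform positions and keeps their order, hence also
`cumLoss`. -/
theorem survival_eq_pathSet {r : ℝ → ℝ} (hr : ContinuousOn r (Ici 0))
    (hpos : ∀ t, 0 ≤ t → 0 < r t) {t : ℝ} (ht : 0 < t) (θ : ℕ) :
    M.survival r x θ t = (M.pathLaw x θ (unifLaw (cumRate r t))).real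
      (M.pathSet x (barrier r (M.α x)) θ) := by
  have := isProbabilityMeasure_arrivalLaw hr hpos ht
  have hΦ := (continuous_cumRate hr).measurable
  have hmp : MeasurePreserving (cumRate r) (arrivalLaw r t) (unifLaw (cumRate r t)) :=
    ⟨hΦ, map_cumRate_arrivalLaw hr hpos ht⟩
  have hv := isProbabilityMeasure_unifLaw (cumRate_pos hr hpos ht)
  have hmp2 := (MeasurePreserving.id (M.shockLaw x)).prod
    ((MeasurePreserving.id (Measure.pi fun _ : Fin θ => M.lossLaw x)).prod
      (measurePreserving_pi (fun _ : Fin θ => arrivalLaw r t) (fun _ => unifLaw (cumRate r t))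
        fun _ => hmp))
  rw [M.survival_eq hr hpos ht, Measure.real, Measure.real, pathLaw, pathLaw,
    ← hmp2.measure_preimage (M.measurableSet_pathSet
      (measurableSet_barrier hr hpos (M.α_cont x)) θ).nullMeasurableSet]
  congr 1
  refine measure_congr ?_
  have hu : ∀ᵐ p ∂(M.pathLaw x θ (arrivalLaw r t)), ∀ k, 0 < p.2.2 k := by
    rw [ae_all_iff]
    intro k
    have h := ((measurePreserving_eval (fun _ : Fin θ => arrivalLaw r t) k).comp
      (measurePreserving_snd (μ := Measure.pi fun _ : Fin θ => M.lossLaw x)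
        (ν := Measure.pi fun _ : Fin θ => arrivalLaw r t))).comp
      (measurePreserving_snd (μ := M.shockLaw x))
    exact h.quasiMeasurePreserving.ae ((ae_arrivalLaw_mem r t).mono fun u hu => hu.1)
  filter_upwards [hu] with p hp
  refine propext (and_congr Iff.rfl (forall_congr' fun k => ?_))
  have hc : cumLoss p.2.1 (fun i => cumRate r (p.2.2 i)) k = cumLoss p.2.1 p.2.2 k := by
    refine Finset.sum_congr rfl fun i _ => ?_
    have h3 := (strictMonoOn_cumRate hr hpos).le_iff_le (hp i).le (hp k).le
    simp only [h3]
  rw [max_eq_left (hp k).le]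
  rw [← hc]
  exact (mem_barrier_cumRate_iff hr hpos (M.α_mono x) (hp k).le).symm

end RiskModel

/-! ### Binomial splitting of the uniform positions. -/

theorem MeasureTheory.Measure.pi_smul_eq {ι : Type*} [Fintype ι] (c : ι → ℝ≥0∞)
    (hc : ∀ i, c i ≠ ∞) (μ : ι → Measure ℝ) [∀ i, IsFiniteMeasure (μ i)] :
    Measure.pi (fun i => c i • μ i) = (∏ i, c i) • Measure.pi μ := by
  have : ∀ i, IsFiniteMeasure (c i • μ i) := fun i => Measure.smul_finite _ (hc i)
  refine Measure.pi_eq fun s _ => ?_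
  simp [Measure.pi_pi, Finset.prod_mul_distrib]

theorem unifLaw_restrict_Iio {L v : ℝ} (hv : 0 < v) (hvL : v ≤ L) :
    (unifLaw L).restrict (Iio v) = ENNReal.ofReal (v / L) • unifLaw v := by
  have h1 : Iio v ∩ Ioc 0 L = Ioo 0 v := by
    ext u
    simp only [mem_inter_iff, mem_Iio, mem_Ioc, mem_Ioo]
    constructor
    · rintro ⟨h1, h2, _⟩; exact ⟨h2, h1⟩
    · rintro ⟨h1, h2⟩; exact ⟨h2, h1, by linarith⟩
  rw [unifLaw, unifLaw, Measure.restrict_smul, Measure.restrict_restrict measurableSet_Iio, h1,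
    Measure.restrict_congr_set Ioo_ae_eq_Ioc, smul_smul, ENNReal.ofReal_div_of_pos (by linarith)]
  congr 1
  rw [div_eq_mul_inv, mul_comm (ENNReal.ofReal v), mul_assoc, ENNReal.mul_inv_cancel
    (by simpa using hv) ENNReal.ofReal_ne_top, mul_one]

theorem unifLaw_Ici {L v : ℝ} (hL : 0 < L) (hv : 0 < v) :
    unifLaw L (Ici v) = ENNReal.ofReal (1 - v / L) := by
  have h1 : Ici v ∩ Ioc 0 L = Icc v L := by
    ext u
    simp only [mem_inter_iff, mem_Ici, mem_Ioc, mem_Icc]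
    constructor
    · rintro ⟨h1, h2, h3⟩; exact ⟨h1, h3⟩
    · rintro ⟨h1, h2⟩; exact ⟨h1, by linarith, h2⟩
  rw [unifLaw, Measure.smul_apply, Measure.restrict_apply measurableSet_Ici, h1, Real.volume_Icc,
    smul_eq_mul, ← ENNReal.ofReal_inv_of_pos hL, ← ENNReal.ofReal_mul (inv_nonneg.2 hL.le)]
  congr 1
  field_simp

/-- The existential form covers a set of mass zero, which occurs for the positions beyond `v` when
`v = L`; there any probability measure serves. -/
theorem exists_isProbabilityMeasure_restrict (ν : Measure ℝ) [IsProbabilityMeasure ν] (s : Set ℝ) :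
    ∃ ν' : Measure ℝ, IsProbabilityMeasure ν' ∧ ν.restrict s = ν s • ν' := by
  by_cases h : ν s = 0
  · exact ⟨ν, inferInstance, by rw [h, zero_smul, Measure.restrict_eq_zero.2 h]⟩
  · refine ⟨ν[|s], cond_isProbabilityMeasure h, ?_⟩
    rw [ProbabilityTheory.cond, smul_smul, ENNReal.mul_inv_cancel h (measure_ne_top _ _), one_smul]

namespace RiskModel

variable {X : Type*} (M : RiskModel X) {x : X}

theorem cumLoss_comp_of_mem {ι κ : Type*} [Fintype ι] [Fintype κ] {g : ι ↪ κ} {ℓ w : κ → ℝ}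
    {k : ι} (h : ∀ i, i ∉ range g → w (g k) < w i) :
    cumLoss ℓ w (g k) = cumLoss (fun i => ℓ (g i)) (fun i => w (g i)) k := by
  classical
  rw [cumLoss, cumLoss]
  rw [← Finset.sum_map Finset.univ g (fun i => if w i ≤ w (g k) then ℓ i else 0)]
  refine (Finset.sum_subset (Finset.subset_univ _) fun i _ hi => ?_).symm
  rw [if_neg]
  rw [not_le]
  exact h i (by simpa using hi)

/-- The probability that exactly the half-edges in `A` have positions before `v` and that their
losses are survived. -/
theorem dataLaw_real_inter {L v : ℝ} [hL : Fact (0 < L)] (hv : 0 < v) (hvL : v ≤ L)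
    {B : Set (ℝ × ℝ)} (hB : MeasurableSet B) {θ : ℕ} {A : Finset (Fin (M.inDeg x))}
    (hA : A.card = θ) :
    (M.dataLaw x L).real {p | (∀ j, p.2.2 j < v ↔ j ∈ A) ∧ M.deficit x p.1 < M.α x 0 ∧
      ∀ j ∈ A, (p.2.2 j, M.deficit x p.1 + cumLoss p.2.1 p.2.2 j) ∈ B} =
    (v / L) ^ θ * (1 - v / L) ^ (M.inDeg x - θ) *
      (M.pathLaw x θ (unifLaw v)).real (M.pathSet x B θ) := by
  classical
  have hv' : Fact (0 < v) := ⟨hv⟩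
  have hL0 := hL.out
  have hd : v / L ≤ 1 := (div_le_one hL0).2 hvL
  let g : Fin θ ↪ Fin (M.inDeg x) := (A.orderEmbOfFin hA).toEmbedding
  have hg : range g = A := by simp [g]
  let s : Fin (M.inDeg x) → Set ℝ := fun j => if j ∈ A then Iio v else Ici v
  have hs : ∀ j, MeasurableSet (s j) := fun j => by
    by_cases h : j ∈ A <;> simp [s, h]
  let Ψ : M.AgentData x → ℝ × (Fin θ → ℝ) × (Fin θ → ℝ) :=
    fun p => (p.1, (fun i => p.2.1 (g i)), fun i => p.2.2 (g i))
  have hset : {p : M.AgentData x | (∀ j, p.2.2 j < v ↔ j ∈ A) ∧ M.deficit x p.1 < M.α x 0 ∧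
      ∀ j ∈ A, (p.2.2 j, M.deficit x p.1 + cumLoss p.2.1 p.2.2 j) ∈ B} =
      Ψ ⁻¹' (M.pathSet x B θ) ∩ (univ ×ˢ (univ ×ˢ univ.pi s)) := by
    ext p
    have h1 : (∀ j, p.2.2 j < v ↔ j ∈ A) ↔ p.2.2 ∈ univ.pi s := by
      simp only [mem_univ_pi]
      refine forall_congr' fun j => ?_
      by_cases h : j ∈ A <;> simp [s, h]
    simp only [mem_ofPred_eq, mem_inter_iff, mem_prod, mem_univ, true_and, ← h1, mem_preimage,
      pathSet, Ψ]
    rw [and_comm]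
    refine and_congr_left fun h2 => and_congr_right fun _ => ?_
    have h3 : ∀ k, cumLoss p.2.1 p.2.2 (g k) =
        cumLoss (fun i => p.2.1 (g i)) (fun i => p.2.2 (g i)) k := fun k =>
      cumLoss_comp_of_mem fun i hi => by
        rw [hg, Finset.mem_coe] at hi
        have hk : g k ∈ A := by rw [← Finset.mem_coe, ← hg]; exact mem_range_self k
        exact ((h2 _).2 hk).trans_le (not_lt.1 fun h => hi ((h2 i).1 h))
    simp only [← h3]
    constructor
    · intro h k
      exact h _ (by rw [← Finset.mem_coe, ← hg]; exact mem_range_self k)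
    · intro h j hj
      rw [← Finset.mem_coe, ← hg] at hj
      obtain ⟨k, rfl⟩ := hj
      exact h k
  -- Positions before `v` carry mass `v / L` and are then uniform on `(0, v]`. The law of the others
  -- does not matter, since losses beyond `v` do not enter the event.
  have hrest : ∀ j, ∃ ν' : Measure ℝ, IsProbabilityMeasure ν' ∧
      (unifLaw L).restrict (s j) =
        ENNReal.ofReal (if j ∈ A then v / L else 1 - v / L) • ν' ∧ (j ∈ A → ν' = unifLaw v) := by
    intro j
    by_cases h : j ∈ A
    · refine ⟨unifLaw v, inferInstance, ?_, fun _ => rfl⟩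
      simp only [s, h, if_true]
      exact unifLaw_restrict_Iio hv hvL
    · obtain ⟨ν', h1, h2⟩ := exists_isProbabilityMeasure_restrict (unifLaw L) (Ici v)
      refine ⟨ν', h1, ?_, fun h' => absurd h' h⟩
      simp only [s, h, if_false]
      rw [h2, unifLaw_Ici hL0 hv]
  choose ν hν hνr hνA using hrest
  have hmeas : (M.dataLaw x L).restrict (univ ×ˢ (univ ×ˢ univ.pi s)) =
      (∏ j, ENNReal.ofReal (if j ∈ A then v / L else 1 - v / L)) •
        (M.shockLaw x).prod ((Measure.pi fun _ => M.lossLaw x).prod (Measure.pi ν)) := by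
    rw [dataLaw, ← Measure.prod_restrict, ← Measure.prod_restrict, Measure.restrict_univ,
      Measure.restrict_univ, Measure.restrict_pi_pi, funext hνr,
      Measure.pi_smul_eq _ (fun _ => ENNReal.ofReal_ne_top), Measure.prod_smul_right,
      Measure.prod_smul_right]
  have hνg : (fun i => ν (g i)) = fun _ => unifLaw v := by
    funext i
    refine hνA _ ?_
    rw [← Finset.mem_coe, ← hg]; exact mem_range_self i
  have hΨ : MeasurePreserving Ψ
      ((M.shockLaw x).prod ((Measure.pi fun _ => M.lossLaw x).prod (Measure.pi ν)))
      (M.pathLaw x θ (unifLaw v)) := by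
    have h2 := measurePreserving_pi_comp_injective (μ := ν) g.injective
    rw [hνg] at h2
    exact (MeasurePreserving.id _).prod ((measurePreserving_pi_comp_injective
      (μ := fun _ => M.lossLaw x) g.injective).prod h2)
  have hPm := M.measurableSet_pathSet (x := x) hB θ
  rw [hset, Measure.real, ← Measure.restrict_apply (hΨ.measurable hPm), hmeas,
    Measure.smul_apply, hΨ.measure_preimage hPm.nullMeasurableSet, smul_eq_mul, ENNReal.toReal_mul,
    ENNReal.toReal_prod, Measure.real]
  congr 1
  have h5 : ∀ j, (ENNReal.ofReal (if j ∈ A then v / L else 1 - v / L)).toReal =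
      if j ∈ A then v / L else 1 - v / L := fun j => by
    refine ENNReal.toReal_ofReal ?_
    split_ifs
    exacts [by positivity, by linarith]
  simp only [h5]
  rw [Finset.prod_ite, Finset.prod_const, Finset.prod_const]
  have h6 : (Finset.univ.filter fun j => j ∈ A) = A := by ext; simp
  have h7 : (Finset.univ.filter fun j => j ∉ A) = Aᶜ := by ext; simp
  rw [h6, h7, Finset.card_compl, hA, Fintype.card_fin]

/-- Split according to the set of half-edges with positions before `v`: all `θ`-element sets
contribute equally, whence the binomial coefficient. -/
theorem measureReal_surviveSet_eq {L v : ℝ} [hL : Fact (0 < L)] (hv : 0 < v) (hvL : v ≤ L)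
    {B : Set (ℝ × ℝ)} (hB : MeasurableSet B) (θ : ℕ) :
    (M.dataLaw x L).real (M.surviveSet x B θ v) =
      binomProb (M.inDeg x) (v / L) θ * (M.pathLaw x θ (unifLaw v)).real (M.pathSet x B θ) := by
  classical
  let T (A : Finset (Fin (M.inDeg x))) : Set (M.AgentData x) :=
    {p | (∀ j, p.2.2 j < v ↔ j ∈ A) ∧ M.deficit x p.1 < M.α x 0 ∧
      ∀ j ∈ A, (p.2.2 j, M.deficit x p.1 + cumLoss p.2.1 p.2.2 j) ∈ B}
  have hset : M.surviveSet x B θ v =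
      ⋃ A ∈ Finset.powersetCard θ (Finset.univ : Finset (Fin (M.inDeg x))), T A := by
    ext p
    simp only [surviveSet, mem_ofPred_eq, mem_iUnion, Finset.mem_powersetCard, Finset.subset_univ,
      true_and, exists_prop, T]
    constructor
    · rintro ⟨h1, h2, h3⟩
      exact ⟨_, h1, fun j => by simp, h2, fun j hj => h3 j (by simpa using hj)⟩
    · rintro ⟨A, h1, h2, h3, h4⟩
      refine ⟨?_, h3, fun j hj => h4 j ((h2 j).1 hj)⟩
      rw [← h1]
      congr 1
      ext j; simp [h2]
  have hTm : ∀ A, MeasurableSet (T A) := by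
    intro A
    have h1 : ∀ j, MeasurableSet {p : M.AgentData x | p.2.2 j < v} := fun j =>
      measurableSet_lt (by fun_prop) measurable_const
    have : T A = (⋂ j, {p : M.AgentData x | p.2.2 j < v ↔ j ∈ A}) ∩
        ({p | M.deficit x p.1 < M.α x 0} ∩ ⋂ (j) (_ : j ∈ A),
          {p | (p.2.2 j, M.deficit x p.1 + cumLoss p.2.1 p.2.2 j) ∈ B}) := by
      ext p; simp [T]
    rw [this]
    refine (MeasurableSet.iInter fun j => ?_).inter ((measurableSet_lt
      (M.measurable_deficit.comp measurable_fst) measurable_const).inter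
      (MeasurableSet.iInter fun j => MeasurableSet.iInter fun _ => ?_))
    · by_cases h : j ∈ A
      · simpa only [h, iff_true] using h1 j
      · simp only [h, iff_false]
        exact (h1 j).compl
    · have : Measurable fun p : M.AgentData x =>
          (p.2.2 j, M.deficit x p.1 + cumLoss p.2.1 p.2.2 j) :=
        Measurable.prodMk (by fun_prop) (M.measurable_deficit_add_cumLoss j)
      exact this hB
  rw [hset, measureReal_biUnion_finset _ fun A _ => hTm A]
  · rw [Finset.sum_congr rfl fun A hA =>
      M.dataLaw_real_inter hv hvL hB (Finset.mem_powersetCard.1 hA).2, Finset.sum_const,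
      Finset.card_powersetCard, Finset.card_univ, Fintype.card_fin, nsmul_eq_mul, binomProb]
    ring
  · intro A _ A' _ hAA
    rw [Function.onFun, Set.disjoint_left]
    rintro p ⟨h1, _⟩ ⟨h2, _⟩
    exact hAA (Finset.ext fun j => (h1 j).symm.trans (h2 j))

/-- The limit of the fraction of solvent agents, as a survival probability for uniform positions. -/
theorem measureReal_surviveSet_cumRate {r : ℝ → ℝ} (hr : ContinuousOn r (Ici 0))
    (hpos : ∀ t, 0 ≤ t → 0 < r t) {L t : ℝ} [hL : Fact (0 < L)] (ht : 0 ≤ t)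
    (htL : cumRate r t ≤ L) (θ : ℕ) :
    (M.dataLaw x L).real (M.surviveSet x (barrier r (M.α x)) θ (cumRate r t)) =
      binomProb (M.inDeg x) (cumRate r t / L) θ * M.survival r x θ t := by
  have hB := measurableSet_barrier hr hpos (M.α_cont x)
  have key : ∀ t, 0 < t → cumRate r t ≤ L →
      (M.dataLaw x L).real (M.surviveSet x (barrier r (M.α x)) θ (cumRate r t)) =
      binomProb (M.inDeg x) (cumRate r t / L) θ * M.survival r x θ t := fun t ht htL => by
    rw [M.measureReal_surviveSet_eq (cumRate_pos hr hpos ht) htL hB,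
      M.survival_eq_pathSet hr hpos ht]
  rcases ht.eq_or_lt with rfl | ht
  -- At `t = 0` the arrival law is the zero measure and the formula for positive times is not
  -- available. For `θ = 0` no arrival is involved and both sides are limits as `t` decreases to
  -- `0`; for `θ > 0` both sides vanish, as positions are almost surely positive.
  · rcases Nat.eq_zero_or_pos θ with rfl | hθ
    · have hc : ∀ t, M.survival r x 0 t = M.survival r x 0 0 := fun t => by
        rw [survival, survival]
        congr 4
        funext i
        exact i.elim0
      have h0 := (continuous_cumRate hr).tendsto 0
      have hl : Tendsto (fun t => (M.dataLaw x L).real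
          (M.surviveSet x (barrier r (M.α x)) 0 (cumRate r t))) (𝓝[>] 0)
          (𝓝 ((M.dataLaw x L).real (M.surviveSet x (barrier r (M.α x)) 0 (cumRate r 0)))) := by
        rw [tendsto_iff_dist_tendsto_zero]
        refine squeeze_zero (g := fun t => (M.inDeg x : ℝ) * (|cumRate r t - cumRate r 0| / L))
          (fun _ => dist_nonneg) (fun t => M.abs_measureReal_surviveSet_sub_le 0 _ _) ?_
        have : Tendsto (fun t => (M.inDeg x : ℝ) * (|cumRate r t - cumRate r 0| / L)) (𝓝 0)
            (𝓝 (M.inDeg x * (|cumRate r 0 - cumRate r 0| / L))) :=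
          (((h0.sub_const _).abs).div_const _).const_mul _
        simp only [sub_self, abs_zero, zero_div, mul_zero] at this
        exact this.mono_left nhdsWithin_le_nhds
      have hr' : Tendsto (fun t => binomProb (M.inDeg x) (cumRate r t / L) 0 *
          M.survival r x 0 t) (𝓝[>] 0) (𝓝 (binomProb (M.inDeg x) (cumRate r 0 / L) 0 *
          M.survival r x 0 0)) := by
        simp only [hc, binomProb]
        have : Continuous fun t => ((M.inDeg x).choose 0 : ℝ) * (cumRate r t / L) ^ 0 *
            (1 - cumRate r t / L) ^ (M.inDeg x - 0) * M.survival r x 0 0 := by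
          have := continuous_cumRate hr
          fun_prop
        exact this.continuousAt.tendsto.mono_left nhdsWithin_le_nhds
      refine tendsto_nhds_unique hl (hr'.congr' ?_)
      have h1 : ∀ᶠ t in 𝓝[>] (0 : ℝ), cumRate r t < L :=
        nhdsWithin_le_nhds (h0.eventually (gt_mem_nhds (by simpa using hL.out)))
      filter_upwards [h1, self_mem_nhdsWithin] with t h1 h2
      exact (key t h2 h1.le).symm
    · rw [cumRate_zero, zero_div, binomProb, zero_pow hθ.ne', mul_zero, zero_mul, zero_mul,
        measureReal_eq_zero_iff]
      refine measure_mono_null (t := {p | ∃ j, p.2.2 j ∈ Iio 0}) ?_ ?_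
      · intro p hp
        have h1 := hp.1
        by_contra hcon
        simp only [mem_ofPred_eq, mem_Iio, not_exists] at hcon
        simp only [hcon, Finset.filter_false, Finset.card_empty] at h1
        omega
      · have : {p : M.AgentData x | ∃ j, p.2.2 j ∈ Iio 0} =
            ⋃ j, {p : M.AgentData x | p.2.2 j ∈ Iio 0} := by ext; simp
        rw [this, measure_iUnion_null_iff]
        intro j
        rw [M.dataLaw_preimage_eval j measurableSet_Iio.nullMeasurableSet]
        refine unifLaw_absolutelyContinuous L ?_
        rw [Measure.restrict_apply measurableSet_Iio]
        convert measure_empty (μ := (volume : Measure ℝ))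
        ext u
        simp only [mem_inter_iff, mem_Iio, mem_Ioc, mem_empty_iff_false, iff_false]
        rintro ⟨h1, h2, _⟩
        linarith
  · exact key t ht htL

end RiskModel

/-! ### The reveal fraction, and times slightly beyond exhaustion. -/

section RevealFraction

variable {r : ℝ → ℝ}

/-- By strict monotonicity of `cumRate r`, stopping at the time when it reaches `lam` is the same as
capping its value at `lam`; this includes the case that `lam` is never reached. -/
theorem mul_revealFraction (hr : ContinuousOn r (Ici 0)) (hpos : ∀ t, 0 ≤ t → 0 < r t) {lam : ℝ}
    (hlam : 0 < lam) {t : ℝ} (ht : 0 ≤ t) :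
    revealFraction r lam t = min (cumRate r t) lam / lam := by
  have hex : ∀ s, 0 ≤ s → lam ≤ cumRate r s → exhaustTime r lam ≤ ENNReal.ofReal s := by
    intro s hs h
    rw [cumRate_of_nonneg hs] at h
    exact iInf₂_le s ⟨hs, h⟩
  have hex2 : ∀ s, 0 ≤ s → cumRate r s ≤ lam → ENNReal.ofReal s ≤ exhaustTime r lam := by
    intro s hs h
    refine le_iInf₂ fun u hu => ENNReal.ofReal_le_ofReal ?_
    rw [← cumRate_of_nonneg hu.1] at hu
    exact ((strictMonoOn_cumRate hr hpos).le_iff_le hs hu.1).1 (h.trans hu.2)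
  rw [revealFraction]
  congr 1
  rcases le_total (cumRate r t) lam with h | h
  · rw [min_eq_left h, min_eq_left (hex2 t ht h), ENNReal.toReal_ofReal ht, cumRate_of_nonneg ht]
  · obtain ⟨s, hs, hsl⟩ := exists_cumRate_eq hr hpos hlam.le h
    have h1 : exhaustTime r lam = ENNReal.ofReal s :=
      le_antisymm (hex s hs hsl.ge) (hex2 s hs hsl.le)
    have h2 : s ≤ t := ((strictMonoOn_cumRate hr hpos).le_iff_le hs ht).1 (hsl.trans_le h)
    rw [min_eq_right h, h1, min_eq_right (ENNReal.ofReal_le_ofReal h2), ENNReal.toReal_ofReal hs,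
      ← cumRate_of_nonneg hs, hsl]

end RevealFraction

theorem binomProb_one {d θ : ℕ} (h : θ ≤ d) : binomProb d 1 θ = if θ = d then 1 else 0 := by
  rw [binomProb]
  split_ifs with h1
  · subst h1; simp
  · rw [sub_self, zero_pow (by omega), mul_zero]

theorem binomProb_nonneg {d θ : ℕ} {z : ℝ} (h0 : 0 ≤ z) (h1 : z ≤ 1) : 0 ≤ binomProb d z θ := by
  have : 0 ≤ 1 - z := by linarith
  rw [binomProb]; positivity

theorem sum_binomProb (d : ℕ) (z : ℝ) : ∑ θ ∈ Finset.range (d + 1), binomProb d z θ = 1 := by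
  have := add_pow z (1 - z) d
  rw [add_sub_cancel, one_pow] at this
  rw [this]
  exact Finset.sum_congr rfl fun θ _ => by rw [binomProb]; ring

namespace RiskModel

variable {X : Type*} (M : RiskModel X) {x : X} {r : ℝ → ℝ}

theorem survival_nonneg (θ : ℕ) (t : ℝ) : 0 ≤ M.survival r x θ t := measureReal_nonneg

theorem survival_le_one (hr : ContinuousOn r (Ici 0)) (hpos : ∀ t, 0 ≤ t → 0 < r t) (θ : ℕ)
    {t : ℝ} (ht : 0 ≤ t) : M.survival r x θ t ≤ 1 := by
  rcases ht.eq_or_lt with rfl | ht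
  · have h0 : arrivalLaw r 0 = 0 := by
      rw [arrivalLaw, Ioc_self, cond_empty]
    rw [survival, h0]
    rcases Nat.eq_zero_or_pos θ with rfl | hθ
    · have : (fun _ : Fin 0 => (0 : Measure ℝ)) = fun _ => M.shockLaw x := by
        funext i; exact i.elim0
      rw [this]
      exact measureReal_le_one
    · have : Measure.pi (fun _ : Fin θ => (0 : Measure ℝ)) = 0 := by
        rw [← Measure.measure_univ_eq_zero, Measure.pi_univ]
        simp [hθ.ne']
      rw [this]
      simp
  · have := isProbabilityMeasure_arrivalLaw hr hpos ht
    exact measureReal_le_one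

/-- Before the end time `cumRate r t` may slightly exceed `lam`. Then the reveal fraction is `1` and
only `θ = M.inDeg x` counts, but `survival` still changes with `t`. With uniform positions on `(0,
cumRate r t]`, survival at `t` and at the exhaustion time become survival before two nearby
positions. The Lipschitz bound and the loss of mass in `(lam / v) ^ M.inDeg x` each cost `M.inDeg x
* (η / lam)`. -/
theorem abs_surviveProb_sub_limitSx_le (hr : ContinuousOn r (Ici 0))
    (hpos : ∀ t, 0 ≤ t → 0 < r t) {lam : ℝ} [hl : Fact (0 < lam)] {θ : ℕ} (hθ : θ ≤ M.inDeg x)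
    {η t : ℝ} (hη : 0 ≤ η) (ht : 0 ≤ t) (htη : cumRate r t ≤ lam + η) :
    |(M.dataLaw x lam).real (M.surviveSet x (barrier r (M.α x)) θ (min (cumRate r t) lam)) -
      M.limitSx r lam x θ t| ≤ 2 * (M.inDeg x * (η / lam)) := by
  have hlam := hl.out
  rw [limitSx, mul_revealFraction hr hpos hlam ht]
  rcases le_total (cumRate r t) lam with h | h
  · rw [min_eq_left h, M.measureReal_surviveSet_cumRate hr hpos ht h, sub_self, abs_zero]
    positivity
  · obtain ⟨s, hs, hsl⟩ := exists_cumRate_eq hr hpos hlam.le h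
    have hs1 := M.measureReal_surviveSet_cumRate (x := x) hr hpos (L := lam) hs hsl.le θ
    rw [hsl, div_self hlam.ne'] at hs1
    rw [min_eq_right h, hs1, div_self hlam.ne', binomProb_one hθ]
    split_ifs with hd
    · subst hd
      set v := cumRate r t with hv
      have hv0 : Fact (0 < v) := ⟨hlam.trans_le h⟩
      have hv' := hv0.out
      have e1 := M.measureReal_surviveSet_cumRate (x := x) hr hpos (L := v) ht le_rfl (M.inDeg x)
      have e2 := M.measureReal_surviveSet_cumRate (x := x) hr hpos (L := v) hs (hsl.le.trans h)
        (M.inDeg x)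
      have e3 := M.abs_measureReal_surviveSet_sub_le (x := x) (L := v) (B := barrier r (M.α x))
        (M.inDeg x) v lam
      rw [← hv, div_self hv'.ne', binomProb_one le_rfl, if_pos rfl, one_mul] at e1
      have hb : binomProb (M.inDeg x) (lam / v) (M.inDeg x) = (lam / v) ^ M.inDeg x := by
        simp [binomProb]
      rw [hsl, hb] at e2
      rw [e1, e2] at e3
      have h1 : |v - lam| / v ≤ η / lam := by
        rw [abs_of_nonneg (by linarith)]
        exact div_le_div₀ hη (by linarith) hlam h
      have h2 : 1 - M.inDeg x * (η / lam) ≤ (lam / v) ^ M.inDeg x := by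
        have h3 := one_add_mul_le_pow (a := lam / v - 1) (by
          have := div_pos hlam hv'; linarith) (M.inDeg x)
        have h4 : lam / v - 1 = - (|v - lam| / v) := by
          rw [abs_of_nonneg (by linarith)]; field_simp; ring
        rw [add_sub_cancel] at h3
        refine le_trans ?_ h3
        rw [h4]
        have := mul_le_mul_of_nonneg_left h1 (Nat.cast_nonneg (α := ℝ) (M.inDeg x))
        linarith
      have h3 : (lam / v) ^ M.inDeg x ≤ 1 := pow_le_one₀ (by positivity) ((div_le_one hv').2 h)
      have h4 := M.survival_le_one (x := x) hr hpos (M.inDeg x) hs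
      have h5 := M.survival_nonneg (x := x) (r := r) (M.inDeg x) s
      have h6 := mul_le_mul_of_nonneg_left h1 (Nat.cast_nonneg (α := ℝ) (M.inDeg x))
      rw [one_mul, one_mul]
      rw [abs_le] at e3 ⊢
      constructor <;> nlinarith
    · rw [zero_mul, zero_mul, sub_self, abs_zero]
      positivity

end RiskModel

/-! ### Solvency read off from the data of an agent. -/

namespace RevealData

variable {X : Type*} {M : RiskModel X} {n : ℕ} {ty : Fin n → X} {Ω : Type*}
  (V : RevealData M ty Ω)

theorem exists_positions {ω : Ω} (hbij : Function.Bijective fun k => V.tgt k ω) (i : Fin n) :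
    ∃ f : Fin (M.inDeg (ty i)) ↪ Fin (M.numLinks ty), (∀ j, V.tgt (f j) ω = ⟨i, j⟩) ∧
      ∀ k, (V.tgt k ω).1 = i → ∃ j, f j = k := by
  choose f hf using fun j : Fin (M.inDeg (ty i)) => hbij.2 ⟨i, j⟩
  refine ⟨⟨f, fun j j' h => ?_⟩, hf, fun k hk => ?_⟩
  · have h1 := hf j
    rw [h, hf j'] at h1
    simpa using h1.symm
  · generalize hh : V.tgt k ω = h at hk
    obtain ⟨i', j⟩ := h
    simp only at hk
    subst hk
    exact ⟨j, hbij.1 ((hf j).trans hh.symm)⟩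

theorem mem_dataEvent_iff {ω : Ω} (hinj : Function.Injective fun k => V.tgt k ω)
    {i : Fin n} {f : Fin (M.inDeg (ty i)) → Fin (M.numLinks ty)}
    (hf : ∀ j, V.tgt (f j) ω = ⟨i, j⟩) (E : ∀ x, Set (M.AgentData x)) :
    ω ∈ V.dataEvent E i ↔
      (V.shock i ω, (fun j => V.loss (f j) ω), fun j => ((f j : ℕ) : ℝ) / n) ∈ E (ty i) := by
  constructor
  · rintro ⟨g, hg, h⟩
    have : g = f := funext fun j => hinj ((hg j).trans (hf j).symm)
    rwa [this] at h
  · exact fun h => ⟨f, hf, h⟩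

variable {r : ℝ → ℝ}

/-- The family of sets of data of agents which survive `θ` losses before `v`. -/
noncomputable def _root_.RiskModel.surviveFam (M : RiskModel X) (r : ℝ → ℝ) (θ : ℕ) (v : ℝ)
    (x : X) : Set (M.AgentData x) := M.surviveSet x (barrier r (M.α x)) θ v

/-- The family of sets of fragile data. -/
noncomputable def _root_.RiskModel.fragileFam (M : RiskModel X) (r : ℝ → ℝ) (η : ℝ)
    (x : X) : Set (M.AgentData x) := M.fragileSet x (barrier r (M.α x)) η

/-- By `notMem_ruined_iff`, solvency is tested at the real times of the losses. By `hclose`, each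
such test is a barrier test at the position of the loss up to a shift of `η`, and an agent that is
not fragile does not feel the shift. The number of losses agrees exactly, since a position is below
`numRevealed / n` precisely when its reveal has occurred. -/
theorem solvent_iff_dataEvent (hr : ContinuousOn r (Ici 0)) (hpos : ∀ t, 0 ≤ t → 0 < r t)
    {ω : Ω} (hclock : ∀ k, 0 < V.clock k ω) (hbij : Function.Bijective fun k => V.tgt k ω)
    {t η : ℝ} (ht : 0 ≤ t)
    (hclose : ∀ k ∈ V.revealed ω t, |(k : ℝ) / n - cumRate r (V.cumTime (k + 1) ω).toReal| ≤ η)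
    {i : Fin n} (hfrag : ω ∉ V.dataEvent (M.fragileFam r η) i) (θ : ℕ) :
    (i ∉ V.ruined ω t ∧ (V.lossesOf i ω t).card = θ) ↔
      ω ∈ V.dataEvent (M.surviveFam r θ (V.numRevealed ω t / n)) i := by
  classical
  have hn : (0 : ℝ) < n := by exact_mod_cast i.pos
  obtain ⟨f, hf, hf'⟩ := V.exists_positions hbij i
  rw [mem_dataEvent_iff V hbij.1 hf] at hfrag ⊢
  have hlt : ∀ j, ((f j : ℕ) : ℝ) / n < V.numRevealed ω t / n ↔ (f j : ℕ) < V.numRevealed ω t :=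
    fun j => by rw [div_lt_div_iff_of_pos_right hn, Nat.cast_lt]
  have hloss : V.lossesOf i ω t =
      (Finset.univ.filter fun j => (f j : ℕ) < V.numRevealed ω t).map f := by
    ext k
    simp only [lossesOf, Finset.mem_filter, mem_revealed_iff, Finset.mem_map, Finset.mem_univ,
      true_and]
    constructor
    · rintro ⟨h1, h2⟩
      obtain ⟨j, rfl⟩ := hf' k h2
      exact ⟨j, h1, rfl⟩
    · rintro ⟨j, h1, rfl⟩
      exact ⟨h1, by rw [hf j]⟩
  have hcum : ∀ j, (f j : ℕ) < V.numRevealed ω t →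
      ∑ k ∈ V.lossesOf i ω t with k ≤ f j, V.loss k ω =
      RiskModel.cumLoss (fun j => V.loss (f j) ω) (fun j => ((f j : ℕ) : ℝ) / n) j := by
    intro j hj
    rw [hloss, RiskModel.cumLoss, Finset.sum_filter, Finset.sum_map, Finset.sum_filter]
    refine Finset.sum_congr rfl fun j' _ => ?_
    have h1 : ((f j' : ℕ) : ℝ) / n ≤ ((f j : ℕ) : ℝ) / n ↔ f j' ≤ f j := by
      rw [div_le_div_iff_of_pos_right hn, Nat.cast_le, Fin.le_def]
    rw [if_congr h1 rfl rfl]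
    split_ifs with h2 h3 h3
    · rfl
    · rfl
    · exact absurd (lt_of_le_of_lt (Fin.le_def.1 h3) hj) h2
    · rfl
  rw [V.notMem_ruined_iff hclock ht]
  simp only [RiskModel.surviveFam, RiskModel.surviveSet, RiskModel.fragileFam,
    RiskModel.fragileSet, mem_ofPred_eq, hlt, not_or, not_exists, not_and, not_not] at hfrag ⊢
  have hcard : (V.lossesOf i ω t).card = Finset.card {j | (f j : ℕ) < V.numRevealed ω t} := by
    rw [hloss, Finset.card_map]
  rw [hcard, and_comm, RiskModel.deficit]
  refine and_congr_right fun _ => and_congr_right fun _ => ?_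
  have hbar : ∀ j, (f j : ℕ) < V.numRevealed ω t →
      (M.δ (ty i) - M.γ (ty i) * (1 - V.shock i ω) +
        ∑ k ∈ V.lossesOf i ω t with k ≤ f j, V.loss k ω <
          M.α (ty i) (V.cumTime (f j + 1) ω).toReal ↔
      (((f j : ℕ) : ℝ) / n, M.δ (ty i) - M.γ (ty i) * (1 - V.shock i ω) +
        RiskModel.cumLoss (fun j => V.loss (f j) ω) (fun j => ((f j : ℕ) : ℝ) / n) j) ∈
          barrier r (M.α (ty i))) := by
    intro j hj
    have hc := hclose (f j) (V.mem_revealed_iff.2 hj)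
    have hη : 0 ≤ η := (abs_nonneg _).trans hc
    rw [hcum j hj]
    have h1 := hfrag.1 j
    rw [RiskModel.deficit] at h1
    constructor
    · intro h
      exact barrier_mono _ _ _ _ _ (h1 (mem_barrier_add_of_lt ENNReal.toReal_nonneg hc h))
        (by linarith)
    · intro h
      exact lt_of_mem_barrier_sub hr hpos (M.α_mono _) ENNReal.toReal_nonneg hc
        (h1 (barrier_mono _ _ _ _ _ h (by linarith)))
  rw [hloss] at hbar ⊢
  simp only [Finset.mem_map, Finset.mem_filter, Finset.mem_univ, true_and, forall_exists_index,
    and_imp, forall_apply_eq_imp_iff₂]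
  exact forall_congr' fun j => forall_congr' fun hj => hbar j hj

open Classical in
/-- The number of agents of type `x` whose data lie in `E`. -/
noncomputable def dataCount (E : ∀ x, Set (M.AgentData x)) (x : X) (ω : Ω) : ℕ :=
  Finset.card {i | ty i = x ∧ ω ∈ V.dataEvent E i}

theorem abs_card_sub_card_le {α : Type*} [DecidableEq α] {s t u : Finset α} (h1 : s ⊆ t ∪ u)
    (h2 : t ⊆ s ∪ u) : |(s.card : ℝ) - t.card| ≤ u.card := by
  have h3 : s.card ≤ t.card + u.card := (Finset.card_le_card h1).trans (Finset.card_union_le _ _)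
  have h4 : t.card ≤ s.card + u.card := (Finset.card_le_card h2).trans (Finset.card_union_le _ _)
  have h3 : (s.card : ℝ) ≤ t.card + u.card := by exact_mod_cast h3
  have h4 : (t.card : ℝ) ≤ s.card + u.card := by exact_mod_cast h4
  rw [abs_le]
  constructor <;> linarith

theorem abs_Sx_sub_dataCount_le (hr : ContinuousOn r (Ici 0)) (hpos : ∀ t, 0 ≤ t → 0 < r t)
    {ω : Ω} (hclock : ∀ k, 0 < V.clock k ω) (hbij : Function.Bijective fun k => V.tgt k ω)
    {t η : ℝ} (ht : 0 ≤ t)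
    (hclose : ∀ k ∈ V.revealed ω t, |(k : ℝ) / n - cumRate r (V.cumTime (k + 1) ω).toReal| ≤ η)
    (x : X) (θ : ℕ) :
    |(V.Sx x θ ω t : ℝ) - V.dataCount (M.surviveFam r θ (V.numRevealed ω t / n)) x ω| ≤
      V.dataCount (M.fragileFam r η) x ω := by
  classical
  refine abs_card_sub_card_le (fun i hi => ?_) (fun i hi => ?_)
  · simp only [Finset.mem_filter, Finset.mem_compl, Finset.mem_union, Finset.mem_univ,
      true_and] at hi ⊢
    by_cases h : ω ∈ V.dataEvent (M.fragileFam r η) i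
    · exact Or.inr ⟨hi.2.1, h⟩
    · exact Or.inl ⟨hi.2.1, (V.solvent_iff_dataEvent hr hpos hclock hbij ht hclose h θ).1
        ⟨hi.1, hi.2.2⟩⟩
  · simp only [Finset.mem_filter, Finset.mem_compl, Finset.mem_union, Finset.mem_univ,
      true_and] at hi ⊢
    by_cases h : ω ∈ V.dataEvent (M.fragileFam r η) i
    · exact Or.inr ⟨hi.1, h⟩
    · have := (V.solvent_iff_dataEvent hr hpos hclock hbij ht hclose h θ).2 hi.2
      exact Or.inl ⟨this.1, hi.1, this.2⟩

/-- Only the owner of a half-edge with position in `[v, v')` can change status, and this interval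
holds at most `n * (v' - v) + 1` multiples of `1 / n`. For fixed `θ` monotonicity in the position is
not available, so this bound is what makes a finite grid sufficient. -/
theorem abs_dataCount_surviveFam_sub_le {ω : Ω} (hn : 0 < n)
    (hbij : Function.Bijective fun k => V.tgt k ω) (x : X) (θ : ℕ) {v v' : ℝ} (h0 : 0 ≤ v)
    (h : v ≤ v') :
    |(V.dataCount (M.surviveFam r θ v) x ω : ℝ) - V.dataCount (M.surviveFam r θ v') x ω| ≤
      n * (v' - v) + 1 := by
  classical
  have hn' : (0 : ℝ) < n := by exact_mod_cast hn
  let K : Finset (Fin (M.numLinks ty)) := {k | v ≤ (k : ℝ) / n ∧ (k : ℝ) / n < v'}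
  have key : ∀ i, i ∉ K.image (fun k => (V.tgt k ω).1) →
      (ω ∈ V.dataEvent (M.surviveFam r θ v) i ↔ ω ∈ V.dataEvent (M.surviveFam r θ v') i) := by
    intro i hi
    obtain ⟨f, hf, -⟩ := V.exists_positions hbij i
    rw [mem_dataEvent_iff V hbij.1 hf, mem_dataEvent_iff V hbij.1 hf]
    have : ∀ j, ((f j : ℕ) : ℝ) / n < v ↔ ((f j : ℕ) : ℝ) / n < v' := fun j => by
      refine ⟨fun h' => h'.trans_le h, fun h' => ?_⟩
      by_contra hcon
      exact hi (Finset.mem_image.2 ⟨f j, by simp [K, h', not_lt.1 hcon], by rw [hf j]⟩)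
    simp only [RiskModel.surviveFam, RiskModel.surviveSet, mem_ofPred_eq, this]
  have hK : (K.card : ℝ) ≤ n * (v' - v) + 1 := by
    have h1 : K.map Fin.valEmbedding ⊆ Finset.Ico ⌈v * n⌉₊ ⌈v' * n⌉₊ := by
      intro k hk
      obtain ⟨j, hj, rfl⟩ := Finset.mem_map.1 hk
      have hk := (Finset.mem_filter.1 hj).2
      rw [Finset.mem_Ico]
      refine ⟨Nat.ceil_le.2 ((le_div_iff₀ hn').1 hk.1), Nat.lt_ceil.2 ((div_lt_iff₀ hn').1 hk.2)⟩
    have h2 := Finset.card_le_card h1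
    rw [Finset.card_map, Nat.card_Ico] at h2
    have h3 : ⌈v * n⌉₊ ≤ ⌈v' * n⌉₊ := Nat.ceil_mono (by gcongr)
    have h4 : (K.card : ℝ) ≤ (⌈v' * n⌉₊ : ℝ) - ⌈v * n⌉₊ := by
      rw [← Nat.cast_sub h3]; exact_mod_cast h2
    have h5 := Nat.ceil_lt_add_one (a := v' * n) (mul_nonneg (h0.trans h) hn'.le)
    have h6 := Nat.le_ceil (v * n)
    nlinarith
  refine (abs_card_sub_card_le (u := K.image fun k => (V.tgt k ω).1) (fun i hi => ?_)
    (fun i hi => ?_)).trans (le_trans (by exact_mod_cast Finset.card_image_le) hK)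
  all_goals
    simp only [Finset.mem_filter, Finset.mem_union, Finset.mem_univ, true_and] at hi ⊢
    by_cases h : i ∈ K.image fun k => (V.tgt k ω).1
    · exact Or.inr h
  · exact Or.inl ⟨hi.1, (key i h).1 hi.2⟩
  · exact Or.inl ⟨hi.1, (key i h).2 hi.2⟩

/-- One `η` is for the integrated intensity error, one for the clock sums, one for the unfinished
wait, which counts for at most one reveal and `1 ≤ η * n`. -/
theorem abs_numRevealed_sub_cumRate_le (hr : ContinuousOn r (Ici 0)) {ω : Ω}
    (hclock : ∀ k, 0 < V.clock k ω) (hrate : ∀ k, 0 ≤ V.rate k ω) {η : ℝ} (hη : 0 ≤ η)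
    (hn : 1 ≤ η * n)
    (hsum : ∀ k ≤ M.numLinks ty, |V.clockSum k ω - k| ≤ η * n)
    (herr : V.intensityError r ω ≤ ENNReal.ofReal η) {t : ℝ} (ht : 0 ≤ t)
    (htend : ENNReal.ofReal t ≤ V.endTime ω) :
    |(V.numRevealed ω t : ℝ) / n - cumRate r t| ≤ 3 * η := by
  have hn0 : (0 : ℝ) < n := by
    by_contra hcon
    have : (n : ℝ) = 0 := le_antisymm (not_lt.1 hcon) (Nat.cast_nonneg _)
    rw [this, mul_zero] at hn
    linarith
  have hI := V.intervalIntegrable_intensity ω 0 t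
  have hrI := intervalIntegrable_of_continuousOn_Ici hr le_rfl ht
  have hd : IntervalIntegrable (fun s => V.intensity ω s / n - r s) volume 0 t :=
    (hI.div_const _).sub hrI
  have h1 : |(∫ s in (0 : ℝ)..t, V.intensity ω s) / n - cumRate r t| ≤ η := by
    rw [cumRate_of_nonneg ht, ← intervalIntegral.integral_div, ← intervalIntegral.integral_sub
      (hI.div_const _) hrI]
    refine (intervalIntegral.abs_integral_le_integral_abs ht).trans ?_
    rw [intervalIntegral.integral_of_le ht]
    have h2 : ENNReal.ofReal (∫ s in Ioc 0 t, |V.intensity ω s / n - r s|) ≤ ENNReal.ofReal η := by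
      rw [ofReal_integral_eq_lintegral_ofReal]
      · refine le_trans ?_ herr
        rw [intensityError]
        refine lintegral_mono_set fun s hs => ⟨hs.1.le, le_trans ?_ htend⟩
        exact ENNReal.ofReal_le_ofReal hs.2
      · exact ((intervalIntegrable_iff_integrableOn_Ioc_of_le ht).1 hd).abs
      · exact ae_of_all _ fun s => abs_nonneg _
    exact (ENNReal.ofReal_le_ofReal_iff hη).1 h2
  have h3 := V.clockSum_le_integral_intensity hclock hrate ht
  have h4 := V.integral_intensity_le_clockSum hclock hrate ht
  have hN := V.numRevealed_le ω t
  have h5 := abs_le.1 (hsum _ hN)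
  have h6 : V.clockSum (V.numRevealed ω t + 1) ω ≤ V.numRevealed ω t + 1 + η * n := by
    rcases hN.lt_or_eq with h | h
    · have := (abs_le.1 (hsum _ h)).2
      push_cast at this
      linarith
    -- After the last link the additional index adds no clock.
    · have e : V.clockSum (V.numRevealed ω t + 1) ω = V.clockSum (V.numRevealed ω t) ω := by
        rw [clockSum, clockSum]
        congr 1
        ext j
        have := j.2
        simp only [Finset.mem_filter, Finset.mem_univ, true_and]
        omega
      rw [e]
      linarith
  have h7 : |(V.numRevealed ω t : ℝ) / n - (∫ s in (0 : ℝ)..t, V.intensity ω s) / n| ≤ 2 * η := by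
    rw [← sub_div, abs_div, abs_of_pos hn0, div_le_iff₀ hn0, abs_le]
    constructor <;> linarith
  have := abs_sub_le ((V.numRevealed ω t : ℝ) / n) ((∫ s in (0 : ℝ)..t, V.intensity ω s) / n)
    (cumRate r t)
  linarith

/-- The fourth `η` arises because reveal `k` has position `k / n` while `k + 1` reveals have
occurred at its time. -/
theorem abs_sub_cumRate_cumTime_le {ω : Ω} (hclock : ∀ k, 0 < V.clock k ω) {η : ℝ}
    (hn : 1 ≤ η * n) {t : ℝ} (htend : ENNReal.ofReal t ≤ V.endTime ω)
    (hN : ∀ t, 0 ≤ t → ENNReal.ofReal t ≤ V.endTime ω →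
      |(V.numRevealed ω t : ℝ) / n - cumRate r t| ≤ 3 * η) :
    ∀ k ∈ V.revealed ω t, |(k : ℝ) / n - cumRate r (V.cumTime (k + 1) ω).toReal| ≤ 4 * η := by
  intro k hk
  have hn0 : (0 : ℝ) < n := by
    by_contra hcon
    have : (n : ℝ) = 0 := le_antisymm (not_lt.1 hcon) (Nat.cast_nonneg _)
    rw [this, mul_zero] at hn
    linarith
  have hk' := V.mem_revealed.1 hk
  have hfin := ne_top_of_le_ne_top ENNReal.ofReal_ne_top hk'
  have h1 := hN (V.cumTime (k + 1) ω).toReal ENNReal.toReal_nonneg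
    (by rw [ENNReal.ofReal_toReal hfin]; exact hk'.trans htend)
  rw [V.numRevealed_cumTime hclock k.2 hfin] at h1
  have h2 : |(k : ℝ) / n - ((k + 1 : ℕ) : ℝ) / n| ≤ η := by
    rw [← sub_div, abs_div, abs_of_pos hn0, div_le_iff₀ hn0]
    push_cast
    rw [show (k : ℝ) - (k + 1) = -1 by ring]
    simpa using hn
  have := abs_sub_le ((k : ℝ) / n) (((k + 1 : ℕ) : ℝ) / n)
    (cumRate r (V.cumTime (k + 1) ω).toReal)
  linarith

end RevealData

/-! ### Events of probability tending to one. -/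

/-- The events `E n` have probabilities tending to one. -/
def WithHighProb {Ω : ℕ → Type*} [∀ n, MeasurableSpace (Ω n)] (P : ∀ n, Measure (Ω n))
    (E : ∀ n, Set (Ω n)) : Prop :=
  Tendsto (fun n => P n (E n)ᶜ) atTop (𝓝 0)

namespace WithHighProb

variable {Ω : ℕ → Type*} [∀ n, MeasurableSpace (Ω n)] {P : ∀ n, Measure (Ω n)}
  {E E' : ∀ n, Set (Ω n)}

theorem mono (h : WithHighProb P E) (hE : ∀ᶠ n in atTop, E n ⊆ E' n) : WithHighProb P E' :=
  tendsto_of_tendsto_of_tendsto_of_le_of_le' tendsto_const_nhds h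
    (Eventually.of_forall fun _ => zero_le)
    (hE.mono fun _ hn => measure_mono (compl_subset_compl.2 hn))

theorem inter (h : WithHighProb P E) (h' : WithHighProb P E') :
    WithHighProb P fun n => E n ∩ E' n := by
  have h2 := Tendsto.add h h'
  rw [add_zero] at h2
  refine tendsto_of_tendsto_of_tendsto_of_le_of_le tendsto_const_nhds h2
    (fun _ => zero_le) fun n => ?_
  simp only [compl_inter]
  exact measure_union_le _ _

theorem of_ae (h : ∀ n, ∀ᵐ ω ∂(P n), ω ∈ E n) : WithHighProb P E := by
  have : ∀ n, P n (E n)ᶜ = 0 := fun n => ae_iff.1 (h n)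
  simp only [WithHighProb, this]
  exact tendsto_const_nhds

theorem finset_inter {ι : Type*} (s : Finset ι) {E : ι → ∀ n, Set (Ω n)}
    (h : ∀ i ∈ s, WithHighProb P (E i)) : WithHighProb P fun n => {ω | ∀ i ∈ s, ω ∈ E i n} := by
  classical
  induction s using Finset.induction_on with
  | empty => exact of_ae fun n => ae_of_all _ fun ω => by simp
  | insert a s ha ih =>
    refine ((h a (Finset.mem_insert_self a s)).inter
      (ih fun i hi => h i (Finset.mem_insert_of_mem hi))).mono
      (Eventually.of_forall fun n ω hω i hi => ?_)
    rcases Finset.mem_insert.1 hi with rfl | hi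
    exacts [hω.1, hω.2 i hi]

/-- The exceptional event may depend on the tolerated probability `δ`. This is needed because
fragile agents become rare only when the scale is chosen after `δ`. -/
theorem of_forall_exists (h : ∀ δ : ℝ, 0 < δ → ∃ F : ∀ n, Set (Ω n),
    (∀ᶠ n in atTop, P n (F n)ᶜ ≤ ENNReal.ofReal δ) ∧ WithHighProb P fun n => E n ∪ (F n)ᶜ) :
    WithHighProb P E := by
  refine ENNReal.tendsto_nhds_zero.2 fun δ hδ => ?_
  obtain ⟨δ', hδ', hle⟩ : ∃ δ' : ℝ, 0 < δ' ∧ ENNReal.ofReal δ' + ENNReal.ofReal δ' ≤ δ := by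
    rcases eq_or_ne δ ∞ with rfl | hfin
    · exact ⟨1, one_pos, le_top⟩
    · refine ⟨δ.toReal / 2, half_pos (ENNReal.toReal_pos hδ.ne' hfin), ?_⟩
      rw [← ENNReal.ofReal_add (by positivity) (by positivity), add_halves,
        ENNReal.ofReal_toReal hfin]
  obtain ⟨F, hF, hE⟩ := h δ' hδ'
  filter_upwards [hF, ENNReal.tendsto_nhds_zero.1 hE _ (ENNReal.ofReal_pos.2 hδ')] with n h1 h2
  refine le_trans (measure_mono ?_) ((measure_union_le _ _).trans ((add_le_add h1 h2).trans hle))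
  intro ω hω
  by_cases h3 : ω ∈ F n
  · exact Or.inr fun h4 => h4.elim hω fun h5 => h5 h3
  · exact Or.inl h3

theorem of_measure_le {u : ℕ → ℝ} (hu : Tendsto u atTop (𝓝 0))
    (h : ∀ᶠ n in atTop, P n (E n)ᶜ ≤ ENNReal.ofReal (u n)) : WithHighProb P E := by
  have h1 := (ENNReal.continuous_ofReal.tendsto 0).comp hu
  rw [ENNReal.ofReal_zero] at h1
  exact tendsto_of_tendsto_of_tendsto_of_le_of_le' tendsto_const_nhds h1
    (Eventually.of_forall fun _ => zero_le) h

end WithHighProb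

theorem tendstoZeroInProb_iff {Ω : ℕ → Type*} [∀ n, MeasurableSpace (Ω n)]
    {P : ∀ n, Measure (Ω n)} {X : ∀ n, Ω n → ℝ≥0∞} :
    TendstoZeroInProb P X ↔
      ∀ ε : ℝ, 0 < ε → WithHighProb P fun n => {ω | X n ω < ENNReal.ofReal ε} := by
  refine forall₂_congr fun ε _ => ?_
  rw [WithHighProb]
  simp only [compl_ofPred, not_lt]

/-! ### The clocks -/

/-- The moments are the values of Euler's integral for `Γ(k + 1)`; the cases `k = 1, 2` give the
mean and a variance bound for the clocks. -/
theorem integrable_pow_expMeasure (k : ℕ) : Integrable (fun x : ℝ => x ^ k) (expMeasure 1) ∧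
    ∫ x, x ^ k ∂(expMeasure 1) = k.factorial := by
  have hpos : (0 : ℝ) < (k : ℝ) + 1 := by positivity
  have hm : Measurable (gammaPDF 1 1) := (measurable_gammaPDFReal 1 1).ennreal_ofReal
  have htop : ∀ᵐ x : ℝ, gammaPDF 1 1 x < ∞ := ae_of_all _ fun x => ENNReal.ofReal_lt_top
  have heq : (fun x : ℝ => (gammaPDF 1 1 x).toReal • x ^ k) =ᵐ[volume]
      (Ioi 0).indicator fun x => Real.exp (-x) * x ^ ((k : ℝ) + 1 - 1) := by
    have h0 : ∀ᵐ x : ℝ, x ≠ 0 := by simp [ae_iff]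
    filter_upwards [h0] with x hx
    rcases lt_or_gt_of_ne hx with h | h
    · rw [indicator_of_notMem (by simp [h.le]), gammaPDF, gammaPDFReal, if_neg h.not_ge]
      simp
    · rw [indicator_of_mem (by simpa using h), gammaPDF, gammaPDFReal, if_pos h.le,
        add_sub_cancel_right, Real.rpow_natCast]
      simp [(Real.exp_pos _).le]
  have hc := Real.GammaIntegral_convergent hpos
  constructor
  · rw [expMeasure, gammaMeasure, integrable_withDensity_iff_integrable_smul₀' hm.aemeasurable htop]
    exact ((integrable_indicator_iff measurableSet_Ioi).2 hc).congr heq.symm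
  · rw [expMeasure, gammaMeasure, integral_withDensity_eq_integral_toReal_smul hm htop,
      integral_congr_ae heq, integral_indicator measurableSet_Ioi, ← Real.Gamma_eq_integral hpos,
      Real.Gamma_nat_eq_factorial]

namespace IsLossReveal

variable {X : Type*} {M : RiskModel X}

section Fixed

variable {n : ℕ} {ty : Fin n → X} {Ω : Type*}
  [mΩ : MeasurableSpace Ω] {V : RevealData M ty Ω} {P : Measure Ω} {𝓖 : Filtration ℕ mΩ}

theorem memLp_clock (hV : IsLossReveal V P 𝓖) (k : Fin (M.numLinks ty)) :
    MemLp (V.clock k) 2 P := by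
  have hm := hV.measurable_clock k
  refine (memLp_two_iff_integrable_sq hm.aestronglyMeasurable).2 ?_
  have h := (integrable_pow_expMeasure 2).1
  rw [← hV.map_clock k] at h
  exact (integrable_map_measure (by fun_prop) hm.aemeasurable).1 h

theorem integral_clock (hV : IsLossReveal V P 𝓖) (k : Fin (M.numLinks ty)) :
    ∫ ω, V.clock k ω ∂P = 1 := by
  have h := (integrable_pow_expMeasure 1).2
  rw [← hV.map_clock k, integral_map (hV.measurable_clock k).aemeasurable (by fun_prop)] at h
  simpa using h

theorem variance_clock_le (hV : IsLossReveal V P 𝓖) (k : Fin (M.numLinks ty)) :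
    variance (V.clock k) P ≤ 2 := by
  have := hV.isProb
  refine (variance_le_expectation_sq (hV.measurable_clock k).aestronglyMeasurable).trans ?_
  have h := (integrable_pow_expMeasure 2).2
  rw [← hV.map_clock k, integral_map (hV.measurable_clock k).aemeasurable (by fun_prop)] at h
  simpa using h.le

/-- Chebyshev's inequality, for which pairwise independence of the clocks is enough. -/
theorem measure_le_abs_clockSum_sub (hV : IsLossReveal V P 𝓖) {k : ℕ} (hk : k ≤ M.numLinks ty)
    {c : ℝ} (hc : 0 < c) :
    P {ω | c ≤ |V.clockSum k ω - k|} ≤ ENNReal.ofReal (2 * M.numLinks ty / c ^ 2) := by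
  have := hV.isProb
  let s : Finset (Fin (M.numLinks ty)) := {j | j.val < k}
  have hs : s.card = k := by
    have : s.map Fin.valEmbedding = Finset.range k := by
      ext j
      simp only [s, Finset.mem_map, Finset.mem_filter, Finset.mem_univ, true_and,
        Fin.valEmbedding_apply, Finset.mem_range]
      exact ⟨by rintro ⟨j, h, rfl⟩; exact h, fun h => ⟨⟨j, h.trans_le hk⟩, h, rfl⟩⟩
    rw [← Finset.card_map, this, Finset.card_range]
  have hL : MemLp (∑ j ∈ s, V.clock j) 2 P := memLp_finsetSum' _ fun j _ => hV.memLp_clock j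
  have hv : variance (∑ j ∈ s, V.clock j) P ≤ 2 * M.numLinks ty := by
    rw [IndepFun.variance_sum (fun j _ => hV.memLp_clock j)
      fun i _ j _ hij => hV.indepFun_clock hij]
    refine (Finset.sum_le_card_nsmul _ _ 2 fun j _ => hV.variance_clock_le j).trans ?_
    rw [hs, nsmul_eq_mul, mul_comm]
    gcongr
  have hi : ∫ ω, (∑ j ∈ s, V.clock j) ω ∂P = k := by
    simp only [Finset.sum_apply]
    rw [integral_finsetSum _ fun j _ => (hV.memLp_clock j).integrable (by norm_num)]
    simp [hV.integral_clock, hs]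
  have h := meas_ge_le_variance_div_sq hL hc
  rw [hi] at h
  simp only [Finset.sum_apply] at h
  refine h.trans (ENNReal.ofReal_le_ofReal (by gcongr))

end Fixed

variable {ty : ∀ n, Fin n → X} {lam : ℝ} {Ω : ℕ → Type*} [mΩ : ∀ n, MeasurableSpace (Ω n)]
  {P : ∀ n, Measure (Ω n)} {𝓖 : ∀ n, Filtration ℕ (mΩ n)} {V : ∀ n, RevealData M (ty n) (Ω n)}

theorem withHighProb_abs_clockSum_sub_le (hV : ∀ n, IsLossReveal (V n) (P n) (𝓖 n))
    (hlam_lim : Tendsto (fun n => (M.numLinks (ty n) : ℝ) / n) atTop (𝓝 lam)) {k : ℕ → ℕ}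
    (hk : ∀ n, k n ≤ M.numLinks (ty n)) {η : ℝ} (hη : 0 < η) :
    WithHighProb P fun n => {ω | |(V n).clockSum (k n) ω - k n| ≤ η * n} := by
  have h1 : Tendsto (fun n : ℕ => 2 / η ^ 2 * ((M.numLinks (ty n) : ℝ) / n) * (n : ℝ)⁻¹) atTop
      (𝓝 0) := by
    have := (hlam_lim.const_mul (2 / η ^ 2)).mul (tendsto_inv_atTop_nhds_zero_nat (𝕜 := ℝ))
    rwa [mul_zero] at this
  refine WithHighProb.of_measure_le h1 ?_
  filter_upwards [eventually_gt_atTop 0] with n hn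
  have hn' : (0 : ℝ) < n := by exact_mod_cast hn
  refine le_trans (measure_mono fun ω hω => ?_)
    (((hV n).measure_le_abs_clockSum_sub (hk n) (mul_pos hη hn')).trans_eq ?_)
  · simp only [mem_compl_iff, mem_ofPred_eq, not_le] at hω ⊢
    exact hω.le
  · congr 1
    field_simp

/-- Clock sums are monotone in `k`, so it suffices to control boundedly many values of `k`, about
`η' * n` apart. -/
theorem withHighProb_forall_abs_clockSum_sub_le (hV : ∀ n, IsLossReveal (V n) (P n) (𝓖 n))
    (hlam_lim : Tendsto (fun n => (M.numLinks (ty n) : ℝ) / n) atTop (𝓝 lam)) {η : ℝ}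
    (hη : 0 < η) :
    WithHighProb P fun n =>
      {ω | ∀ k ≤ M.numLinks (ty n), |(V n).clockSum k ω - k| ≤ η * n} := by
  -- One `η'` is for the fluctuation at grid points and two bound the spacing `s n ≤ 2 * (η' * n)`.
  obtain ⟨η', hη', rfl⟩ : ∃ η' > 0, η = 3 * η' := ⟨η / 3, by positivity, by ring⟩
  obtain ⟨J, hJ⟩ := exists_nat_ge ((lam + 1) / η')
  let s (n : ℕ) : ℕ := ⌊η' * n⌋₊ + 1
  let g (i n : ℕ) : ℕ := min (i * s n) (M.numLinks (ty n))
  have h := WithHighProb.finset_inter (Finset.range (J + 2)) fun i _ =>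
    withHighProb_abs_clockSum_sub_le hV hlam_lim (k := g i) (fun n => min_le_right _ _) hη'
  refine h.mono ?_
  filter_upwards [hlam_lim.eventually (eventually_le_nhds (lt_add_one lam)), eventually_gt_atTop 0,
    eventually_ge_atTop ⌈1 / η'⌉₊] with n hn hn0 hnη ω hω k hk
  have hn' : (0 : ℝ) < n := by exact_mod_cast hn0
  have hs1 : η' * n < s n := by simpa [s] using Nat.lt_floor_add_one (η' * n)
  have hs2 : (s n : ℝ) ≤ 2 * (η' * n) := by
    have h1 := Nat.floor_le (mul_pos hη' hn').le
    have h2 : 1 / η' ≤ n := (Nat.le_ceil _).trans (by exact_mod_cast hnη)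
    rw [div_le_iff₀ hη'] at h2
    simp only [s]
    push_cast
    linarith
  have hspos : 0 < s n := Nat.succ_pos _
  have hi : k / s n < J + 1 := by
    rw [Nat.lt_succ_iff, ← Nat.cast_le (α := ℝ)]
    refine (Nat.cast_div_le.trans ?_).trans hJ
    rw [div_le_div_iff₀ (by exact_mod_cast hspos) hη']
    have h1 : (k : ℝ) ≤ (lam + 1) * n := by
      rw [div_le_iff₀ hn'] at hn
      exact le_trans (by exact_mod_cast hk) hn
    have h2 : 0 ≤ lam + 1 := by
      have := (div_nonneg (Nat.cast_nonneg (M.numLinks (ty n))) hn'.le : (0 : ℝ) ≤ _)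
      linarith
    nlinarith
  have hdm := Nat.div_add_mod k (s n)
  have hml := Nat.mod_lt k hspos
  have hlow : g (k / s n) n ≤ k := by
    refine (min_le_left _ _).trans ?_
    rw [mul_comm]
    omega
  have hup : k ≤ g (k / s n + 1) n := by
    refine le_min ?_ hk
    rw [add_mul, one_mul, mul_comm]
    omega
  have hgap : g (k / s n + 1) n ≤ g (k / s n) n + s n := by
    simp only [g]
    rw [add_mul, one_mul]
    omega
  have hgap' : (g (k / s n + 1) n : ℝ) ≤ g (k / s n) n + s n := by exact_mod_cast hgap
  have hlow' : (g (k / s n) n : ℝ) ≤ k := by exact_mod_cast hlow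
  have hup' : (k : ℝ) ≤ g (k / s n + 1) n := by exact_mod_cast hup
  have e1 := abs_le.1 (hω (k / s n) (by simp; omega))
  have e2 := abs_le.1 (hω (k / s n + 1) (by simp; omega))
  have m1 := (V n).clockSum_mono (fun j => (hV n).clock_pos j ω) hlow
  have m2 := (V n).clockSum_mono (fun j => (hV n).clock_pos j ω) hup
  simp only at m1 m2
  rw [abs_le]
  constructor <;> linarith

end IsLossReveal

/-! ### The second moment method, and comparison of positions with a grid. -/

/-- A law of large numbers for counts of nearly independent events. -/
theorem measure_le_abs_count_sub {Ω : Type*} [MeasurableSpace Ω] {P : Measure Ω}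
    [IsProbabilityMeasure P] {ι : Type*} [DecidableEq ι] (I : Finset ι) {A : ι → Set Ω}
    (hA : ∀ i ∈ I, MeasurableSet (A i)) {p e : ℝ} (hp0 : 0 ≤ p) (hp1 : p ≤ 1)
    (he : 0 ≤ e) (h1 : ∀ i ∈ I, p - e ≤ P.real (A i))
    (h2 : ∀ i ∈ I, ∀ j ∈ I, i ≠ j → P.real (A i ∩ A j) ≤ p ^ 2 + e)
    [∀ ω, DecidablePred fun i => ω ∈ A i] {c : ℝ} (hc : 0 < c) :
    P {ω | c ≤ |((I.filter fun i => ω ∈ A i).card : ℝ) - I.card * p|} ≤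
      ENNReal.ofReal ((I.card + 3 * e * (I.card : ℝ) ^ 2) / c ^ 2) := by
  let Z (i : ι) (ω : Ω) : ℝ := (A i).indicator (fun _ => 1) ω - p
  have hZ : ∀ ω, ((I.filter fun i => ω ∈ A i).card : ℝ) - I.card * p = ∑ i ∈ I, Z i ω := by
    intro ω
    rw [Finset.sum_sub_distrib, Finset.sum_const, nsmul_eq_mul, Finset.card_filter]
    push_cast
    congr 1
    exact Finset.sum_congr rfl fun i _ => by by_cases h : ω ∈ A i <;> simp [h]
  have hZ1 : ∀ i ω, |Z i ω| ≤ 1 := by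
    intro i ω
    by_cases h : ω ∈ A i <;> simp only [Z, h, indicator_of_mem, indicator_of_notMem,
      not_false_eq_true] <;> rw [abs_le] <;> constructor <;> linarith
  have hZm : ∀ i ∈ I, Measurable (Z i) := fun i hi =>
    (measurable_const.indicator (hA i hi)).sub_const p
  have hint : ∀ i ∈ I, ∀ j ∈ I, Integrable (fun ω => Z i ω * Z j ω) P := fun i hi j hj =>
    Integrable.of_bound ((hZm i hi).mul (hZm j hj)).aestronglyMeasurable 1 (ae_of_all _ fun ω => by
      rw [Real.norm_eq_abs, abs_mul]
      exact mul_le_one₀ (hZ1 i ω) (abs_nonneg _) (hZ1 j ω))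
  -- For `i ≠ j` the expectation is `P(A i ∩ A j) - p P(A i) - p P(A j) + p²`, at most `e + 2 p e`.
  -- Hence a lower bound for single events and an upper bound for pairs suffice.
  have hcov : ∀ i ∈ I, ∀ j ∈ I, ∫ ω, Z i ω * Z j ω ∂P ≤ (if i = j then 1 else 0) + 3 * e := by
    intro i hi j hj
    split_ifs with hij
    · have : ∫ ω, Z i ω * Z j ω ∂P ≤ ∫ _, 1 ∂P := by
        refine integral_mono (hint i hi j hj) (integrable_const _) fun ω => ?_
        have := mul_le_one₀ (hZ1 i ω) (abs_nonneg _) (hZ1 j ω)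
        rw [← abs_mul] at this
        exact (le_abs_self _).trans this
      simp only [integral_const, probReal_univ, smul_eq_mul, one_mul] at this
      linarith
    · have hi1 : Integrable (fun ω => (A i).indicator (fun _ => (1 : ℝ)) ω) P :=
        (integrable_const _).indicator (hA i hi)
      have hj1 : Integrable (fun ω => (A j).indicator (fun _ => (1 : ℝ)) ω) P :=
        (integrable_const _).indicator (hA j hj)
      have hij1 : Integrable (fun ω => (A i ∩ A j).indicator (fun _ => (1 : ℝ)) ω) P :=
        (integrable_const _).indicator ((hA i hi).inter (hA j hj))
      have heq : (fun ω => Z i ω * Z j ω) = fun ω => (A i ∩ A j).indicator (fun _ => (1 : ℝ)) ω -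
          p * (A i).indicator (fun _ => (1 : ℝ)) ω - p * (A j).indicator (fun _ => (1 : ℝ)) ω +
          p ^ 2 := by
        funext ω
        by_cases hi : ω ∈ A i <;> by_cases hj : ω ∈ A j <;> simp [Z, hi, hj] <;> ring
      have e1 : ∀ B, MeasurableSet B → ∫ ω, B.indicator (fun _ => (1 : ℝ)) ω ∂P = P.real B :=
        fun B hB => by rw [integral_indicator hB]; simp
      have hd1 : Integrable (fun ω => (A i ∩ A j).indicator (fun _ => (1 : ℝ)) ω -
          p * (A i).indicator (fun _ => (1 : ℝ)) ω) P := hij1.sub (hi1.const_mul p)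
      have hd2 : Integrable (fun ω => (A i ∩ A j).indicator (fun _ => (1 : ℝ)) ω -
          p * (A i).indicator (fun _ => (1 : ℝ)) ω - p * (A j).indicator (fun _ => (1 : ℝ)) ω) P :=
        hd1.sub (hj1.const_mul p)
      rw [heq, integral_add hd2 (integrable_const _), integral_sub hd1 (hj1.const_mul p),
        integral_sub hij1 (hi1.const_mul p), integral_const_mul, integral_const_mul,
        e1 _ (hA i hi), e1 _ (hA j hj), e1 _ ((hA i hi).inter (hA j hj))]
      simp only [integral_const, probReal_univ, smul_eq_mul, one_mul, zero_add]
      have a1 := mul_le_mul_of_nonneg_left (h1 i hi) hp0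
      have a2 := mul_le_mul_of_nonneg_left (h1 j hj) hp0
      have a3 := h2 i hi j hj hij
      have a4 := mul_le_mul_of_nonneg_right hp1 he
      nlinarith
  have hsq : ∫ ω, (∑ i ∈ I, Z i ω) ^ 2 ∂P ≤ I.card + 3 * e * (I.card : ℝ) ^ 2 := by
    simp_rw [sq, Finset.sum_mul_sum]
    rw [integral_finsetSum _ fun i hi => integrable_finsetSum _ fun j hj => hint i hi j hj]
    calc _ ≤ ∑ i ∈ I, ∑ j ∈ I, ((if i = j then 1 else 0) + 3 * e) := by
          refine Finset.sum_le_sum fun i hi => ?_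
          rw [integral_finsetSum _ fun j hj => hint i hi j hj]
          exact Finset.sum_le_sum fun j hj => hcov i hi j hj
      _ = _ := by
          simp only [Finset.sum_add_distrib, Finset.sum_ite_eq, Finset.sum_const, nsmul_eq_mul]
          rw [Finset.sum_congr rfl fun i hi => if_pos hi]
          simp only [Finset.sum_const, nsmul_eq_mul, mul_one]
          ring
  have hsqi : Integrable (fun ω => (∑ i ∈ I, Z i ω) ^ 2) P := by
    simp_rw [sq, Finset.sum_mul_sum]
    exact integrable_finsetSum _ fun i hi => integrable_finsetSum _ fun j hj => hint i hi j hj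
  have hM := mul_meas_ge_le_integral_of_nonneg (ae_of_all _ fun ω => sq_nonneg (∑ i ∈ I, Z i ω))
    hsqi (c ^ 2)
  have hset : {ω | c ≤ |((I.filter fun i => ω ∈ A i).card : ℝ) - I.card * p|} =
      {ω | c ^ 2 ≤ (∑ i ∈ I, Z i ω) ^ 2} := by
    ext ω
    simp only [mem_ofPred_eq]
    rw [hZ, ← sq_abs (∑ i ∈ I, Z i ω), sq_le_sq₀ hc.le (abs_nonneg _)]
  rw [hset, ← ofReal_measureReal]
  refine ENNReal.ofReal_le_ofReal ((le_div_iff₀ (by positivity)).2 ?_)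
  rw [mul_comm]
  exact hM.trans hsq

theorem tendsto_factorial_sub_div_mul_pow (s : ℕ) :
    Tendsto (fun m : ℕ => ((m - s).factorial : ℝ) / m.factorial * (m : ℝ) ^ s) atTop (𝓝 1) := by
  have h := isEquivalent_descFactorial s
  have h2 : Tendsto (fun m : ℕ => (m.descFactorial s : ℝ) / (m : ℝ) ^ s) atTop (𝓝 1) :=
    (Asymptotics.isEquivalent_iff_tendsto_one ((eventually_gt_atTop 0).mono fun m hm => by
      positivity)).1 h
  have h3 := h2.inv₀ one_ne_zero
  rw [inv_one] at h3
  refine h3.congr' ?_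
  filter_upwards [eventually_ge_atTop s] with m hm
  have h4 : ((m - s).factorial : ℝ) * m.descFactorial s = m.factorial := by
    exact_mod_cast Nat.factorial_mul_descFactorial hm
  have h5 : ((m - s).factorial : ℝ) ≠ 0 := by positivity
  have h6 : (m.factorial : ℝ) ≠ 0 := by positivity
  rw [← h4] at h6 ⊢
  have h7 := right_ne_zero_of_mul h6
  field_simp

namespace RiskModel

variable {X : Type*} {M : RiskModel X} {ty : ∀ n, Fin n → X} {lam : ℝ}

theorem tendsto_numLinks (hlam : 0 < lam)
    (hlam_lim : Tendsto (fun n => (M.numLinks (ty n) : ℝ) / n) atTop (𝓝 lam)) :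
    Tendsto (fun n => M.numLinks (ty n)) atTop atTop := by
  rw [← tendsto_natCast_atTop_iff (R := ℝ)]
  have h := hlam_lim.pos_mul_atTop hlam (tendsto_natCast_atTop_atTop (R := ℝ))
  refine h.congr' ?_
  filter_upwards [eventually_gt_atTop 0] with n hn
  have : (n : ℝ) ≠ 0 := by positivity
  field_simp

/-- The grid of step `1 / n` with `numLinks` points is close to that of `(0, lam]`. -/
theorem eventually_grid_close (hlam : 0 < lam)
    (hlam_lim : Tendsto (fun n => (M.numLinks (ty n) : ℝ) / n) atTop (𝓝 lam)) {η : ℝ}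
    (hη : 0 < η) :
    ∀ᶠ n in atTop, M.numLinks (ty n) ≠ 0 ∧ ∀ k : ℕ, k < M.numLinks (ty n) → ∀ w : ℝ,
      k * lam / M.numLinks (ty n) < w → w ≤ (k + 1) * lam / M.numLinks (ty n) →
        |(k : ℝ) / n - w| ≤ η := by
  have hm := tendsto_numLinks hlam hlam_lim
  have h1 : Tendsto (fun n => lam / (M.numLinks (ty n) : ℝ)) atTop (𝓝 0) :=
    tendsto_const_nhds.div_atTop (tendsto_natCast_atTop_atTop.comp hm)
  filter_upwards [hm.eventually_gt_atTop 0, h1.eventually (eventually_le_nhds (half_pos hη)),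
    Metric.tendsto_nhds.1 hlam_lim _ (half_pos hη), eventually_gt_atTop 0] with n h2 h3 h4 hn
  refine ⟨h2.ne', fun k hk w hw1 hw2 => ?_⟩
  have h2' : (0 : ℝ) < M.numLinks (ty n) := by exact_mod_cast h2
  have hn' : (0 : ℝ) < n := by exact_mod_cast hn
  rw [Real.dist_eq] at h4
  have hk' : (k : ℝ) / M.numLinks (ty n) ≤ 1 := by
    rw [div_le_one h2']; exact_mod_cast hk.le
  have e1 : |(k : ℝ) / n - k * lam / M.numLinks (ty n)| ≤ η / 2 := by
    have : (k : ℝ) / n - k * lam / M.numLinks (ty n) =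
      k / M.numLinks (ty n) * (M.numLinks (ty n) / n - lam) := by field_simp
    rw [this, abs_mul, abs_of_nonneg (by positivity)]
    exact (mul_le_of_le_one_left (abs_nonneg _) hk').trans h4.le
  have e2 : (k + 1) * lam / (M.numLinks (ty n) : ℝ) =
    k * lam / M.numLinks (ty n) + lam / M.numLinks (ty n) := by ring
  rw [e2] at hw2
  rw [abs_le] at e1 ⊢
  constructor <;> linarith

variable (M) in
/-- A bound for the effect of perturbing positions by `η` on survival before `v`. -/
noncomputable def perturbProb (r : ℝ → ℝ) (lam : ℝ) (x : X) (v η : ℝ) : ℝ≥0∞ :=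
  M.dataLaw x lam (M.fragileFam r η x) + M.dataLaw x lam {p | ∃ j, p.2.2 j ∈ Icc (v - η) (v + η)}

theorem exists_fragile_le {r : ℝ → ℝ} (hr : ContinuousOn r (Ici 0))
    (hpos : ∀ t, 0 ≤ t → 0 < r t) [hl : Fact (0 < lam)] (x : X) {e : ℝ} (he : 0 < e) :
    ∃ η₀ > 0, ∀ η ≤ η₀, M.dataLaw x lam (M.fragileFam r η x) ≤ ENNReal.ofReal e := by
  have h := M.tendsto_measure_fragileSet (x := x) (L := lam) (barrier_mono r (M.α x))
    (measurableSet_barrier hr hpos (M.α_cont x)) (ae_subsingleton_critical hr hpos (M.α_cont x) lam)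
  obtain ⟨k, hk⟩ := (ENNReal.tendsto_nhds_zero.1 h _ (ENNReal.ofReal_pos.2 he)).exists
  exact ⟨1 / ((k : ℝ) + 1), by positivity, fun η hη =>
    (measure_mono (M.fragileSet_mono (barrier_mono r (M.α x)) hη)).trans hk⟩

theorem exists_perturbProb_le {r : ℝ → ℝ} (hr : ContinuousOn r (Ici 0))
    (hpos : ∀ t, 0 ≤ t → 0 < r t) [hl : Fact (0 < lam)] (x : X) (v : ℝ) {e : ℝ} (he : 0 < e) :
    ∃ η > 0, M.perturbProb r lam x v η ≤ ENNReal.ofReal e := by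
  obtain ⟨η₀, hη₀, h⟩ := M.exists_fragile_le (lam := lam) hr hpos x (half_pos he)
  have hlam := hl.out
  obtain ⟨η₁, hη₁, h1⟩ : ∃ η₁ > 0, M.inDeg x * (2 * η₁ / lam) ≤ e / 2 := by
    -- The summand `1` avoids division by zero for in-degree zero.
    refine ⟨e / 2 * lam / (2 * (M.inDeg x + 1)), by positivity, ?_⟩
    have : (M.inDeg x : ℝ) / (M.inDeg x + 1) ≤ 1 := by
      rw [div_le_one (by positivity)]; linarith
    calc _ = (M.inDeg x : ℝ) / (M.inDeg x + 1) * (e / 2) := by field_simp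
      _ ≤ _ := mul_le_of_le_one_left (by positivity) this
  refine ⟨min η₀ η₁, lt_min hη₀ hη₁, ?_⟩
  have h2 := M.measureReal_dataLaw_exists_mem_Icc_le (x := x) (L := lam)
    (a := v - min η₀ η₁) (b := v + min η₀ η₁) (by linarith [lt_min hη₀ hη₁])
  have h3 : M.inDeg x * ((v + min η₀ η₁ - (v - min η₀ η₁)) / lam) ≤ e / 2 := by
    refine le_trans ?_ h1
    gcongr
    linarith [min_le_right η₀ η₁]
  rw [perturbProb, ← add_halves e, ENNReal.ofReal_add (by positivity) (by positivity)]
  refine add_le_add (h _ (min_le_left _ _)) ?_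
  rw [← ofReal_measureReal]
  exact ENNReal.ofReal_le_ofReal (h2.trans h3)

end RiskModel

/-! ### Concentration of the counts of surviving and of fragile agents. -/

namespace IsLossReveal

variable {X : Type*} {M : RiskModel X} {r : ℝ → ℝ} {lam : ℝ}

section Fixed

variable {n : ℕ} {ty : Fin n → X} {Ω : Type*}
  [mΩ : MeasurableSpace Ω] {V : RevealData M ty Ω} {P : Measure Ω} {𝓖 : Filtration ℕ mΩ}

/-- The ratio of the probabilities of drawing without and with replacement. -/
noncomputable def _root_.RiskModel.matchFactor (M : RiskModel X) (ty : Fin n → X) (s : ℕ) : ℝ :=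
  (M.numLinks ty - s).factorial / (M.numLinks ty).factorial * (M.numLinks ty : ℝ) ^ s

theorem measure_dataEvent_le_one (hV : IsLossReveal V P 𝓖) {E : ∀ x, Set (M.AgentData x)}
    (hE : ∀ x, MeasurableSet (E x)) (hm : M.numLinks ty ≠ 0) (i : Fin n) :
    P (V.dataEvent E i) ≤ ENNReal.ofReal (M.matchFactor ty (M.inDeg (ty i))) *
      M.gridProb (ty i) n (M.numLinks ty) (E (ty i)) := by
  have h := hV.measure_dataEvent_le (a := fun _ : Unit => i) (fun _ _ _ => rfl) hE hm
  simpa [RiskModel.matchFactor] using h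

theorem measure_dataEvent_inter_le (hV : IsLossReveal V P 𝓖) {E : ∀ x, Set (M.AgentData x)}
    (hE : ∀ x, MeasurableSet (E x)) (hm : M.numLinks ty ≠ 0) {i j : Fin n} (hij : i ≠ j) :
    P (V.dataEvent E i ∩ V.dataEvent E j) ≤
      ENNReal.ofReal (M.matchFactor ty (M.inDeg (ty i) + M.inDeg (ty j))) *
        (M.gridProb (ty i) n (M.numLinks ty) (E (ty i)) *
          M.gridProb (ty j) n (M.numLinks ty) (E (ty j))) := by
  have h := hV.measure_dataEvent_le (a := ![i, j]) (fun a b hab => by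
    fin_cases a <;> fin_cases b <;> simp_all [eq_comm]) hE hm
  simp only [Fin.forall_fin_two, Fin.sum_univ_two, Fin.prod_univ_two, Matrix.cons_val_zero,
    Matrix.cons_val_one] at h
  exact h

/-- Almost surely every half-edge has exactly one position, so not having data in `E` means having
data in the complement. An upper bound for the latter is a lower bound for the event itself. -/
theorem measure_compl_dataEvent_le (hV : IsLossReveal V P 𝓖) {E : ∀ x, Set (M.AgentData x)}
    (i : Fin n) : P (V.dataEvent E i)ᶜ ≤ P (V.dataEvent (fun x => (E x)ᶜ) i) := by
  refine measure_mono_ae ?_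
  filter_upwards [hV.ae_bijective_tgt] with ω hω h
  obtain ⟨f, hf, -⟩ := V.exists_positions hω i
  exact (V.mem_dataEvent_iff hω.1 hf fun x => (E x)ᶜ).2 fun h' => h ((V.mem_dataEvent_iff hω.1 hf _).2 h')

end Fixed

variable {ty : ∀ n, Fin n → X} {Ω : ℕ → Type*} [mΩ : ∀ n, MeasurableSpace (Ω n)]
  {P : ∀ n, Measure (Ω n)} {𝓖 : ∀ n, Filtration ℕ (mΩ n)} {V : ∀ n, RevealData M (ty n) (Ω n)}

theorem tendsto_matchFactor (hlam : 0 < lam)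
    (hlam_lim : Tendsto (fun n => (M.numLinks (ty n) : ℝ) / n) atTop (𝓝 lam)) (s : ℕ) :
    Tendsto (fun n => M.matchFactor (ty n) s) atTop (𝓝 1) :=
  (tendsto_factorial_sub_div_mul_pow s).comp (RiskModel.tendsto_numLinks hlam hlam_lim)

theorem measurableSet_surviveFam (hr : ContinuousOn r (Ici 0)) (hpos : ∀ t, 0 ≤ t → 0 < r t)
    (θ : ℕ) (v : ℝ) (x : X) : MeasurableSet (M.surviveFam r θ v x) :=
  M.measurableSet_surviveSet (measurableSet_barrier hr hpos (M.α_cont x)) θ v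

theorem measurableSet_fragileFam (hr : ContinuousOn r (Ici 0)) (hpos : ∀ t, 0 ≤ t → 0 < r t)
    (η : ℝ) (x : X) : MeasurableSet (M.fragileFam r η x) :=
  M.measurableSet_fragileSet (measurableSet_barrier hr hpos (M.α_cont x)) η

/-- The probability of survival of an agent of the limiting model. -/
noncomputable def _root_.RiskModel.surviveProb (M : RiskModel X) (r : ℝ → ℝ) (lam : ℝ) (x : X)
    (θ : ℕ) (v : ℝ) : ℝ := (M.dataLaw x lam).real (M.surviveFam r θ v x)

theorem eventually_measureReal_dataEvent (hV : ∀ n, IsLossReveal (V n) (P n) (𝓖 n))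
    (hlam : 0 < lam) (hlam_lim : Tendsto (fun n => (M.numLinks (ty n) : ℝ) / n) atTop (𝓝 lam))
    (hr : ContinuousOn r (Ici 0)) (hpos : ∀ t, 0 ≤ t → 0 < r t) (x : X) (θ : ℕ) (v : ℝ) {e : ℝ}
    (he : 0 < e) :
    ∀ᶠ n in atTop, (∀ i, ty n i = x → M.surviveProb r lam x θ v - e ≤
        (P n).real ((V n).dataEvent (M.surviveFam r θ v) i)) ∧
      ∀ i j, ty n i = x → ty n j = x → i ≠ j →
        (P n).real ((V n).dataEvent (M.surviveFam r θ v) i ∩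
          (V n).dataEvent (M.surviveFam r θ v) j) ≤ M.surviveProb r lam x θ v ^ 2 + e := by
  have hl : Fact (0 < lam) := ⟨hlam⟩
  -- For `p, e' ≤ 1` the product `(1 + e') * (p + e') ^ 2` exceeds `p ^ 2` by at most `7 * e'`.
  obtain ⟨e', he', he1, hee⟩ : ∃ e' > 0, e' ≤ 1 ∧ 7 * e' ≤ e :=
    ⟨min 1 (e / 7), by positivity, min_le_left _ _, by linarith [min_le_right 1 (e / 7)]⟩
  obtain ⟨η, hη, hηe⟩ := M.exists_perturbProb_le (lam := lam) hr hpos x v he'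
  set p := M.surviveProb r lam x θ v with hp
  have hp0 : 0 ≤ p := measureReal_nonneg
  have hp1 : p ≤ 1 := measureReal_le_one
  have hB := measurableSet_barrier hr hpos (M.α_cont x)
  have hfac : ∀ s, ∀ᶠ n in atTop, M.matchFactor (ty n) s ≤ 1 + e' := fun s =>
    (tendsto_matchFactor hlam hlam_lim s).eventually (eventually_le_nhds (by linarith))
  filter_upwards [RiskModel.eventually_grid_close hlam hlam_lim hη, hfac (M.inDeg x),
    hfac (M.inDeg x + M.inDeg x)] with n ⟨hm, hgrid⟩ hf1 hf2
  have := (hV n).isProb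
  have hg1 : M.gridProb x n (M.numLinks (ty n)) (M.surviveFam r θ v x) ≤
      ENNReal.ofReal (p + e') := by
    refine (M.gridProb_surviveSet_le (barrier_mono _ _) hB hm hgrid).trans ?_
    rw [ENNReal.ofReal_add hp0 he'.le]
    exact add_le_add (by rw [hp, RiskModel.surviveProb, ofReal_measureReal]; rfl) hηe
  have hg2 : M.gridProb x n (M.numLinks (ty n)) (M.surviveFam r θ v x)ᶜ ≤
      ENNReal.ofReal (1 - p + e') := by
    refine (M.gridProb_compl_surviveSet_le (barrier_mono _ _) hB hm hgrid).trans ?_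
    rw [ENNReal.ofReal_add (by linarith) he'.le]
    refine add_le_add (le_of_eq ?_) hηe
    rw [hp, RiskModel.surviveProb, ← probReal_compl_eq_one_sub
      (measurableSet_surviveFam hr hpos θ v x), ofReal_measureReal]
    rfl
  have hE := measurableSet_surviveFam (M := M) hr hpos θ v
  constructor
  · rintro i rfl
    have h := ((hV n).measure_compl_dataEvent_le i).trans
      ((hV n).measure_dataEvent_le_one (fun x => (hE x).compl) hm i)
    have h2 : P n ((V n).dataEvent (M.surviveFam r θ v) i)ᶜ ≤
        ENNReal.ofReal ((1 + e') * (1 - p + e')) := by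
      rw [ENNReal.ofReal_mul (by linarith)]
      exact h.trans (mul_le_mul' (ENNReal.ofReal_le_ofReal hf1) hg2)
    have h3 := ENNReal.toReal_le_of_le_ofReal (by nlinarith) h2
    have h4 := probReal_compl_eq_one_sub (μ := P n) ((hV n).measurableSet_dataEvent hE i)
    rw [measureReal_def] at h4
    rw [h4] at h3
    nlinarith
  · rintro i j hi hj hij
    have h := (hV n).measure_dataEvent_inter_le hE hm hij
    rw [hi, hj] at h
    have h2 : P n ((V n).dataEvent (M.surviveFam r θ v) i ∩
        (V n).dataEvent (M.surviveFam r θ v) j) ≤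
        ENNReal.ofReal ((1 + e') * ((p + e') * (p + e'))) := by
      rw [ENNReal.ofReal_mul (by linarith), ENNReal.ofReal_mul (by linarith)]
      exact h.trans (mul_le_mul' (ENNReal.ofReal_le_ofReal hf2) (mul_le_mul' hg1 hg1))
    refine (ENNReal.toReal_le_of_le_ofReal (by positivity) h2).trans ?_
    have a1 : p * e' ≤ e' := mul_le_of_le_one_left he'.le hp1
    have a2 : e' * e' ≤ e' := mul_le_of_le_one_left he'.le he1
    have a3 : p * (p * e') ≤ e' := (mul_le_of_le_one_left (by positivity) hp1).trans a1
    have a4 : p * e' * e' ≤ e' := (mul_le_of_le_one_right (by positivity) he1).trans a1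
    have a5 : e' * e' * e' ≤ e' := (mul_le_of_le_one_right (by positivity) he1).trans a2
    nlinarith

open Classical in
/-- The number of agents of type `x`. -/
noncomputable def _root_.RiskModel.typeCount {n : ℕ} (ty : Fin n → X) (x : X) : ℕ :=
  Finset.card {i | ty i = x}

theorem withHighProb_abs_dataCount_surviveFam_sub_le (hV : ∀ n, IsLossReveal (V n) (P n) (𝓖 n))
    (hlam : 0 < lam) (hlam_lim : Tendsto (fun n => (M.numLinks (ty n) : ℝ) / n) atTop (𝓝 lam))
    (hr : ContinuousOn r (Ici 0)) (hpos : ∀ t, 0 ≤ t → 0 < r t) (x : X) (θ : ℕ) (v : ℝ) {η : ℝ}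
    (hη : 0 < η) :
    WithHighProb P fun n => {ω | |((V n).dataCount (M.surviveFam r θ v) x ω : ℝ) -
      RiskModel.typeCount (ty n) x * M.surviveProb r lam x θ v| ≤ η * n} := by
  classical
  have hl : Fact (0 < lam) := ⟨hlam⟩
  refine ENNReal.tendsto_nhds_zero.2 fun δ' hδ' => ?_
  obtain ⟨δ, hδ, hle⟩ : ∃ δ : ℝ, 0 < δ ∧ ENNReal.ofReal δ ≤ δ' := by
    rcases eq_or_ne δ' ∞ with rfl | hfin
    · exact ⟨1, one_pos, le_top⟩
    · exact ⟨δ'.toReal, ENNReal.toReal_pos hδ'.ne' hfin, by rw [ENNReal.ofReal_toReal hfin]⟩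
  -- With this `e` the pairs contribute at most `δ / 2` to the second moment bound; the diagonal
  -- contributes a multiple of `1 / n`.
  obtain ⟨e, he, hee⟩ : ∃ e > 0, 3 * e / η ^ 2 = δ / 2 :=
    ⟨δ * η ^ 2 / 6, by positivity, by field_simp; ring⟩
  have hinv := (tendsto_inv_atTop_nhds_zero_nat (𝕜 := ℝ)).const_mul (1 / η ^ 2)
  rw [mul_zero] at hinv
  filter_upwards [eventually_measureReal_dataEvent hV hlam hlam_lim hr hpos x θ v he,
    eventually_gt_atTop 0, hinv.eventually (eventually_le_nhds (half_pos hδ))] with n ⟨h1, h2⟩ hn h3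
  have := (hV n).isProb
  have hn' : (0 : ℝ) < n := by exact_mod_cast hn
  have h := measure_le_abs_count_sub (P := P n) (Finset.univ.filter fun i => ty n i = x)
    (A := (V n).dataEvent (M.surviveFam r θ v))
    (fun i _ => (hV n).measurableSet_dataEvent (measurableSet_surviveFam hr hpos θ v) i)
    (p := M.surviveProb r lam x θ v) (e := e) measureReal_nonneg measureReal_le_one he.le
    (fun i hi => h1 i (by simpa using hi))
    (fun i hi j hj hij => h2 i j (by simpa using hi) (by simpa using hj) hij)
    (mul_pos hη hn')
  refine le_trans (measure_mono fun ω hω => ?_)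
    (h.trans ((ENNReal.ofReal_le_ofReal ?_).trans hle))
  · simp only [mem_compl_iff, mem_ofPred_eq, not_le, RevealData.dataCount,
      RiskModel.typeCount] at hω ⊢
    rw [Finset.filter_filter]
    convert hω.le
  · set N := (Finset.univ.filter fun i => ty n i = x).card
    have hN : (N : ℝ) ≤ n := by
      have := Finset.card_filter_le (Finset.univ : Finset (Fin n)) fun i => ty n i = x
      rw [Finset.card_univ, Fintype.card_fin] at this
      exact_mod_cast this
    calc ((N : ℝ) + 3 * e * (N : ℝ) ^ 2) / (η * n) ^ 2 ≤ (n + 3 * e * (n : ℝ) ^ 2) / (η * n) ^ 2 := by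
          gcongr
      _ = 1 / η ^ 2 * (n : ℝ)⁻¹ + 3 * e / η ^ 2 := by field_simp
      _ ≤ δ := by rw [hee]; linarith

/-- Few agents are fragile under small perturbations. -/
theorem exists_eventually_dataCount_fragileFam (hV : ∀ n, IsLossReveal (V n) (P n) (𝓖 n))
    (hlam : 0 < lam) (hlam_lim : Tendsto (fun n => (M.numLinks (ty n) : ℝ) / n) atTop (𝓝 lam))
    (hr : ContinuousOn r (Ici 0)) (hpos : ∀ t, 0 ≤ t → 0 < r t) (x : X) {κ δ : ℝ}
    (hκ : 0 < κ) (hδ : 0 < δ) :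
    ∃ η₀ > 0, ∀ η, 0 < η → η ≤ η₀ → ∀ᶠ n in atTop,
      P n {ω | ((V n).dataCount (M.fragileFam r η) x ω : ℝ) ≤ κ * n}ᶜ ≤ ENNReal.ofReal δ := by
  classical
  have hl : Fact (0 < lam) := ⟨hlam⟩
  -- Markov's inequality at level `κ * n` needs probability `κ * δ` per agent. The factor `1 / 2`
  -- absorbs `matchFactor ≤ 2`, and halving `η₀` below absorbs the doubling of scale in
  -- `gridProb_fragileSet_le`.
  obtain ⟨η₀, hη₀, h⟩ := M.exists_fragile_le (lam := lam) hr hpos x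
    (show 0 < κ * δ / 2 by positivity)
  have hB := measurableSet_barrier hr hpos (M.α_cont x)
  refine ⟨η₀ / 2, by positivity, fun η hη hη' => ?_⟩
  filter_upwards [RiskModel.eventually_grid_close hlam hlam_lim hη, eventually_gt_atTop 0,
    (tendsto_matchFactor hlam hlam_lim (M.inDeg x)).eventually
      (eventually_le_nhds (show (1 : ℝ) < 2 by norm_num))] with n ⟨hm, hgrid⟩ hn hf
  have := (hV n).isProb
  have hn' : (0 : ℝ) < n := by exact_mod_cast hn
  have hE := measurableSet_fragileFam (M := M) hr hpos η
  have hP : ∀ i, ty n i = x → P n ((V n).dataEvent (M.fragileFam r η) i) ≤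
      ENNReal.ofReal (κ * δ) := by
    rintro i rfl
    refine ((hV n).measure_dataEvent_le_one hE hm i).trans ?_
    rw [show κ * δ = 2 * (κ * δ / 2) by ring, ENNReal.ofReal_mul (by norm_num)]
    refine mul_le_mul' (ENNReal.ofReal_le_ofReal hf) ?_
    exact (M.gridProb_fragileSet_le (barrier_mono _ _) hB hm hgrid).trans (h _ (by linarith))
  let I : Finset (Fin n) := {i | ty n i = x}
  have hcount : ∀ ω, ((V n).dataCount (M.fragileFam r η) x ω : ℝ≥0∞) =
      ∑ i ∈ I, ((V n).dataEvent (M.fragileFam r η) i).indicator 1 ω := by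
    intro ω
    rw [RevealData.dataCount, ← Finset.filter_filter, Finset.card_filter]
    push_cast
    refine Finset.sum_congr (by simp [I]) fun i _ => ?_
    by_cases hi : ω ∈ (V n).dataEvent (M.fragileFam r η) i <;> simp [hi]
  have hmeas : ∀ i, Measurable (((V n).dataEvent (M.fragileFam r η) i).indicator
      (1 : Ω n → ℝ≥0∞)) := fun i => measurable_one.indicator ((hV n).measurableSet_dataEvent hE i)
  have hint : ∫⁻ ω, ((V n).dataCount (M.fragileFam r η) x ω : ℝ≥0∞) ∂(P n) ≤
      n * ENNReal.ofReal (κ * δ) := by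
    simp only [hcount]
    rw [lintegral_finsetSum _ fun i _ => hmeas i]
    calc _ ≤ ∑ i ∈ I, ENNReal.ofReal (κ * δ) := Finset.sum_le_sum fun i hi => by
          rw [lintegral_indicator_one ((hV n).measurableSet_dataEvent hE i)]
          exact hP i (by simpa [I] using hi)
      _ ≤ _ := by
          rw [Finset.sum_const, nsmul_eq_mul]
          gcongr
          simpa using Finset.card_le_univ I
  have hmk := meas_ge_le_lintegral_div (μ := P n)
    (f := fun ω => ((V n).dataCount (M.fragileFam r η) x ω : ℝ≥0∞))
    (by simp only [hcount]; exact (Finset.measurable_sum _ fun i _ => hmeas i).aemeasurable)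
    (ε := ENNReal.ofReal (κ * n)) (by simpa using mul_pos hκ hn') ENNReal.ofReal_ne_top
  refine le_trans (measure_mono fun ω hω => ?_) (hmk.trans ?_)
  · simp only [mem_compl_iff, mem_ofPred_eq, not_le] at hω ⊢
    rw [← ENNReal.ofReal_natCast]
    exact ENNReal.ofReal_le_ofReal hω.le
  · refine ENNReal.div_le_of_le_mul (hint.trans_eq ?_)
    rw [← ENNReal.ofReal_natCast, ← ENNReal.ofReal_mul hn'.le, ← ENNReal.ofReal_mul hδ.le]
    congr 1
    ring

end IsLossReveal

/-! ### Deterministic estimates on regular outcomes. -/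

namespace RevealData

variable {X : Type*} {M : RiskModel X} {n : ℕ} {ty : Fin n → X} {Ω : Type*}
  (V : RevealData M ty Ω) {r : ℝ → ℝ} {lam : ℝ}

/-- The outcomes for which the reveals are close to their expected evolution. -/
structure IsRegular (r : ℝ → ℝ) (η : ℝ) (ω : Ω) : Prop where
  bijective_tgt : Function.Bijective fun k => V.tgt k ω
  clock_pos : ∀ k, 0 < V.clock k ω
  rate_nonneg : ∀ k, 0 ≤ V.rate k ω
  clockSum_close : ∀ k ≤ M.numLinks ty, |V.clockSum k ω - k| ≤ η * n
  intensityError_le : V.intensityError r ω ≤ ENNReal.ofReal η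

variable {V}

theorem IsRegular.abs_numRevealed_sub_le (hr : ContinuousOn r (Ici 0)) {η : ℝ} {ω : Ω}
    (hω : V.IsRegular r η ω) (hη : 0 < η) (hn : 1 ≤ η * n) {t : ℝ} (ht : 0 ≤ t)
    (htend : ENNReal.ofReal t ≤ V.endTime ω) :
    |(V.numRevealed ω t : ℝ) / n - cumRate r t| ≤ 3 * η :=
  V.abs_numRevealed_sub_cumRate_le hr hω.clock_pos hω.rate_nonneg hη.le hn hω.clockSum_close
    hω.intensityError_le ht htend

/-- There cannot be more reveals than links, so up to the end time `cumRate r` overshoots `lam` only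
slightly. -/
theorem IsRegular.cumRate_le (hr : ContinuousOn r (Ici 0)) {η : ℝ} {ω : Ω}
    (hω : V.IsRegular r η ω) (hη : 0 < η) (hn : 1 ≤ η * n)
    (hm : (M.numLinks ty : ℝ) / n ≤ lam + η) {t : ℝ} (ht : 0 ≤ t)
    (htend : ENNReal.ofReal t ≤ V.endTime ω) : cumRate r t ≤ lam + 4 * η := by
  have h1 := abs_le.1 (hω.abs_numRevealed_sub_le hr hη hn ht htend)
  have h2 : (V.numRevealed ω t : ℝ) / n ≤ M.numLinks ty / n := by
    gcongr; exact V.numRevealed_le ω t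
  linarith

theorem IsRegular.abs_numRevealed_sub_min_le (hr : ContinuousOn r (Ici 0)) {η : ℝ} {ω : Ω}
    (hω : V.IsRegular r η ω) (hη : 0 < η) (hn : 1 ≤ η * n)
    (hm : (M.numLinks ty : ℝ) / n ≤ lam + η) {t : ℝ} (ht : 0 ≤ t)
    (htend : ENNReal.ofReal t ≤ V.endTime ω) :
    |(V.numRevealed ω t : ℝ) / n - min (cumRate r t) lam| ≤ 7 * η := by
  have h1 := hω.abs_numRevealed_sub_le hr hη hn ht htend
  have h2 := hω.cumRate_le hr hη hn hm ht htend
  have h3 : |cumRate r t - min (cumRate r t) lam| ≤ 4 * η := by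
    rcases le_total (cumRate r t) lam with h | h
    · rw [min_eq_left h, sub_self, abs_zero]; positivity
    · rw [min_eq_right h, abs_of_nonneg (by linarith)]; linarith
  have := abs_sub_le ((V.numRevealed ω t : ℝ) / n) (cumRate r t) (min (cumRate r t) lam)
  linarith

/-- The reveal count over `n` is rounded down to a multiple `j * η`. Fragile agents cost `κ`;
rounding costs `η` and one extra agent, hence `2 * η`; concentration of the count and convergence of
the type fraction cost `η` each. The distance from `j * η` to the capped accumulated rate is at most
`8 * η`, which gives `8` units of `M.inDeg x * (η / lam)` by the Lipschitz bound. The overshoot of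
`4 * η` beyond `lam` gives another `8`. -/
theorem IsRegular.abs_Sx_sub_le (hr : ContinuousOn r (Ici 0)) (hpos : ∀ t, 0 ≤ t → 0 < r t)
    [hl : Fact (0 < lam)] {η κ μx : ℝ} {ω : Ω} {x : X} {θ J : ℕ} (hω : V.IsRegular r η ω)
    (hη : 0 < η) (hn : 1 ≤ η * n) (hm : (M.numLinks ty : ℝ) / n ≤ lam + η)
    (hJ : (lam + η) / η ≤ J) (hθ : θ ≤ M.inDeg x) (hμ0 : 0 ≤ μx) (hμ1 : μx ≤ 1)
    (hμ : |(RiskModel.typeCount ty x : ℝ) / n - μx| ≤ η)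
    (hfrag : (V.dataCount (M.fragileFam r (4 * η)) x ω : ℝ) ≤ κ * n)
    (hcount : ∀ j ∈ Finset.range (J + 1), |(V.dataCount (M.surviveFam r θ (j * η)) x ω : ℝ) -
      RiskModel.typeCount ty x * M.surviveProb r lam x θ (j * η)| ≤ η * n)
    {t : ℝ} (ht : 0 ≤ t) (htend : ENNReal.ofReal t ≤ V.endTime ω) :
    |(V.Sx x θ ω t : ℝ) / n - μx * M.limitSx r lam x θ t| ≤
      κ + (4 * η + 16 * (M.inDeg x * (η / lam))) := by
  have hlam := hl.out
  have hn0 : 0 < n := by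
    rcases Nat.eq_zero_or_pos n with h | h
    · subst h; norm_num at hn
    · exact h
  have hn' : (0 : ℝ) < n := by exact_mod_cast hn0
  have hN : ∀ t, 0 ≤ t → ENNReal.ofReal t ≤ V.endTime ω → _ :=
    fun t ht htend => hω.abs_numRevealed_sub_le hr hη hn ht htend
  have h1 := (V.abs_Sx_sub_dataCount_le hr hpos hω.clock_pos hω.bijective_tgt ht
    (V.abs_sub_cumRate_cumTime_le hω.clock_pos hn htend hN) x θ).trans hfrag
  set v : ℝ := (V.numRevealed ω t : ℝ) / n with hv
  have hv0 : 0 ≤ v := by positivity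
  have hvm : v ≤ lam + η := le_trans (by rw [hv]; gcongr; exact V.numRevealed_le ω t) hm
  set j := ⌊v / η⌋₊ with hj
  have hj1 : j * η ≤ v := by
    have := Nat.floor_le (div_nonneg hv0 hη.le)
    rwa [← hj, le_div_iff₀ hη] at this
  have hj2 : v - j * η ≤ η := by
    have := (Nat.lt_floor_add_one (v / η)).le
    rw [← hj, div_le_iff₀ hη] at this
    linarith
  have hjJ : j < J + 1 := by
    rw [Nat.lt_succ_iff, ← Nat.cast_le (α := ℝ)]
    refine le_trans (Nat.floor_le (div_nonneg hv0 hη.le)) (le_trans ?_ hJ)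
    gcongr
  have h2 := V.abs_dataCount_surviveFam_sub_le (r := r) hn0 hω.bijective_tgt x θ
    (show 0 ≤ j * η by positivity) hj1
  have h3 := hcount j (Finset.mem_range.2 hjJ)
  set p := M.surviveProb r lam x θ (j * η) with hp
  have hp0 : 0 ≤ p := measureReal_nonneg
  have hp1 : p ≤ 1 := measureReal_le_one
  have h4 := M.abs_measureReal_surviveSet_sub_le (x := x) (L := lam) (B := barrier r (M.α x)) θ
    (j * η) (min (cumRate r t) lam)
  have h5 := M.abs_surviveProb_sub_limitSx_le (x := x) hr hpos hθ (show 0 ≤ 4 * η by positivity) ht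
    (hω.cumRate_le hr hη hn hm ht htend)
  set q := (M.dataLaw x lam).real
    (M.surviveSet x (barrier r (M.α x)) θ (min (cumRate r t) lam)) with hq
  have h6 := hω.abs_numRevealed_sub_min_le hr hη hn hm ht htend
  rw [← hv] at h6
  have h7 : |j * η - min (cumRate r t) lam| ≤ 8 * η := by
    have := abs_sub_le (j * η) v (min (cumRate r t) lam)
    rw [abs_sub_comm _ v, abs_of_nonneg (sub_nonneg.2 hj1)] at this
    linarith
  have h8 : |p - q| ≤ 8 * (M.inDeg x * (η / lam)) := by
    refine h4.trans ?_
    rw [show 8 * (M.inDeg x * (η / lam)) = M.inDeg x * (8 * η / lam) by ring]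
    gcongr
  have h9 : |p - M.limitSx r lam x θ t| ≤ 16 * (M.inDeg x * (η / lam)) := by
    have e := abs_sub_le p q (M.limitSx r lam x θ t)
    have e2 : 2 * (M.inDeg x * (4 * η / lam)) = 8 * (M.inDeg x * (η / lam)) := by ring
    rw [e2] at h5
    linarith
  have h10 : |(V.Sx x θ ω t : ℝ) / n - RiskModel.typeCount ty x / n * p| ≤ κ + 3 * η := by
    rw [show (V.Sx x θ ω t : ℝ) / n - RiskModel.typeCount ty x / n * p =
      ((V.Sx x θ ω t : ℝ) - RiskModel.typeCount ty x * p) / n by ring, abs_div, abs_of_pos hn',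
      div_le_iff₀ hn']
    have e1 := abs_sub_le (V.Sx x θ ω t : ℝ) (V.dataCount (M.surviveFam r θ v) x ω)
      (RiskModel.typeCount ty x * p)
    have e2 := abs_sub_le (V.dataCount (M.surviveFam r θ v) x ω : ℝ)
      (V.dataCount (M.surviveFam r θ (j * η)) x ω) (RiskModel.typeCount ty x * p)
    rw [abs_sub_comm (V.dataCount (M.surviveFam r θ v) x ω : ℝ)
      (V.dataCount (M.surviveFam r θ (j * η)) x ω)] at e2
    have e3 : n * (v - j * η) ≤ n * η := mul_le_mul_of_nonneg_left hj2 hn'.le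
    linarith
  have h11 : |RiskModel.typeCount ty x / n * p - μx * p| ≤ η := by
    rw [← sub_mul, abs_mul, abs_of_nonneg hp0]
    exact (mul_le_of_le_one_right (abs_nonneg _) hp1).trans hμ
  have h12 : |μx * p - μx * M.limitSx r lam x θ t| ≤ 16 * (M.inDeg x * (η / lam)) := by
    rw [← mul_sub, abs_mul, abs_of_nonneg hμ0]
    exact (mul_le_of_le_one_left (abs_nonneg _) hμ1).trans h9
  have e1 := abs_sub_le ((V.Sx x θ ω t : ℝ) / n) (RiskModel.typeCount ty x / n * p)
    (μx * M.limitSx r lam x θ t)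
  have e2 := abs_sub_le (RiskModel.typeCount ty x / n * p) (μx * p) (μx * M.limitSx r lam x θ t)
  linarith

variable (V)

theorem card_lossesOf_le {ω : Ω} (hbij : Function.Bijective fun k => V.tgt k ω) (i : Fin n)
    (t : ℝ) : (V.lossesOf i ω t).card ≤ M.inDeg (ty i) := by
  obtain ⟨f, -, hf⟩ := V.exists_positions hbij i
  have : V.lossesOf i ω t ⊆ Finset.univ.map f := fun k hk => by
    obtain ⟨j, hj⟩ := hf k (Finset.mem_filter.1 hk).2
    exact Finset.mem_map.2 ⟨j, Finset.mem_univ _, hj⟩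
  simpa using Finset.card_le_card this

/-- The total weight of the solvent agents. -/
noncomputable def solventWeight (w : X → ℕ) (ω : Ω) (t : ℝ) : ℕ :=
  ∑ i ∈ (V.ruined ω t)ᶜ, w (ty i)

open Classical in
theorem sum_filter_solvent_eq {ω : Ω} (hbij : Function.Bijective fun k => V.tgt k ω)
    (w : X → ℕ) (F : Finset X) (t : ℝ) :
    ∑ i ∈ (V.ruined ω t)ᶜ with ty i ∈ F, w (ty i) =
      ∑ x ∈ F, ∑ θ ∈ Finset.range (M.inDeg x + 1), w x * V.Sx x θ ω t := by
  rw [Finset.sum_sigma',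
    ← Finset.sum_fiberwise_of_maps_to (t := F.sigma fun x => Finset.range (M.inDeg x + 1))
    (g := fun i => (⟨ty i, (V.lossesOf i ω t).card⟩ : Σ _ : X, ℕ))]
  · refine Finset.sum_congr rfl fun p hp => ?_
    rw [Finset.sum_congr (g := fun _ => w p.1) rfl, Finset.sum_const, smul_eq_mul, mul_comm, Sx,
      Finset.filter_filter]
    · congr 2
      ext i
      have := (Finset.mem_sigma.1 hp).1
      obtain ⟨x, θ⟩ := p
      simp only [Finset.mem_filter, Finset.mem_compl, Sigma.mk.injEq, heq_eq_eq]
      constructor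
      · rintro ⟨h1, h2, h3⟩; exact ⟨h1, h3⟩
      · rintro ⟨h1, h2⟩; exact ⟨h1, by rw [h2.1]; exact this, h2⟩
    · intro i hi
      rw [← (Finset.mem_filter.1 hi).2]
  · intro i hi
    exact Finset.mem_sigma.2 ⟨(Finset.mem_filter.1 hi).2, Finset.mem_range.2
      (Nat.lt_succ_of_le (V.card_lossesOf_le hbij i t))⟩

theorem sum_typeCount_eq (w : X → ℕ) (F : Finset X) [DecidablePred fun i => ty i ∈ F] :
    ∑ i with ty i ∈ F, w (ty i) = ∑ x ∈ F, w x * RiskModel.typeCount ty x := by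
  classical
  rw [← Finset.sum_fiberwise_of_maps_to (t := F) (g := ty) fun i hi => (Finset.mem_filter.1 hi).2]
  refine Finset.sum_congr rfl fun x hx => ?_
  rw [Finset.sum_congr (g := fun _ => w x) rfl fun i hi => by rw [(Finset.mem_filter.1 hi).2],
    Finset.sum_const, smul_eq_mul, mul_comm, RiskModel.typeCount, Finset.filter_filter]
  congr 2
  ext i
  simp only [Finset.mem_filter, Finset.mem_univ, true_and, and_iff_right_iff_imp]
  rintro rfl
  exact hx

end RevealData

namespace RiskModel

variable {X : Type*} (M : RiskModel X) {r : ℝ → ℝ} {lam : ℝ}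

theorem typeFraction_eq {n : ℕ} (ty : Fin n → X) (x : X) :
    typeFraction ty x = typeCount ty x / n := by
  classical
  rw [typeFraction, typeCount, Nat.card_eq_fintype_card, Fintype.card_subtype]

theorem limitSx_nonneg (hr : ContinuousOn r (Ici 0)) (hpos : ∀ t, 0 ≤ t → 0 < r t) (hlam : 0 < lam)
    (x : X) (θ : ℕ) {t : ℝ} (ht : 0 ≤ t) : 0 ≤ M.limitSx r lam x θ t := by
  have h0 : 0 ≤ cumRate r t := cumRate_nonneg hr hpos t
  rw [limitSx, mul_revealFraction hr hpos hlam ht]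
  exact mul_nonneg (binomProb_nonneg (div_nonneg (le_min h0 hlam.le) hlam.le)
    ((div_le_one hlam).2 (min_le_right _ _))) (M.survival_nonneg _ _)

theorem sum_limitSx_le_one (hr : ContinuousOn r (Ici 0)) (hpos : ∀ t, 0 ≤ t → 0 < r t)
    (hlam : 0 < lam) (x : X) {t : ℝ} (ht : 0 ≤ t) :
    ∑ θ ∈ Finset.range (M.inDeg x + 1), M.limitSx r lam x θ t ≤ 1 := by
  have h0 : 0 ≤ cumRate r t := cumRate_nonneg hr hpos t
  rw [← sum_binomProb (M.inDeg x) (revealFraction r lam t)]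
  refine Finset.sum_le_sum fun θ _ => ?_
  refine mul_le_of_le_one_right ?_ (M.survival_le_one hr hpos θ ht)
  rw [mul_revealFraction hr hpos hlam ht]
  exact binomProb_nonneg (div_nonneg (le_min h0 hlam.le) hlam.le)
    ((div_le_one hlam).2 (min_le_right _ _))

end RiskModel

/-! ### Limits in probability. -/

section Limits

variable {X : Type*} {M : RiskModel X} {r : ℝ → ℝ} {lam : ℝ} {ty : ∀ n, Fin n → X} {Ω : ℕ → Type*}
  [mΩ : ∀ n, MeasurableSpace (Ω n)] {P : ∀ n, Measure (Ω n)} {𝓖 : ∀ n, Filtration ℕ (mΩ n)}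
  {V : ∀ n, RevealData M (ty n) (Ω n)}

theorem withHighProb_isRegular (hV : ∀ n, IsLossReveal (V n) (P n) (𝓖 n))
    (hlam_lim : Tendsto (fun n => (M.numLinks (ty n) : ℝ) / n) atTop (𝓝 lam))
    (hr_lim : TendstoZeroInProb P fun n => (V n).intensityError r) {η : ℝ} (hη : 0 < η) :
    WithHighProb P fun n => {ω | (V n).IsRegular r η ω} :=
  (((WithHighProb.of_ae fun n => (hV n).ae_bijective_tgt).inter
    (IsLossReveal.withHighProb_forall_abs_clockSum_sub_le hV hlam_lim hη)).inter
    (tendstoZeroInProb_iff.1 hr_lim η hη)).mono (Eventually.of_forall fun n ω hω =>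
      ⟨hω.1.1, fun k => (hV n).clock_pos k ω, fun k => (hV n).rate_nonneg k ω, hω.1.2, hω.2.le⟩)

theorem tendstoZeroInProb_supError {F : ∀ n, Ω n → ℝ → ℕ} {f : ℝ → ℝ}
    (h : ∀ ε : ℝ, 0 < ε → WithHighProb P fun n => {ω | ∀ t, 0 ≤ t →
      ENNReal.ofReal t ≤ (V n).endTime ω → |(F n ω t : ℝ) / n - f t| ≤ ε}) :
    TendstoZeroInProb P fun n => (V n).supError (F n) f := by
  refine tendstoZeroInProb_iff.2 fun ε hε => (h _ (half_pos hε)).mono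
    (Eventually.of_forall fun n ω hω => ?_)
  refine lt_of_le_of_lt (iSup₂_le fun t ht => ENNReal.ofReal_le_ofReal (hω t ht.1 ht.2)) ?_
  exact (ENNReal.ofReal_lt_ofReal_iff hε).2 (half_lt_self hε)

theorem eventually_one_le_mul {η : ℝ} (hη : 0 < η) : ∀ᶠ n : ℕ in atTop, 1 ≤ η * n :=
  (tendsto_natCast_atTop_atTop.const_mul_atTop hη).eventually_ge_atTop 1

/-- The scale `η` is chosen after `δ`, so that few agents are fragile outside probability `δ`. All
other estimates used have probability tending to one for each fixed `η`. -/
theorem withHighProb_abs_Sx_sub_le (hV : ∀ n, IsLossReveal (V n) (P n) (𝓖 n)) (hlam : 0 < lam)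
    (hlam_lim : Tendsto (fun n => (M.numLinks (ty n) : ℝ) / n) atTop (𝓝 lam))
    (hr : ContinuousOn r (Ici 0)) (hpos : ∀ t, 0 ≤ t → 0 < r t)
    (hr_lim : TendstoZeroInProb P fun n => (V n).intensityError r) {x : X} {μx : ℝ}
    (hμ0 : 0 ≤ μx) (hμ1 : μx ≤ 1)
    (hμ : Tendsto (fun n => RiskModel.typeFraction (ty n) x) atTop (𝓝 μx)) {θ : ℕ}
    (hθ : θ ≤ M.inDeg x) {ε : ℝ} (hε : 0 < ε) :
    WithHighProb P fun n => {ω | ∀ t, 0 ≤ t → ENNReal.ofReal t ≤ (V n).endTime ω →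
      |((V n).Sx x θ ω t : ℝ) / n - μx * M.limitSx r lam x θ t| ≤ ε} := by
  have hl : Fact (0 < lam) := ⟨hlam⟩
  refine WithHighProb.of_forall_exists fun δ hδ => ?_
  obtain ⟨η₀, hη₀, hfrag⟩ := IsLossReveal.exists_eventually_dataCount_fragileFam hV hlam hlam_lim
    hr hpos x (half_pos hε) hδ
  obtain ⟨η, hη, hη1, hη2⟩ : ∃ η > 0, 4 * η ≤ η₀ ∧
      4 * η + 16 * (M.inDeg x * (η / lam)) ≤ ε / 2 := by
    have hc : 0 < 4 + 16 * (M.inDeg x / lam) := by positivity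
    refine ⟨min (η₀ / 4) (ε / 2 / (4 + 16 * (M.inDeg x / lam))), by positivity, ?_, ?_⟩
    · linarith [min_le_left (η₀ / 4) (ε / 2 / (4 + 16 * (M.inDeg x / lam)))]
    · have := min_le_right (η₀ / 4) (ε / 2 / (4 + 16 * (M.inDeg x / lam)))
      rw [le_div_iff₀ hc] at this
      refine le_trans (le_of_eq ?_) this
      ring
  obtain ⟨J, hJ⟩ := exists_nat_ge ((lam + η) / η)
  refine ⟨_, hfrag (4 * η) (by positivity) hη1, ?_⟩
  have h1 := (withHighProb_isRegular hV hlam_lim hr_lim hη).inter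
    (WithHighProb.finset_inter (Finset.range (J + 1)) fun j _ =>
      IsLossReveal.withHighProb_abs_dataCount_surviveFam_sub_le hV hlam hlam_lim hr hpos x θ
        (j * η) hη)
  refine h1.mono ?_
  filter_upwards [eventually_one_le_mul hη,
    hlam_lim.eventually (eventually_le_nhds (lt_add_of_pos_right lam hη)),
    Metric.tendsto_nhds.1 hμ _ hη] with n hn hm hμn ω hω
  by_cases hF : ω ∈ {ω | ((V n).dataCount (M.fragileFam r (4 * η)) x ω : ℝ) ≤ ε / 2 * n}
  · refine Or.inl fun t ht htend => ?_
    rw [Real.dist_eq, RiskModel.typeFraction_eq] at hμn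
    refine (hω.1.abs_Sx_sub_le hr hpos hη hn hm hJ hθ hμ0 hμ1 hμn.le hF hω.2 ht htend).trans ?_
    linarith
  · exact Or.inr hF

/-- A finite set `F` of types carries all but `ε / 4` of the limiting weight. Since the total weight
converges as well, the weight of the agents with types outside `F` is eventually at most `ε / 2` per
agent of the population, ruined or not. Weight `1` gives `S`; weight `outDeg` serves for `W`. -/
theorem withHighProb_abs_solventWeight_sub_le (hV : ∀ n, IsLossReveal (V n) (P n) (𝓖 n))
    (hlam : 0 < lam) (hlam_lim : Tendsto (fun n => (M.numLinks (ty n) : ℝ) / n) atTop (𝓝 lam))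
    (hr : ContinuousOn r (Ici 0)) (hpos : ∀ t, 0 ≤ t → 0 < r t)
    (hr_lim : TendstoZeroInProb P fun n => (V n).intensityError r) {μ : X → ℝ}
    (hμ0 : ∀ x, 0 ≤ μ x) (hμ1 : ∀ x, μ x ≤ 1)
    (hμ : ∀ x, Tendsto (fun n => RiskModel.typeFraction (ty n) x) atTop (𝓝 (μ x))) {w : X → ℕ}
    {L : ℝ} (hw : HasSum (fun x => μ x * w x) L)
    (hw_lim : Tendsto (fun n => ((∑ i, w (ty n i) : ℕ) : ℝ) / n) atTop (𝓝 L)) {ε : ℝ}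
    (hε : 0 < ε) :
    WithHighProb P fun n => {ω | ∀ t, 0 ≤ t → ENNReal.ofReal t ≤ (V n).endTime ω →
      |((V n).solventWeight w ω t : ℝ) / n -
        ∑' x, μ x * w x * ∑ θ ∈ Finset.range (M.inDeg x + 1), M.limitSx r lam x θ t| ≤ ε} := by
  classical
  obtain ⟨F, hF⟩ := (hw.eventually (lt_mem_nhds (show L - ε / 4 < L by linarith))).exists
  set c : ℝ := ∑ x ∈ F, ∑ θ ∈ Finset.range (M.inDeg x + 1), (w x : ℝ) with hc
  have hc0 : 0 ≤ c := by positivity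
  obtain ⟨ε', hε', hcε⟩ : ∃ ε' > 0, c * ε' ≤ ε / 4 := by
    refine ⟨ε / 4 / (c + 1), by positivity, ?_⟩
    rw [← mul_div_assoc, div_le_iff₀ (by positivity)]
    nlinarith
  have h1 := (withHighProb_isRegular hV hlam_lim hr_lim one_pos).inter
    (WithHighProb.finset_inter F fun x _ =>
      WithHighProb.finset_inter (Finset.range (M.inDeg x + 1)) fun θ hθ =>
        withHighProb_abs_Sx_sub_le hV hlam hlam_lim hr hpos hr_lim (hμ0 x) (hμ1 x) (hμ x)
          (Nat.lt_succ_iff.1 (Finset.mem_range.1 hθ)) hε')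
  have htail : Tendsto (fun n => ((∑ i, w (ty n i) : ℕ) : ℝ) / n -
      ∑ x ∈ F, RiskModel.typeFraction (ty n) x * w x) atTop (𝓝 (L - ∑ x ∈ F, μ x * w x)) :=
    hw_lim.sub (tendsto_finsetSum _ fun x _ => (hμ x).mul_const _)
  refine h1.mono ?_
  filter_upwards [eventually_gt_atTop 0, htail.eventually (eventually_le_nhds
    (show L - ∑ x ∈ F, μ x * w x < ε / 2 by linarith))] with n hn htn ω hω t ht htend
  have hn' : (0 : ℝ) < n := by exact_mod_cast hn
  set G : X → ℝ := fun x => ∑ θ ∈ Finset.range (M.inDeg x + 1), M.limitSx r lam x θ t with hG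
  have hG0 : ∀ x, 0 ≤ G x := fun x =>
    Finset.sum_nonneg fun θ _ => M.limitSx_nonneg hr hpos hlam x θ ht
  have hG1 : ∀ x, G x ≤ 1 := fun x => M.sum_limitSx_le_one hr hpos hlam x ht
  have hwn : ∀ x, 0 ≤ μ x * w x := fun x => mul_nonneg (hμ0 x) (Nat.cast_nonneg _)
  have hle : ∀ x, μ x * w x * G x ≤ μ x * w x := fun x => mul_le_of_le_one_right (hwn x) (hG1 x)
  have hge : ∀ x, 0 ≤ μ x * w x * G x := fun x => mul_nonneg (hwn x) (hG0 x)
  have hsum : Summable fun x => μ x * w x * G x := Summable.of_nonneg_of_le hge hle hw.summable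
  -- the limit
  have hl1 : ∑ x ∈ F, μ x * w x * G x ≤ ∑' x, μ x * w x * G x :=
    hsum.sum_le_tsum F fun x _ => hge x
  have hl2 : ∑' x, μ x * w x * G x - ∑ x ∈ F, μ x * w x * G x ≤ L - ∑ x ∈ F, μ x * w x := by
    have := (hw.summable.sub hsum).sum_le_tsum F fun x _ => sub_nonneg.2 (hle x)
    rw [hw.summable.tsum_sub hsum, hw.tsum_eq, Finset.sum_sub_distrib] at this
    linarith
  -- the process
  have hsplit := Finset.sum_filter_add_sum_filter_not ((V n).ruined ω t)ᶜ (fun i => ty n i ∈ F)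
    fun i => w (ty n i)
  rw [(V n).sum_filter_solvent_eq hω.1.bijective_tgt] at hsplit
  have hall := Finset.sum_filter_add_sum_filter_not Finset.univ (fun i => ty n i ∈ F)
    fun i => w (ty n i)
  rw [RevealData.sum_typeCount_eq] at hall
  have hrest : ∑ i ∈ ((V n).ruined ω t)ᶜ with ¬ ty n i ∈ F, w (ty n i) ≤
      ∑ i with ¬ ty n i ∈ F, w (ty n i) :=
    Finset.sum_le_sum_of_subset (Finset.filter_subset_filter _ (Finset.subset_univ _))
  set A := ∑ i ∈ ((V n).ruined ω t)ᶜ with ¬ ty n i ∈ F, w (ty n i)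
  set B := ∑ i with ¬ ty n i ∈ F, w (ty n i)
  have hB : (B : ℝ) / n ≤ ε / 2 := by
    refine le_trans (le_of_eq ?_) htn
    rw [← hall]
    push_cast
    rw [add_div, Finset.sum_div]
    have : ∀ x ∈ F, RiskModel.typeFraction (ty n) x * w x =
        (w x : ℝ) * RiskModel.typeCount (ty n) x / n := fun x _ => by
      rw [RiskModel.typeFraction_eq]; ring
    rw [Finset.sum_congr rfl this]
    ring
  have hA : (A : ℝ) / n ≤ ε / 2 := le_trans (by gcongr) hB
  have hA0 : 0 ≤ (A : ℝ) / n := by positivity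
  have hmain : |∑ x ∈ F, ∑ θ ∈ Finset.range (M.inDeg x + 1), (w x : ℝ) * ((V n).Sx x θ ω t) / n -
      ∑ x ∈ F, μ x * w x * G x| ≤ ε / 4 := by
    refine le_trans ?_ hcε
    simp only [hG, Finset.mul_sum, ← Finset.sum_sub_distrib, hc, Finset.sum_mul]
    refine (Finset.abs_sum_le_sum_abs _ _).trans (Finset.sum_le_sum fun x hx =>
      (Finset.abs_sum_le_sum_abs _ _).trans (Finset.sum_le_sum fun θ hθ => ?_))
    have := hω.2 x hx θ hθ t ht htend
    rw [show (w x : ℝ) * ((V n).Sx x θ ω t) / n - μ x * w x * M.limitSx r lam x θ t =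
      w x * (((V n).Sx x θ ω t : ℝ) / n - μ x * M.limitSx r lam x θ t) by ring, abs_mul,
      abs_of_nonneg (Nat.cast_nonneg _)]
    gcongr
  have hQ : ((V n).solventWeight w ω t : ℝ) / n =
      ∑ x ∈ F, ∑ θ ∈ Finset.range (M.inDeg x + 1), (w x : ℝ) * ((V n).Sx x θ ω t) / n + A / n := by
    rw [RevealData.solventWeight, ← hsplit]
    push_cast
    simp only [add_div, Finset.sum_div]
  rw [hQ]
  rw [abs_le] at hmain ⊢
  constructor <;> linarith

end Limits

theorem mainTheorem1 {X : Type*} [Countable X] (M : RiskModel X)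
    -- for every `n`, the types of the `n` agents; in-degrees and out-degrees have equal sums
    (ty : ∀ n, Fin n → X)
    (hdeg : ∀ n, ∑ i, M.inDeg (ty n i) = ∑ i, M.outDeg (ty n i))
    -- the fractions of agents of the various types converge to a probability distribution
    (μ : X → ℝ) (hμ_nonneg : ∀ x, 0 ≤ μ x) (hμ_sum : HasSum μ 1)
    (hμ_lim : ∀ x, Tendsto (fun n => RiskModel.typeFraction (ty n) x) atTop (𝓝 (μ x)))
    -- the average degrees converge to those of the limiting distribution
    (lam : ℝ) (hlam_pos : 0 < lam)
    (hlam_in : HasSum (fun x => (M.inDeg x : ℝ) * μ x) lam)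
    (hlam_out : HasSum (fun x => (M.outDeg x : ℝ) * μ x) lam)
    (hlam_lim : Tendsto (fun n => (M.numLinks (ty n) : ℝ) / n) atTop (𝓝 lam))
    -- for every `n`, a loss reveal process
    {Ω : ℕ → Type*} [mΩ : ∀ n, MeasurableSpace (Ω n)] (P : ∀ n, Measure (Ω n))
    (𝓖 : ∀ n, Filtration ℕ (mΩ n)) (V : ∀ n, RevealData M (ty n) (Ω n))
    (hV : ∀ n, IsLossReveal (V n) (P n) (𝓖 n))
    -- its intensity is `n r(t) + o_p(n)` up to the end time
    (r : ℝ → ℝ) (hr_cont : ContinuousOn r (Ici 0)) (hr_pos : ∀ t, 0 ≤ t → 0 < r t)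
    (hr_int : IntegrableOn r (Ici 0))
    (hr_lim : TendstoZeroInProb P fun n => (V n).intensityError r) :
    (∀ x, ∀ θ ≤ M.inDeg x, TendstoZeroInProb P fun n =>
      (V n).supError ((V n).Sx x θ) fun t => μ x * M.limitSx r lam x θ t) ∧
    (TendstoZeroInProb P fun n => (V n).supError (V n).S (M.limitS r lam μ)) ∧
    (TendstoZeroInProb P fun n => (V n).supError (V n).D (M.limitD r lam μ)) ∧
    (TendstoZeroInProb P fun n => (V n).supError (V n).W (M.limitW r lam μ)) := by
  have hμ1 : ∀ x, μ x ≤ 1 := fun x => le_hasSum hμ_sum x fun y _ => hμ_nonneg y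
  have hS : ∀ ε : ℝ, 0 < ε → WithHighProb P fun n => {ω | ∀ t, 0 ≤ t →
      ENNReal.ofReal t ≤ (V n).endTime ω → |((V n).S ω t : ℝ) / n - M.limitS r lam μ t| ≤ ε} := by
    intro ε hε
    refine (withHighProb_abs_solventWeight_sub_le hV hlam_pos hlam_lim hr_cont hr_pos hr_lim
      hμ_nonneg hμ1 hμ_lim (w := fun _ => 1) (L := 1) (by simpa using hμ_sum)
      (tendsto_const_nhds.congr' ?_) hε).mono (Eventually.of_forall fun n ω hω t ht htend => ?_)
    · filter_upwards [eventually_gt_atTop 0] with n hn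
      have : (n : ℝ) ≠ 0 := by positivity
      simp [this]
    · have := hω t ht htend
      simpa [RevealData.solventWeight, RevealData.S, RiskModel.limitS] using this
  refine ⟨fun x θ hθ => tendstoZeroInProb_supError fun ε hε => withHighProb_abs_Sx_sub_le hV
    hlam_pos hlam_lim hr_cont hr_pos hr_lim (hμ_nonneg x) (hμ1 x) (hμ_lim x) hθ hε,
    tendstoZeroInProb_supError hS, tendstoZeroInProb_supError fun ε hε => (hS ε hε).mono ?_,
    tendstoZeroInProb_supError fun ε hε => ?_⟩
  · filter_upwards [eventually_gt_atTop 0] with n hn ω hω t ht htend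
    have hn' : (n : ℝ) ≠ 0 := by positivity
    have h1 : (V n).D ω t + (V n).S ω t = n := by
      rw [RevealData.D, RevealData.S, Finset.card_add_card_compl, Fintype.card_fin]
    have h2 : ((V n).D ω t : ℝ) / n = 1 - (V n).S ω t / n := by
      have h1 : ((V n).D ω t : ℝ) + (V n).S ω t = n := by exact_mod_cast h1
      rw [eq_sub_iff_add_eq, ← add_div, h1, div_self hn']
    rw [h2, RiskModel.limitD, sub_sub_sub_cancel_left, abs_sub_comm]
    exact hω t ht htend
  -- A third of `ε` each for the number of links, the reveal count, whose error is `7 * (ε / 21)`,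
  -- and the out-degrees of the solvent agents.
  · have hη : 0 < ε / 21 := by positivity
    refine ((withHighProb_isRegular hV hlam_lim hr_lim hη).inter
      (withHighProb_abs_solventWeight_sub_le hV hlam_pos hlam_lim hr_cont hr_pos hr_lim
        hμ_nonneg hμ1 hμ_lim (w := M.outDeg) (L := lam) (by simpa [mul_comm] using hlam_out)
        (by simpa [RiskModel.numLinks, hdeg] using hlam_lim)
        (show 0 < ε / 3 by positivity))).mono ?_
    filter_upwards [eventually_one_le_mul hη,
      hlam_lim.eventually (eventually_le_nhds (lt_add_of_pos_right lam hη)),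
      Metric.tendsto_nhds.1 hlam_lim (ε / 3) (by positivity)] with n hn hm hm' ω hω t ht htend
    rw [Real.dist_eq] at hm'
    have h1 := (V n).W_add_numRevealed (fun k => (hV n).clock_pos k ω)
      (fun k => (hV n).src_ruinous k ω) (fun k => IsLossReveal.rate_stop (hV n) k ω) ht
    have h2 := Finset.sum_add_sum_compl ((V n).ruined ω t) fun i => M.outDeg (ty n i)
    rw [← h1, ← hdeg n] at h2
    have h2 : ((V n).W ω t : ℝ) + (V n).numRevealed ω t + (V n).solventWeight M.outDeg ω t =
      M.numLinks (ty n) := by exact_mod_cast h2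
    have h3 : ((V n).W ω t : ℝ) / n = M.numLinks (ty n) / n - (V n).numRevealed ω t / n -
      (V n).solventWeight M.outDeg ω t / n := by rw [← h2]; ring
    have h4 := hω.1.abs_numRevealed_sub_min_le hr_cont hη hn hm ht htend
    have h5 := hω.2 t ht htend
    have h6 : lam * (1 - revealFraction r lam t) = lam - min (cumRate r t) lam := by
      rw [mul_revealFraction hr_cont hr_pos hlam_pos ht]
      field_simp
    rw [h3, RiskModel.limitW, h6]
    rw [abs_le] at h4 h5 ⊢
    have h7 := abs_lt.1 hm'
    constructor <;> linarith
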